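/- **Setting.** Let $k$ be a field. *Highest weight category.* Let $\mathcal C$ be a $k$-linear abelian category in which every object has finite length, and $\Lambda$ a poset, with objects $\Delta(\lambda)\in\mathcal C$ ($\lambda\in\Lambda$) such that: (HW1) $\operatorname{End}(\Delta(\lambda))=k$; (HW2) $\Delta(\lambda)$ has a unique simple quotient $L(\lambda)$, and each simple object is isomorphic to precisely one $L(\lambda)$; (HW3) there is a projective object $P(\lambda)$ with a finite filtration with top quotient $\Delta(\lambda)$ and all other successive quotients of the form $\Delta(\mu)$, $\mu>\lambda$; (HW4) the multiplicity of $L(\mu)$ in $\Delta(\lambda)$ equals that of $\Delta(\lambda)$ in the filtration of $P(\mu)$. *$\mathfrak{sl}_2$-categorification.* Let $E,F$ be exact $k$-linear endofunctors of $\mathcal C$ with a fixed adjunction making $E$ left adjoint to $F$, such that $F$ is also isomorphic to a left adjoint of $E$; the operators $e=[E]$, $f=[F]$ define a locally finite action of $\mathfrak{sl}_2$ over $\mathbb Q$ on $\mathbb Q\otimes_{\mathbb Z}K(\mathcal C)$, with $h=[e,f]$; and the classes of simple objects are weight vectors. Let also $X\in\operatorname{End}(E)$, $T\in\operatorname{End}(E^2)$,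 $q\in k^\times$, $a\in k$ (with $a\ne0$ if $q\neq1$) be given with $(1_ET)(T1_E)(1_ET)=(T1_E)(1_ET)(T1_E)$ in $\operatorname{End}(E^3)$; $(T+1)(T-q)=0$; $T(1_EX)T=qX1_E$ if $q\ne1$ and $T(1_EX)T=X1_E-T$ if $q=1$; and $X-a$ locally nilpotent, i.e. nilpotent on $E(M)$ for every object $M$. *Compatibility.* For $\alpha,\beta\in\mathbb C$ write $\alpha<\beta$ if $\beta-\alpha$ is a positive integer. Let a function $c:\Lambda\to\mathbb C$, a partition $\Lambda=\bigsqcup_{a\in\mathfrak A}\Lambda_a$, integers $n_a\ge0$, bijections $\sigma_a:\{+,-\}^{n_a}\to\Lambda_a$ and functions $d_a:\{1,\dots,n_a\}\to\mathbb C$ be given. For $t\in\{+,-\}^{n_a}$ let $t^j$ (if $t_j=+$) and $\bar t^l$ (if $t_l=-$) be obtained from $t$ by changing the sign at the place $j$, resp. $l$. Assume: (HWC0) $E$ and $F$ preserve the objects that have a finite filtration whose successive quotients are of the form $\Delta(\lambda)$; (HWC1) $\lambda<\mu$ implies $c(\lambda)>c(\mu)$; (HWC2) $[E\Delta(\sigma_a(t))]=\sum_{j:\,t_j=+}[\Delta(\sigma_a(t^j))]$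 and $[F\Delta(\sigma_a(t))]=\sum_{l:\,t_l=-}[\Delta(\sigma_a(\bar t^l))]$ in $K(\mathcal C)$; (HWC3) $c(\sigma_a(t^j))=c(\sigma_a(t))+d_a(j)$ and $c(\sigma_a(\bar t^l))=c(\sigma_a(t))-d_a(l)$; (HWC4) $d_a(1)<d_a(2)<\dots<d_a(n_a)$. *Crystals.* An $\mathfrak{sl}_2$-crystal is a set $B$ with maps $\mathrm{wt}:B\to\mathbb Z$, $\tilde e,\tilde f:B\to B\sqcup\{0\}$, $h_\pm:B\to\mathbb Z_{\ge0}$ such that (i) $\mathrm{wt}=h_--h_+$; (ii) $\tilde eb=0\iff h_+(b)=0$ and $\tilde fb=0\iff h_-(b)=0$; (iii) for $b,b'\in B$, $\tilde eb=b'\iff\tilde fb'=b$; (iv) if $b'=\tilde eb$ then $h_+(b')=h_+(b)-1$ and $h_-(b')=h_-(b)+1$. Morphisms of crystals commute with all these maps (with $0\mapsto0$), an isomorphism is a bijective morphism, and a subcrystal is a subset with a crystal structure for which the inclusion is a morphism. On the set of (isomorphism classes of) simple objects of $\mathcal C$ put: $h_+(S)=\max\{i:E^iS\ne0\}$, $h_-(S)=\max\{i:F^iS\neq0\}$,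 $\mathrm{wt}(S)$ is the integer $w$ with $h[S]=w[S]$, $\tilde eS=0$ if $ES=0$ and otherwise $\tilde eS$ is the simple object isomorphic to both the socle and the head of $ES$; $\tilde fS$ is defined in the same way with $F$ in place of $E$. On $\{+,-\}^n$: the reduced form $t^{red}\in\{+,-,0\}^n$ of $t$ is obtained by repeatedly replacing a $-$ at a place $a$ and a $+$ at a place $b>a$, with only $0$'s strictly between them, by $0$'s, as long as possible. Then $h_+(t)$ and $h_-(t)$ are the numbers of $+$'s and $-$'s in $t^{red}$, $\mathrm{wt}=h_--h_+$, $\tilde et$ is obtained from $t$ by changing $t_i$ from $+$ to $-$ for the largest $i$ with $t^{red}_i=+$ ($\tilde et=0$ if there is no such $i$), and $\tilde ft$ is obtained by changing $t_j$ from $-$ to $+$ for the smallest $j$ with $t^{red}_j=-$ ($\tilde ft=0$ if there is no such $j$). **Theorem.** The set of simple objects of $\mathcal C$ and the sets $\{+,-\}^{n_a}$, with the structures above, are $\mathfrak{sl}_2$-crystals, and for each $a\in\mathfrak A$ the set $\{L(\lambda):\lambda\in\Lambda_a\}$ is a subcrystal of the crystal $\{L(\lambda):\lambda\in\Lambda\}$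 of simple objects and the map $t\mapsto L(\sigma_a(t))$ is an isomorphism of crystals from $\{+,-\}^{n_a}$ onto $\{L(\lambda):\lambda\in\Lambda_a\}$. -/

import Mathlib

open CategoryTheory CategoryTheory.Limits
open scoped TensorProduct

namespace HWSl2

universe v u

/-! ## Crystals -/

section Crystals

/-- The data of an `sl₂`-crystal on a set `B`; the extra element `0` of `B ⊔ {0}` is `none`. -/
structure CrystalData (B : Type*) where
  wt : B → ℤ
  e : B → Option B
  f : B → Option B
  hPlus : B → ℕ
  hMinus : B → ℕ

/-- The axioms (i)-(iv) of an `sl₂`-crystal. -/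
structure CrystalData.IsCrystal {B : Type*} (K : CrystalData B) : Prop where
  wt_eq : ∀ b, K.wt b = (K.hMinus b : ℤ) - (K.hPlus b : ℤ)
  e_eq_none_iff : ∀ b, K.e b = none ↔ K.hPlus b = 0
  f_eq_none_iff : ∀ b, K.f b = none ↔ K.hMinus b = 0
  e_eq_some_iff : ∀ b b', K.e b = some b' ↔ K.f b' = some b
  h_of_e : ∀ b b', K.e b = some b' →
    (K.hPlus b' : ℤ) = (K.hPlus b : ℤ) - 1 ∧ (K.hMinus b' : ℤ) = (K.hMinus b : ℤ) + 1

/-- `φ` intertwines all the structure maps (with `φ 0 = 0`). -/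
structure IsCrystalHom {B B' : Type*} (K : CrystalData B) (K' : CrystalData B')
    (φ : B → B') : Prop where
  wt : ∀ b, K'.wt (φ b) = K.wt b
  hPlus : ∀ b, K'.hPlus (φ b) = K.hPlus b
  hMinus : ∀ b, K'.hMinus (φ b) = K.hMinus b
  e : ∀ b, K'.e (φ b) = (K.e b).map φ
  f : ∀ b, K'.f (φ b) = (K.f b).map φ

/-- An isomorphism of crystals: a bijective morphism (its inverse is then a morphism). -/
def IsCrystalIso {B B' : Type*} (K : CrystalData B) (K' : CrystalData B') (φ : B → B') : Prop :=
  Function.Bijective φ ∧ IsCrystalHom K K' φ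

/-- The crystal `KS` on the subset `S` is a subcrystal of `K`: the inclusion is a morphism. -/
def IsSubcrystal {B : Type*} (K : CrystalData B) (S : Set B) (KS : CrystalData S) : Prop :=
  KS.IsCrystal ∧ IsCrystalHom KS K (Subtype.val : S → B)

end Crystals

/-! ## The crystal of sign sequences -/

section Signs

inductive Sgn : Type
  | plus
  | minus
  deriving DecidableEq

variable {n : ℕ}

/-- One cancellation: `u a = -`, `u b = +`, `a < b`, only zeros in between; both entries are
replaced by zero (zero is `none`). -/
def CancelStep (u v : Fin n → Option Sgn) : Prop :=
  ∃ a b : Fin n, a < b ∧ u a = some Sgn.minus ∧ u b = some Sgn.plus ∧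
    (∀ i, a < i → i < b → u i = none) ∧
    v = Function.update (Function.update u a none) b none

/-- `u` is obtained from `t` by cancellations, and no further cancellation is possible. -/
def IsReducedForm (t : Fin n → Sgn) (u : Fin n → Option Sgn) : Prop :=
  Relation.ReflTransGen CancelStep (fun i => some (t i)) u ∧ ∀ v, ¬ CancelStep u v

theorem exists_irreducible (u : Fin n → Option Sgn) :
    ∃ w, Relation.ReflTransGen CancelStep u w ∧ ∀ v, ¬ CancelStep w v := by
  induction h : (Finset.univ.filter fun i => u i ≠ none).card using Nat.strong_induction_on
    generalizing u with
  | _ N ih =>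
    by_cases hu : ∃ v, CancelStep u v
    · obtain ⟨v, hv⟩ := hu
      have hlt : (Finset.univ.filter fun i => v i ≠ none).card < N := by
        rw [← h]
        apply Finset.card_lt_card
        obtain ⟨a, b, hab, ha, hb, -, rfl⟩ := hv
        rw [Finset.ssubset_iff_of_subset]
        · exact ⟨b, by simp [hb], by simp⟩
        · intro i
          simp only [Finset.mem_filter, Finset.mem_univ, true_and, Function.update_apply]
          split_ifs <;> simp
      obtain ⟨w, hw, hw'⟩ := ih _ hlt v rfl
      exact ⟨w, .head hv hw, hw'⟩
    · exact ⟨u, .refl, fun v hv => hu ⟨v, hv⟩⟩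

theorem cancelStep_diamond (u v w : Fin n → Option Sgn) (hv : CancelStep u v)
    (hw : CancelStep u w) :
    ∃ x, Relation.ReflGen CancelStep v x ∧ Relation.ReflTransGen CancelStep w x := by
  obtain ⟨a, b, hab, ha, hb, hz, rfl⟩ := hv
  obtain ⟨a', b', hab', ha', hb', hz', rfl⟩ := hw
  have h1 : a ≠ b' := by rintro rfl; simp [ha] at hb'
  have h2 : a' ≠ b := by rintro rfl; simp [ha'] at hb
  by_cases hbb : b = b'
  · subst hbb
    have haa : a = a' := by
      rcases lt_trichotomy a a' with h | h | h
      · simp [hz a' h hab'] at ha'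
      · exact h
      · simp [hz' a h hab] at ha
    subst haa
    exact ⟨_, .refl, .refl⟩
  · have haa : a ≠ a' := by
      rintro rfl
      rcases lt_trichotomy b b' with h | h | h
      · simp [hz' b hab h] at hb
      · exact hbb h
      · simp [hz b' hab' h] at hb'
    refine ⟨Function.update (Function.update
      (Function.update (Function.update u a none) b none) a' none) b' none,
      .single ⟨a', b', hab', ?_, ?_, ?_, rfl⟩, .single ⟨a, b, hab, ?_, ?_, ?_, ?_⟩⟩
    · simp [h2, Ne.symm haa, ha']
    · simp [Ne.symm h1, Ne.symm hbb, hb']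
    · intro i hi hi'
      simp [Function.update_apply, hz' i hi hi']
    · simp [h1, haa, ha]
    · simp [Ne.symm h2, hbb, hb]
    · intro i hi hi'
      simp [Function.update_apply, hz i hi hi']
    · funext i
      simp only [Function.update_apply]
      split_ifs <;> rfl

/-- The reduced form is well defined. -/
theorem existsUnique_reducedForm (t : Fin n → Sgn) : ∃! u, IsReducedForm t u := by
  obtain ⟨u, hu, hu'⟩ := exists_irreducible (fun i => some (t i))
  have stuck : ∀ x y : Fin n → Option Sgn, (∀ v, ¬ CancelStep x v) →
      Relation.ReflTransGen CancelStep x y → x = y := by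
    intro x y hx hxy
    rcases hxy.cases_head with h | ⟨z, hz, -⟩
    · exact h
    · exact absurd hz (hx z)
  refine ⟨u, ⟨hu, hu'⟩, ?_⟩
  rintro w ⟨hw, hw'⟩
  obtain ⟨x, hx, hx'⟩ := Relation.church_rosser cancelStep_diamond hu hw
  rw [stuck u x hu' hx, stuck w x hw' hx']

/-- The reduced form `t^red` of a sign sequence. -/
noncomputable def reducedForm (t : Fin n → Sgn) : Fin n → Option Sgn :=
  (existsUnique_reducedForm t).choose

/-- The positions where the reduced form is `s`. -/
noncomputable def reducedPositions (s : Sgn) (t : Fin n → Sgn) : Finset (Fin n) :=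
  Finset.univ.filter fun i => reducedForm t i = some s

/-- The crystal `{+,-}ⁿ`: `h_±` count the signs in the reduced form, `ẽ` changes the rightmost
`+` of the reduced form to `-`, and `f̃` changes the leftmost `-` of it to `+`. -/
noncomputable def signCrystal (n : ℕ) : CrystalData (Fin n → Sgn) where
  wt t := ((reducedPositions Sgn.minus t).card : ℤ) - ((reducedPositions Sgn.plus t).card : ℤ)
  hPlus t := (reducedPositions Sgn.plus t).card
  hMinus t := (reducedPositions Sgn.minus t).card
  e t := if h : (reducedPositions Sgn.plus t).Nonempty then
    some (Function.update t ((reducedPositions Sgn.plus t).max' h) Sgn.minus) else none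
  f t := if h : (reducedPositions Sgn.minus t).Nonempty then
    some (Function.update t ((reducedPositions Sgn.minus t).min' h) Sgn.plus) else none

end Signs

/-! ## The Grothendieck group of an abelian category -/

section K0

variable (C : Type u) [Category.{v} C] [Abelian C]

/-- The relations `[S₂] = [S₁] + [S₃]` for short exact sequences `0 → S₁ → S₂ → S₃ → 0`. -/
def K0Relations : AddSubgroup (FreeAbelianGroup C) :=
  AddSubgroup.closure {x | ∃ S : ShortComplex C, S.ShortExact ∧
    x = FreeAbelianGroup.of S.X₂ - FreeAbelianGroup.of S.X₁ - FreeAbelianGroup.of S.X₃}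

/-- The Grothendieck group `K(C)`. -/
abbrev K0 : Type u := FreeAbelianGroup C ⧸ K0Relations C

variable {C}

/-- The class of an object in `K(C)`. -/
def K0.cls (M : C) : K0 C := QuotientAddGroup.mk (FreeAbelianGroup.of M)

/-- The endomorphism of `K(C)` induced by an exact endofunctor: `[M] ↦ [G M]`. -/
def K0.map (G : C ⥤ C) [G.Additive] [PreservesFiniteLimits G] [PreservesFiniteColimits G] :
    K0 C →+ K0 C :=
  QuotientAddGroup.map _ _ (FreeAbelianGroup.map G.obj) (by
    rw [K0Relations, AddSubgroup.closure_le]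
    rintro _ ⟨S, hS, rfl⟩
    refine AddSubgroup.subset_closure ⟨S.map G, hS.map_of_exact G, ?_⟩
    simp)

theorem K0.map_cls (G : C ⥤ C) [G.Additive] [PreservesFiniteLimits G]
    [PreservesFiniteColimits G] (M : C) : K0.map G (K0.cls M) = K0.cls (G.obj M) := by
  simp [K0.map, K0.cls]

variable (C) in
/-- `[C] = ℚ ⊗ K(C)`. -/
abbrev RatK0 : Type u := ℚ ⊗[ℤ] K0 C

/-- The class of an object in `ℚ ⊗ K(C)`. -/
noncomputable def RatK0.cls (M : C) : RatK0 C := (1 : ℚ) ⊗ₜ[ℤ] K0.cls M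

/-- The operator on `ℚ ⊗ K(C)` induced by an exact endofunctor. -/
noncomputable def RatK0.map (G : C ⥤ C) [G.Additive] [PreservesFiniteLimits G]
    [PreservesFiniteColimits G] : Module.End ℚ (RatK0 C) :=
  (K0.map G).toIntLinearMap.baseChange ℚ

end K0

/-! ## `sl₂`-categorifications -/

section Categorifications

variable (k : Type*) [Field k] (C : Type u) [Category.{v} C] [Abelian C] [Linear k C]

/-- Two exact `k`-linear endofunctors `E`, `F`, with `E` left adjoint to `F`. -/
structure ExactAdjointPair where
  E : C ⥤ C
  F : C ⥤ C
  [additiveE : E.Additive]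
  [additiveF : F.Additive]
  [linearE : E.Linear k]
  [linearF : F.Linear k]
  [leftExactE : PreservesFiniteLimits E]
  [rightExactE : PreservesFiniteColimits E]
  [leftExactF : PreservesFiniteLimits F]
  [rightExactF : PreservesFiniteColimits F]
  adj : E ⊣ F

attribute [instance] ExactAdjointPair.additiveE ExactAdjointPair.additiveF
  ExactAdjointPair.linearE ExactAdjointPair.linearF
  ExactAdjointPair.leftExactE ExactAdjointPair.rightExactE
  ExactAdjointPair.leftExactF ExactAdjointPair.rightExactF

variable {k C}

/-- `e = [E]`. -/
noncomputable def ExactAdjointPair.opE (A : ExactAdjointPair k C) : Module.End ℚ (RatK0 C) :=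
  RatK0.map A.E

/-- `f = [F]`. -/
noncomputable def ExactAdjointPair.opF (A : ExactAdjointPair k C) : Module.End ℚ (RatK0 C) :=
  RatK0.map A.F

/-- `h = [e, f]`. -/
noncomputable def ExactAdjointPair.opH (A : ExactAdjointPair k C) : Module.End ℚ (RatK0 C) :=
  ⁅A.opE, A.opF⁆

variable (k C)

/-- A weak `sl₂`-categorification. -/
structure WeakSl2Categorification extends ExactAdjointPair k C where
  /-- `F` is isomorphic to a left adjoint of `E`. -/
  adj' : Nonempty (F ⊣ E)
  /-- the `sl₂`-relations `[h,e] = 2e`, `[h,f] = -2f` for `h = [e,f]` -/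
  lie_h_e : ⁅toExactAdjointPair.opH, toExactAdjointPair.opE⁆ = (2 : ℚ) • toExactAdjointPair.opE
  lie_h_f : ⁅toExactAdjointPair.opH, toExactAdjointPair.opF⁆ = (-2 : ℚ) • toExactAdjointPair.opF
  /-- every vector lies in a finite dimensional subrepresentation -/
  locallyFinite : ∀ x : RatK0 C, ∃ W : Submodule ℚ (RatK0 C), Module.Finite ℚ W ∧ x ∈ W ∧
    ∀ w ∈ W, toExactAdjointPair.opE w ∈ W ∧ toExactAdjointPair.opF w ∈ W
  /-- the classes of simple objects are weight vectors -/
  simple_weight : ∀ S : C, Simple S →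
    ∃ r : ℚ, toExactAdjointPair.opH (RatK0.cls S) = r • RatK0.cls S

/-- An `sl₂`-categorification. In components, `1_E T` is `E(T_M)`, `T 1_E` is `T_{E M}`, and
similarly for `X`. -/
structure Sl2Categorification extends WeakSl2Categorification k C where
  X : E ⟶ E
  T : E ⋙ E ⟶ E ⋙ E
  q : k
  a : k
  q_ne_zero : q ≠ 0
  a_ne_zero : q ≠ 1 → a ≠ 0
  braid : ∀ M : C,
    let oneT : E.obj (E.obj (E.obj M)) ⟶ E.obj (E.obj (E.obj M)) := E.map (T.app M)
    let Tone : E.obj (E.obj (E.obj M)) ⟶ E.obj (E.obj (E.obj M)) := T.app (E.obj M)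
    oneT ≫ Tone ≫ oneT = Tone ≫ oneT ≫ Tone
  hecke : ∀ M : C,
    let TM : E.obj (E.obj M) ⟶ E.obj (E.obj M) := T.app M
    (TM - q • 𝟙 _) ≫ (TM + 𝟙 _) = 0
  affine_of_ne : q ≠ 1 → ∀ M : C,
    let TM : E.obj (E.obj M) ⟶ E.obj (E.obj M) := T.app M
    TM ≫ E.map (X.app M) ≫ TM = q • X.app (E.obj M)
  affine_of_eq : q = 1 → ∀ M : C,
    let TM : E.obj (E.obj M) ⟶ E.obj (E.obj M) := T.app M
    TM ≫ E.map (X.app M) ≫ TM = X.app (E.obj M) - TM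
  /-- `X - a` is (locally) nilpotent: nilpotent on `E M` for every object `M`. -/
  nilpotent : ∀ M : C, IsNilpotent (R := End (E.obj M)) (X.app M - a • 𝟙 (E.obj M))

end Categorifications

/-! ## The crystal of an `sl₂`-categorification -/

section SimplesCrystal

variable (C : Type u) [Category.{v} C] [Abelian C]

/-- The set of isomorphism classes of simple objects. -/
def SimpleClass : Type u := {x : Quotient (isIsomorphicSetoid C) // Simple x.out}

variable {C}

/-- The isomorphism class of a simple object. -/
def SimpleClass.mk (S : C) (hS : Simple S) : SimpleClass C :=
  ⟨Quotient.mk (isIsomorphicSetoid C) S, by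
    obtain ⟨i⟩ := Quotient.exact (s := isIsomorphicSetoid C)
      (Quotient.out_eq (Quotient.mk (isIsomorphicSetoid C) S))
    exact Simple.of_iso i⟩

/-- A representative of an isomorphism class of simple objects. -/
noncomputable def SimpleClass.obj (x : SimpleClass C) : C := x.1.out

/-- The socle of `M` (the sum of its simple subobjects) is simple and isomorphic to `T`. -/
def HasSimpleSocle (M T : C) : Prop :=
  Simple T ∧ ∃ i : T ⟶ M, Mono i ∧ ∀ (S : C), Simple S → ∀ g : S ⟶ M, ∃ h : S ⟶ T, h ≫ i = g

/-- The head of `M` (its maximal semisimple quotient) is simple and isomorphic to `T`. -/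
def HasSimpleHead (M T : C) : Prop :=
  Simple T ∧ ∃ p : M ⟶ T, Epi p ∧ ∀ (S : C), Simple S → ∀ g : M ⟶ S, ∃ h : T ⟶ S, p ≫ h = g

/-- `h(S) = max {i | Gⁱ S ≠ 0}`. -/
noncomputable def maxPower (G : C ⥤ C) (S : C) : ℕ := sSup {i : ℕ | ¬ IsZero (G.obj^[i] S)}

open scoped Classical in
/-- The simple object that is both the socle and the head of `G S`, and `none` if there is no
such object (which happens only for `G S = 0` when `G` is `E` or `F`). -/
noncomputable def crystalOp (G : C ⥤ C) (x : SimpleClass C) : Option (SimpleClass C) :=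
  if h : ∃ y : SimpleClass C, HasSimpleSocle (G.obj x.obj) y.obj ∧ HasSimpleHead (G.obj x.obj) y.obj
  then some h.choose else none

variable {k : Type*} [Field k] [Linear k C]

open scoped Classical in
/-- The weight of `S`: the integer `w` with `h [S] = w [S]` in `ℚ ⊗ K(C)`. -/
noncomputable def ExactAdjointPair.weight (A : ExactAdjointPair k C) (S : C) : ℤ :=
  if h : ∃ w : ℤ, A.opH (RatK0.cls S) = (w : ℚ) • RatK0.cls S then h.choose else 0

/-- The crystal on the set of simple objects. -/
noncomputable def Sl2Categorification.crystal (S : Sl2Categorification k C) :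
    CrystalData (SimpleClass C) where
  wt x := S.weight x.obj
  e x := crystalOp S.E x
  f x := crystalOp S.F x
  hPlus x := maxPower S.E x.obj
  hMinus x := maxPower S.F x.obj

end SimplesCrystal

/-! ## Highest weight categories -/

section HighestWeight

variable {k : Type*} [Field k] {C : Type u} [Category.{v} C] [Abelian C]

/-- `HasFiltration Y [i₁, …, i_r] M`: there is a filtration `M = F₀ ⊃ F₁ ⊃ … ⊃ F_r = 0` with
`F_{j-1}/F_j ≅ Y i_j`. -/
inductive HasFiltration {ι : Type*} (Y : ι → C) : List ι → C → Prop
  | zero (M : C) (h : IsZero M) : HasFiltration Y [] M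
  | step (i : ι) (l : List ι) (S : ShortComplex C) (hS : S.ShortExact)
      (top : Nonempty (S.X₃ ≅ Y i)) (rest : HasFiltration Y l S.X₁) :
      HasFiltration Y (i :: l) S.X₂

/-- `M` has a filtration with all successive quotients among the `Y i`. -/
def IsFilteredBy {ι : Type*} (Y : ι → C) (M : C) : Prop := ∃ l, HasFiltration Y l M

variable (k C) [Linear k C] (Λ : Type*) [PartialOrder Λ]

open scoped Classical in
/-- A highest weight structure on `C` with poset `Λ`. -/
structure HighestWeightStructure where
  /-- every object has finite length -/
  artinian : ∀ M : C, IsArtinianObject M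
  noetherian : ∀ M : C, IsNoetherianObject M
  Δ : Λ → C
  /-- `End Δ(x) = k` -/
  end_Δ : ∀ x, Function.Bijective fun r : k => r • 𝟙 (Δ x)
  /-- the simple quotient of `Δ(x)` -/
  L : Λ → C
  π : ∀ x, Δ x ⟶ L x
  simple_L : ∀ x, Simple (L x)
  epi_π : ∀ x, Epi (π x)
  /-- the simple quotient is unique -/
  unique_quotient : ∀ x (S : C), Simple S → ∀ g : Δ x ⟶ S, Epi g →
    ∃ i : L x ≅ S, π x ≫ i.hom = g
  /-- each simple object is isomorphic to precisely one `L(x)` -/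
  classification : ∀ S : C, Simple S → ∃! x, Nonempty (S ≅ L x)
  P : Λ → C
  projective_P : ∀ x, Projective (P x)
  /-- the labels of the filtration of `P(x)` by standard objects, below the top one `Δ(x)` -/
  lower : Λ → List Λ
  filtration_P : ∀ x, HasFiltration Δ (x :: lower x) (P x)
  lower_gt : ∀ x, ∀ y ∈ lower x, x < y
  /-- BGG reciprocity `[Δ(x) : L(y)] = (P(y) : Δ(x))`; `l` lists the composition factors. -/
  reciprocity : ∀ x, ∃ l, HasFiltration L l (Δ x) ∧
    ∀ y, l.count y = (y :: lower y).count x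

variable {k C Λ}

/-- The isomorphism class of `L(x)`. -/
def HighestWeightStructure.simpleClass (H : HighestWeightStructure k C Λ) (x : Λ) :
    SimpleClass C := SimpleClass.mk (H.L x) (H.simple_L x)

/-- For complex numbers, `α < β` means that `β - α` is a positive integer. -/
def IntLT (α β : ℂ) : Prop := ∃ m : ℕ, 0 < m ∧ β - α = m

/-- The additional data and the axioms (HWC0)-(HWC4) of a highest weight
`sl₂`-categorification. -/
structure HighestWeightCategorification (H : HighestWeightStructure k C Λ)
    (S : Sl2Categorification k C) (𝔄 : Type*) where
  c : Λ → ℂ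
  n : 𝔄 → ℕ
  block : 𝔄 → Set Λ
  /-- the blocks form a partition of `Λ` -/
  partition : ∀ x : Λ, ∃! a, x ∈ block a
  σ : ∀ a, (Fin (n a) → Sgn) ≃ block a
  d : ∀ a, Fin (n a) → ℂ
  hwc0 : ∀ M : C, IsFilteredBy H.Δ M → IsFilteredBy H.Δ (S.E.obj M) ∧ IsFilteredBy H.Δ (S.F.obj M)
  hwc1 : ∀ x y : Λ, x < y → IntLT (c y) (c x)
  hwc2_e : ∀ a (t : Fin (n a) → Sgn), K0.map S.E (K0.cls (H.Δ (σ a t))) =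
    ∑ j with t j = Sgn.plus, K0.cls (H.Δ (σ a (Function.update t j Sgn.minus)))
  hwc2_f : ∀ a (t : Fin (n a) → Sgn), K0.map S.F (K0.cls (H.Δ (σ a t))) =
    ∑ j with t j = Sgn.minus, K0.cls (H.Δ (σ a (Function.update t j Sgn.plus)))
  hwc3_e : ∀ a (t : Fin (n a) → Sgn) j, t j = Sgn.plus →
    c (σ a (Function.update t j Sgn.minus)) = c (σ a t) + d a j
  hwc3_f : ∀ a (t : Fin (n a) → Sgn) j, t j = Sgn.minus →
    c (σ a (Function.update t j Sgn.plus)) = c (σ a t) - d a j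
  hwc4 : ∀ a (i j : Fin (n a)), i < j → IntLT (d a i) (d a j)

/-- The set `{L(x) : x ∈ Λ_a}` of simple objects. -/
def HighestWeightCategorification.blockSimples {H : HighestWeightStructure k C Λ}
    {S : Sl2Categorification k C} {𝔄 : Type*} (W : HighestWeightCategorification H S 𝔄) (a : 𝔄) :
    Set (SimpleClass C) := H.simpleClass '' W.block a

/-- The map `t ↦ L(σ_a(t))`. -/
def HighestWeightCategorification.labelMap {H : HighestWeightStructure k C Λ}
    {S : Sl2Categorification k C} {𝔄 : Type*} (W : HighestWeightCategorification H S 𝔄) (a : 𝔄)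
    (t : Fin (W.n a) → Sgn) : W.blockSimples a :=
  ⟨H.simpleClass (W.σ a t), Set.mem_image_of_mem _ (W.σ a t).2⟩

end HighestWeight

end HWSl2

open HWSl2

/-!
The operators `E` and `F` act on standard classes by sign changes, and the crystal structure is
recovered from this action by combining three arguments.

*Simple objects.* For a simple object `L(x)` put `n = h₊(L(x))`. The affine Hecke operators `X`
and `T` force morphisms into `Eⁿ M` to come in families: if `Hom(A, Eⁿ M) ≠ 0`, its dimension is
at least `n!` (`factorial_le_finrank_hom`), and, if `K` is the kernel of `X - a` on `E M`, then
`(n + 1) dim Hom(A, Eⁿ K) ≤ dim Hom(A, Eⁿ⁺¹ M)` (`succ_mul_finrank_hom_kernel_le`). In the other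
direction, the standard filtrations give `dim Hom(Fⁿ L(y), L(z)) ≤ n!`
(`IsFlipFunctor.finrank_hom_le`), since there are at most `n!` orders in which to perform `n`
given sign changes. Together with the identity `eⁿ fⁿ v = (n!)² v` for a vector `v` of weight `n`
killed by `e`, these estimates leave no room: `Eⁿ L(x)` has a single composition factor `L(ν)`, of
multiplicity `n!` (`exists_isTop`). A simple subobject or quotient of `E L(x)` is a composition
factor of the kernel of `X - a`, and each such factor uses up the whole multiplicity of `L(ν)`
available in `Eⁿ⁻¹` of that kernel; so it is unique, and `E L(x)` has isomorphic simple head and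
socle (`exists_raise`).

*Rigidity.* On the labels in `{+,-}ⁿ` of a block this defines an operator that changes a `+` to a
`-`, lowers `h₊` by one and is onto the sequences with `h₋ > 0` (`IsRaising`). As the weight
spaces `w` and `-w` have the same size, such an operator is injective, and two of them with
comparable depth functions have equal depth functions (`IsRaising.depth_eq`); if the depth
function is that of the crystal of signs, then the operator is `ẽ`, by comparing the sums of the
positions of the changed signs (`IsRaising.eq_signRaise`).

*Leading terms.* It remains to see that `h₊(L(σ_a(t))) ≤ h₊(t)`. By injectivity a vector killed by
`eᴺ` only involves simple objects killed by `Eᴺ` (`maxPower_lt_of_pow_eq_zero`). Replacing, along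
the cancellation of `t` to its reduced form, the standard classes by their antisymmetrizations in
the cancelled pairs of places gives a vector killed by `e ^ (h₊(t) + 1)`
(`exists_leading_vector`); by `hwc1`, `hwc3_e`, `hwc3_f` and `hwc4` it is the class of `Δ(σ_a(t))`
up to classes of standard objects that do not contain `L(σ_a(t))`.
-/

namespace HWSl2

universe v u

/-! ### The crystal of sign sequences -/

/-- The step of the lattice path attached to a sign: `+1` for `+`, `-1` for `-`, and `0` for a
cancelled place. -/
def signStep : Option Sgn → ℤ
  | some Sgn.plus => 1
  | some Sgn.minus => -1
  | none => 0

/-- The height of the lattice path of `u` after the first `k` steps. -/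
def height {n : ℕ} (u : Fin n → Option Sgn) (k : ℕ) : ℤ :=
  ∑ i with i.val < k, signStep (u i)

section Height

variable {n : ℕ}

theorem height_zero (u : Fin n → Option Sgn) : height u 0 = 0 := by simp [height]

theorem height_succ (u : Fin n → Option Sgn) (p : Fin n) :
    height u (p.val + 1) = height u p.val + signStep (u p) := by
  have : (Finset.univ.filter fun i : Fin n => i.val < p.val + 1) =
      insert p (Finset.univ.filter fun i : Fin n => i.val < p.val) := by
    ext i
    simp only [Finset.mem_filter, Finset.mem_univ, true_and, Finset.mem_insert, Fin.ext_iff]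
    omega
  rw [height, this, Finset.sum_insert (by simp), add_comm, height]

theorem height_of_le (u : Fin n → Option Sgn) {k : ℕ} (hk : n ≤ k) : height u k = height u n := by
  unfold height
  congr 1
  ext i
  simp only [Finset.mem_filter, Finset.mem_univ, true_and]
  omega

theorem height_update (u : Fin n → Option Sgn) (p : Fin n) (s : Option Sgn) (k : ℕ) :
    height (Function.update u p s) k =
      height u k + if p.val < k then signStep s - signStep (u p) else 0 := by
  unfold height
  by_cases hp : p.val < k
  · have hmem : p ∈ Finset.univ.filter fun i : Fin n => i.val < k := by simp [hp]
    rw [← Finset.add_sum_erase _ _ hmem, ← Finset.add_sum_erase _ (fun i => signStep (u i)) hmem,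
      Finset.sum_congr rfl (g := fun i => signStep (u i))]
    · simp [hp]
      ring
    · intro i hi
      rw [Function.update_of_ne (Finset.ne_of_mem_erase hi)]
  · rw [if_neg hp, add_zero]
    refine Finset.sum_congr rfl fun i hi => ?_
    rw [Function.update_of_ne]
    rintro rfl
    exact hp (Finset.mem_filter.1 hi).2

/-- The place `p` is a strict left-to-right record of the lattice path. -/
def IsPlusRecord (u : Fin n → Option Sgn) (p : Fin n) : Prop :=
  ∀ k ≤ p.val, height u k < height u (p.val + 1)

/-- The place `p` is a strict right-to-left record of the lattice path. -/
def IsMinusRecord (u : Fin n → Option Sgn) (p : Fin n) : Prop :=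
  ∀ k, p.val < k → height u k < height u p.val

theorem IsPlusRecord.eq_plus {u : Fin n → Option Sgn} {p : Fin n} (h : IsPlusRecord u p) :
    u p = some Sgn.plus := by
  have := h p.val le_rfl
  rw [height_succ] at this
  rcases hu : u p with _ | (_ | _) <;> simp_all [signStep]

theorem IsMinusRecord.eq_minus {u : Fin n → Option Sgn} {p : Fin n} (h : IsMinusRecord u p) :
    u p = some Sgn.minus := by
  have := h (p.val + 1) (Nat.lt_succ_self _)
  rw [height_succ] at this
  rcases hu : u p with _ | (_ | _) <;> simp_all [signStep]

/-- Cancelling the places `a < b` fills in the dip of the lattice path between them. -/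
theorem CancelStep.height_eq {u v : Fin n → Option Sgn} (h : CancelStep u v) :
    ∃ a b : Fin n, a < b ∧ v a = none ∧ v b = none ∧
      (∀ k, a.val < k → k ≤ b.val → height u k = height u a.val - 1) ∧
      height u (b.val + 1) = height u a.val ∧
      (∀ k, height v k = height u k + if a.val < k ∧ k ≤ b.val then 1 else 0) := by
  obtain ⟨a, b, hab, ha, hb, hz, rfl⟩ := h
  have hdip : ∀ k, a.val < k → k ≤ b.val → height u k = height u a.val - 1 := by
    intro k hk
    induction k, hk using Nat.le_induction with
    | base => intro _; rw [height_succ, ha]; simp [signStep]; ring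
    | succ k hk ih =>
      intro hkb
      have hkn : k < n := by omega
      have := height_succ u ⟨k, hkn⟩
      simp only at this
      rw [this, ih (by omega), hz ⟨k, hkn⟩ (by simp [Fin.lt_def]; omega)
        (by simp [Fin.lt_def]; omega)]
      simp [signStep]
  refine ⟨a, b, hab, ?_, by simp, hdip, ?_, ?_⟩
  · simp [hab.ne]
  · rw [height_succ, hdip b.val hab le_rfl, hb]; simp [signStep]
  · intro k
    have hab' : a.val < b.val := hab
    rw [height_update, height_update, Function.update_of_ne hab.ne', ha, hb]
    simp only [signStep]
    split_ifs <;> omega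

theorem CancelStep.isPlusRecord_iff {u v : Fin n → Option Sgn} (h : CancelStep u v) (p : Fin n) :
    IsPlusRecord u p ↔ IsPlusRecord v p := by
  obtain ⟨a, b, hab, hva, hvb, hdip, hb, hv⟩ := h.height_eq
  have hab' : a.val < b.val := hab
  have hu_not : ∀ {w : Fin n → Option Sgn}, (∀ k, k ≤ a.val ∨ b.val < k → height w k = height u k) →
      (∀ k, a.val < k → k ≤ b.val → height w k ≤ height u a.val) →
      IsPlusRecord w p → p.val < a.val ∨ b.val < p.val := by
    intro w h1 h2 hw
    by_contra hcon
    push Not at hcon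
    have h3 := hw a.val hcon.1
    rw [h1 a.val (Or.inl le_rfl)] at h3
    rcases Nat.lt_or_ge b.val (p.val + 1) with h4 | h4
    · have : p.val = b.val := by omega
      rw [this, h1 _ (Or.inr (Nat.lt_succ_self _)), hb] at h3
      omega
    · have := h2 (p.val + 1) (by omega) h4
      omega
  constructor
  · intro hu
    have hp := hu_not (fun _ _ => rfl) (fun k h1 h2 => by rw [hdip k h1 h2]; omega) hu
    intro k hk
    have h0 := hu k hk
    rw [hv k, hv (p.val + 1), if_neg (by omega : ¬ (a.val < p.val + 1 ∧ p.val + 1 ≤ b.val))]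
    split_ifs with hc
    · have h1 := hu a.val (by omega)
      have h2 := hdip k hc.1 hc.2
      omega
    · omega
  · intro hu
    have hp := hu_not (fun k hk => by rw [hv k, if_neg (by omega)]; omega)
      (fun k h1 h2 => by rw [hv k, if_pos ⟨h1, h2⟩, hdip k h1 h2]; omega) hu
    intro k hk
    have h0 := hu k hk
    rw [hv k, hv (p.val + 1), if_neg (by omega : ¬ (a.val < p.val + 1 ∧ p.val + 1 ≤ b.val))] at h0
    split_ifs at h0 <;> omega

theorem CancelStep.isMinusRecord_iff {u v : Fin n → Option Sgn} (h : CancelStep u v) (p : Fin n) :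
    IsMinusRecord u p ↔ IsMinusRecord v p := by
  obtain ⟨a, b, hab, hva, hvb, hdip, hb, hv⟩ := h.height_eq
  have hab' : a.val < b.val := hab
  have hu_not : ∀ {w : Fin n → Option Sgn}, (∀ k, k ≤ a.val ∨ b.val < k → height w k = height u k) →
      (∀ k, a.val < k → k ≤ b.val → height w k ≤ height u a.val) →
      IsMinusRecord w p → p.val < a.val ∨ b.val < p.val := by
    intro w h1 h2 hw
    by_contra hcon
    push Not at hcon
    have h3 := hw (b.val + 1) (by omega)
    rw [h1 (b.val + 1) (Or.inr (Nat.lt_succ_self _)), hb] at h3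
    rcases Nat.lt_or_ge a.val p.val with h4 | h4
    · have := h2 p.val h4 hcon.2
      omega
    · have : p.val = a.val := by omega
      rw [this, h1 _ (Or.inl le_rfl)] at h3
      omega
  constructor
  · intro hu
    have hp := hu_not (fun _ _ => rfl) (fun k h1 h2 => by rw [hdip k h1 h2]; omega) hu
    intro k hk
    have h0 := hu k hk
    rw [hv k, hv p.val, if_neg (by omega : ¬ (a.val < p.val ∧ p.val ≤ b.val))]
    split_ifs with hc
    · have h1 := hu (b.val + 1) (by omega)
      have h2 := hdip k hc.1 hc.2
      omega
    · omega
  · intro hu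
    have hp := hu_not (fun k hk => by rw [hv k, if_neg (by omega)]; omega)
      (fun k h1 h2 => by rw [hv k, if_pos ⟨h1, h2⟩, hdip k h1 h2]; omega) hu
    intro k hk
    have h0 := hu k hk
    rw [hv k, hv p.val, if_neg (by omega : ¬ (a.val < p.val ∧ p.val ≤ b.val))] at h0
    split_ifs at h0 <;> omega

theorem CancelStep.height_top {u v : Fin n → Option Sgn} (h : CancelStep u v) :
    height v n = height u n := by
  obtain ⟨a, b, -, -, -, -, -, hv⟩ := h.height_eq
  have := b.2
  rw [hv n, if_neg (by omega), add_zero]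

/-- In an irreducible sequence no `-` precedes a `+`. -/
theorem not_minus_lt_plus {u : Fin n → Option Sgn} (hu : ∀ v, ¬ CancelStep u v) :
    ∀ a b : Fin n, a < b → u a = some Sgn.minus → u b ≠ some Sgn.plus := by
  suffices H : ∀ m : ℕ, ∀ a b : Fin n, b.val - a.val = m → a < b → u a = some Sgn.minus →
      u b ≠ some Sgn.plus from fun a b => H _ a b rfl
  intro m
  induction m using Nat.strong_induction_on with
  | _ m ih =>
    intro a b hm hab ha hb
    by_cases hz : ∀ i, a < i → i < b → u i = none
    · exact hu _ ⟨a, b, hab, ha, hb, hz, rfl⟩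
    · push Not at hz
      obtain ⟨i, hai, hib, hi⟩ := hz
      have h1 : a.val < i.val := hai
      have h2 : i.val < b.val := hib
      rcases hui : u i with _ | (_ | _)
      · exact hi hui
      · exact ih (i.val - a.val) (by omega) a i rfl hai ha hui
      · exact ih (b.val - i.val) (by omega) i b rfl hib hui hb

theorem height_le_of_forall_ne_minus {u : Fin n → Option Sgn} {k p : ℕ} (hkp : k ≤ p) (hp : p ≤ n)
    (h : ∀ i : Fin n, i.val < p → u i ≠ some Sgn.minus) : height u k ≤ height u p := by
  induction p, hkp using Nat.le_induction with
  | base => exact le_rfl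
  | succ p hkp ih =>
    have h1 := height_succ u ⟨p, hp⟩
    have h2 := h ⟨p, hp⟩ (Nat.lt_succ_self _)
    have h3 := ih (by omega) (fun i hi => h i (by omega))
    simp only at h1
    rcases hu : u ⟨p, hp⟩ with _ | (_ | _) <;> simp_all [signStep]
    omega

theorem height_ge_of_forall_ne_plus {u : Fin n → Option Sgn} {k p : ℕ} (hkp : k ≤ p) (hp : p ≤ n)
    (h : ∀ i : Fin n, k ≤ i.val → u i ≠ some Sgn.plus) : height u p ≤ height u k := by
  induction p, hkp using Nat.le_induction with
  | base => exact le_rfl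
  | succ p hkp ih =>
    have h1 := height_succ u ⟨p, hp⟩
    have h2 := h ⟨p, hp⟩ hkp
    have h3 := ih (by omega)
    simp only at h1
    rcases hu : u ⟨p, hp⟩ with _ | (_ | _) <;> simp_all [signStep]
    omega

theorem isPlusRecord_iff_of_irreducible {u : Fin n → Option Sgn} (hu : ∀ v, ¬ CancelStep u v)
    (p : Fin n) : IsPlusRecord u p ↔ u p = some Sgn.plus := by
  refine ⟨fun h => h.eq_plus, fun h k hk => ?_⟩
  have h1 := height_le_of_forall_ne_minus (u := u) hk p.2.le
    (fun i hi hi' => not_minus_lt_plus hu i p hi hi' h)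
  rw [height_succ, h]
  simp only [signStep]
  omega

theorem isMinusRecord_iff_of_irreducible {u : Fin n → Option Sgn} (hu : ∀ v, ¬ CancelStep u v)
    (p : Fin n) : IsMinusRecord u p ↔ u p = some Sgn.minus := by
  refine ⟨fun h => h.eq_minus, fun h k hk => ?_⟩
  have key : ∀ k, p.val < k → k ≤ n → height u k < height u p.val := by
    intro k hk hkn
    have h1 := height_ge_of_forall_ne_plus (u := u) (k := p.val + 1) hk hkn
      (fun i hi => not_minus_lt_plus hu p i (Fin.lt_def.2 (by omega)) h)
    rw [height_succ, h] at h1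
    simp only [signStep] at h1
    omega
  rcases le_total k n with hkn | hkn
  · exact key k hk hkn
  · rw [height_of_le u hkn]
    exact key n p.2 le_rfl

end Height

section SignCrystal

variable {n : ℕ}

/-- The lattice path of a sign sequence. -/
def path (t : Fin n → Sgn) (k : ℕ) : ℤ := height (fun i => some (t i)) k

theorem path_of_le (t : Fin n → Sgn) {k : ℕ} (hk : n ≤ k) : path t k = path t n :=
  height_of_le _ hk

theorem path_succ (t : Fin n → Sgn) (p : Fin n) :
    path t (p.val + 1) = path t p.val + signStep (some (t p)) := height_succ _ p

theorem path_update (t : Fin n → Sgn) (p : Fin n) (s : Sgn) (k : ℕ) :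
    path (Function.update t p s) k =
      path t k + if p.val < k then signStep (some s) - signStep (some (t p)) else 0 := by
  have : (fun i => some (Function.update t p s i)) =
      Function.update (fun i => some (t i)) p (some s) := by
    funext i
    by_cases h : i = p
    · subst h; simp
    · simp [h]
  rw [path, this, height_update]
  rfl

theorem isReducedForm_reducedForm (t : Fin n → Sgn) : IsReducedForm t (reducedForm t) :=
  (existsUnique_reducedForm t).choose_spec.1

theorem mem_reducedPositions_plus (t : Fin n → Sgn) (p : Fin n) :
    p ∈ reducedPositions Sgn.plus t ↔ ∀ k ≤ p.val, path t k < path t (p.val + 1) := by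
  obtain ⟨h1, h2⟩ := isReducedForm_reducedForm t
  have h3 : ∀ u, Relation.ReflTransGen CancelStep (fun i => some (t i)) u →
      (IsPlusRecord (fun i => some (t i)) p ↔ IsPlusRecord u p) := by
    intro u hu
    induction hu with
    | refl => exact Iff.rfl
    | tail _ hstep ih => exact ih.trans (hstep.isPlusRecord_iff p)
  rw [reducedPositions, Finset.mem_filter, ← isPlusRecord_iff_of_irreducible h2, ← h3 _ h1]
  simp [IsPlusRecord, path]

theorem mem_reducedPositions_minus (t : Fin n → Sgn) (p : Fin n) :
    p ∈ reducedPositions Sgn.minus t ↔ ∀ k, p.val < k → path t k < path t p.val := by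
  obtain ⟨h1, h2⟩ := isReducedForm_reducedForm t
  have h3 : ∀ u, Relation.ReflTransGen CancelStep (fun i => some (t i)) u →
      (IsMinusRecord (fun i => some (t i)) p ↔ IsMinusRecord u p) := by
    intro u hu
    induction hu with
    | refl => exact Iff.rfl
    | tail _ hstep ih => exact ih.trans (hstep.isMinusRecord_iff p)
  rw [reducedPositions, Finset.mem_filter, ← isMinusRecord_iff_of_irreducible h2, ← h3 _ h1]
  simp [IsMinusRecord, path]

theorem eq_plus_of_mem_reducedPositions {t : Fin n → Sgn} {p : Fin n}
    (h : p ∈ reducedPositions Sgn.plus t) : t p = Sgn.plus := by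
  rw [mem_reducedPositions_plus] at h
  exact Option.some.inj (IsPlusRecord.eq_plus (u := fun i => some (t i)) h)

theorem eq_minus_of_mem_reducedPositions {t : Fin n → Sgn} {p : Fin n}
    (h : p ∈ reducedPositions Sgn.minus t) : t p = Sgn.minus := by
  rw [mem_reducedPositions_minus] at h
  exact Option.some.inj (IsMinusRecord.eq_minus (u := fun i => some (t i)) h)

/-- The weight of a sign sequence is its number of `-` minus its number of `+`. -/
theorem signCrystal_wt (t : Fin n → Sgn) : (signCrystal n).wt t = - path t n := by
  obtain ⟨h1, h2⟩ := isReducedForm_reducedForm t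
  have h3 : ∀ u, Relation.ReflTransGen CancelStep (fun i => some (t i)) u →
      height u n = path t n := by
    intro u hu
    induction hu with
    | refl => rfl
    | tail _ hstep ih => rw [hstep.height_top, ih]
  rw [← h3 _ h1]
  simp only [signCrystal, reducedPositions, Finset.card_filter, height, Fin.is_lt,
    Finset.filter_true, Nat.cast_sum]
  rw [← Finset.sum_sub_distrib, ← Finset.sum_neg_distrib]
  refine Finset.sum_congr rfl fun i _ => ?_
  rcases reducedForm t i with _ | (_ | _) <;> simp [signStep]

/-- `h₊` is the maximal height of the lattice path. -/
theorem signCrystal_hPlus (t : Fin n → Sgn) :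
    (∀ k, path t k ≤ (signCrystal n).hPlus t) ∧ ∃ k, path t k = (signCrystal n).hPlus t := by
  have key : ∀ m ≤ n, (∀ k ≤ m, path t k ≤
      (((reducedPositions Sgn.plus t).filter fun p => p.val < m).card : ℤ)) ∧
      ∃ k ≤ m, path t k =
        (((reducedPositions Sgn.plus t).filter fun p => p.val < m).card : ℤ) := by
    intro m
    induction m with
    | zero =>
      intro _
      refine ⟨fun k hk => ?_, 0, le_rfl, ?_⟩
      · obtain rfl : k = 0 := by omega
        simp [path, height_zero]
      · simp [path, height_zero]
    | succ m ih =>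
      intro hm
      obtain ⟨h1, k0, hk0, h2⟩ := ih (by omega)
      set p : Fin n := ⟨m, hm⟩
      have hpm : p.val = m := rfl
      have hs := path_succ t p
      rw [hpm] at hs
      by_cases hp : p ∈ reducedPositions Sgn.plus t
      · have hf : (reducedPositions Sgn.plus t).filter (fun p => p.val < m + 1) =
            insert p ((reducedPositions Sgn.plus t).filter fun p => p.val < m) := by
          ext i
          simp only [Finset.mem_filter, Finset.mem_insert, Fin.ext_iff, hpm]
          constructor
          · rintro ⟨hi, hi'⟩
            by_cases hh : i.val = m
            · exact Or.inl hh
            · exact Or.inr ⟨hi, by omega⟩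
          · rintro (hi | ⟨hi, hi'⟩)
            · exact ⟨by rwa [show i = p from Fin.ext hi], by omega⟩
            · exact ⟨hi, by omega⟩
        rw [hf, Finset.card_insert_of_notMem (by simp [hpm])]
        rw [eq_plus_of_mem_reducedPositions hp] at hs
        rw [mem_reducedPositions_plus] at hp
        have h3 := hp k0 hk0
        have h4 := h1 m le_rfl
        simp only [signStep, hpm] at hs h3
        push_cast
        refine ⟨fun k hk => ?_, m + 1, le_rfl, by omega⟩
        rcases Nat.lt_or_ge m k with hkm | hkm
        · obtain rfl : k = m + 1 := by omega
          omega
        · have := h1 k hkm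
          omega
      · have hf : (reducedPositions Sgn.plus t).filter (fun p => p.val < m + 1) =
            (reducedPositions Sgn.plus t).filter fun p => p.val < m := by
          ext i
          simp only [Finset.mem_filter]
          refine and_congr_right fun hi => ⟨fun hi' => ?_, fun hi' => by omega⟩
          have : i ≠ p := by rintro rfl; exact hp hi
          have : i.val ≠ m := fun hh => this (Fin.ext hh)
          omega
        rw [hf]
        refine ⟨fun k hk => ?_, k0, by omega, h2⟩
        rcases Nat.lt_or_ge m k with hkm | hkm
        · obtain rfl : k = m + 1 := by omega
          rw [mem_reducedPositions_plus] at hp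
          push Not at hp
          obtain ⟨k1, hk1, hk1'⟩ := hp
          exact hk1'.trans (h1 k1 hk1)
        · exact h1 k hkm
  obtain ⟨h1, k0, -, h2⟩ := key n le_rfl
  have hf : (reducedPositions Sgn.plus t).filter (fun p => p.val < n) =
      reducedPositions Sgn.plus t := by
    ext i; simp
  rw [hf] at h1 h2
  refine ⟨fun k => ?_, k0, h2⟩
  rcases le_total k n with hk | hk
  · exact h1 k hk
  · rw [path_of_le t hk]
    exact h1 n le_rfl

/-- `ẽ` flips the step at which the lattice path first reaches its maximum. -/
theorem signCrystal_e_eq_some_iff (t t' : Fin n → Sgn) :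
    (signCrystal n).e t = some t' ↔ ∃ p, t p = Sgn.plus ∧ t' = Function.update t p Sgn.minus ∧
      (∀ k ≤ p.val, path t k < path t (p.val + 1)) ∧
      ∀ k, p.val < k → path t k ≤ path t (p.val + 1) := by
  have hlast : ∀ p, p ∈ reducedPositions Sgn.plus t →
      ((∀ q ∈ reducedPositions Sgn.plus t, q ≤ p) ↔
        ∀ k, p.val < k → path t k ≤ path t (p.val + 1)) := by
    intro p hp
    rw [mem_reducedPositions_plus] at hp
    constructor
    · intro hq k hk
      by_contra hcon
      -- the first place after `p` where the path exceeds its height at `p + 1` is a record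
      classical
      have hex : ∃ k, p.val < k ∧ path t (p.val + 1) < path t k := ⟨k, hk, not_le.1 hcon⟩
      obtain ⟨h1, h2⟩ := Nat.find_spec hex
      set m := Nat.find hex with hm
      have hmin : ∀ k < m, p.val < k → path t k ≤ path t (p.val + 1) := by
        intro k hkm hpk
        by_contra hc
        exact Nat.find_min hex hkm ⟨hpk, not_le.1 hc⟩
      have hmn : m - 1 < n := by
        by_contra hc
        have h3 := hmin (m - 1) (by omega) (by have := p.2; omega)
        rw [path_of_le t (by omega : n ≤ m)] at h2
        rw [path_of_le t (by omega : n ≤ m - 1)] at h3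
        omega
      have hm1 : m ≠ p.val + 1 := by
        intro hc; rw [hc] at h2; omega
      have := hq ⟨m - 1, hmn⟩ (by
        rw [mem_reducedPositions_plus]
        intro k hk
        simp only at hk ⊢
        rw [show m - 1 + 1 = m by omega]
        rcases Nat.lt_or_ge p.val k with h | h
        · exact (hmin k (by omega) h).trans_lt h2
        · exact (hp k h).trans h2)
      rw [Fin.le_def] at this
      simp only at this
      omega
    · intro h q hq
      by_contra hc
      rw [not_le, Fin.lt_def] at hc
      rw [mem_reducedPositions_plus] at hq
      have h1 := hq (p.val + 1) hc
      have h2 := h (q.val + 1) (by omega)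
      omega
  constructor
  · intro h
    simp only [signCrystal] at h
    split_ifs at h with hne
    have hmem := Finset.max'_mem _ hne
    refine ⟨_, eq_plus_of_mem_reducedPositions hmem, (Option.some.inj h).symm,
      (mem_reducedPositions_plus _ _).1 hmem, (hlast _ hmem).1 fun q hq => Finset.le_max' _ q hq⟩
  · rintro ⟨p, -, rfl, h1, h2⟩
    have hmem := (mem_reducedPositions_plus _ _).2 h1
    have hne : (reducedPositions Sgn.plus t).Nonempty := ⟨p, hmem⟩
    have hp : (reducedPositions Sgn.plus t).max' hne = p :=
      le_antisymm (Finset.max'_le _ _ _ ((hlast p hmem).2 h2)) (Finset.le_max' _ _ hmem)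
    simp only [signCrystal]
    rw [dif_pos hne, hp]

/-- `f̃` flips the step that follows the last maximum of the lattice path. -/
theorem signCrystal_f_eq_some_iff (t t' : Fin n → Sgn) :
    (signCrystal n).f t = some t' ↔ ∃ p, t p = Sgn.minus ∧ t' = Function.update t p Sgn.plus ∧
      (∀ k ≤ p.val, path t k ≤ path t p.val) ∧ ∀ k, p.val < k → path t k < path t p.val := by
  have hfirst : ∀ p, p ∈ reducedPositions Sgn.minus t →
      ((∀ q ∈ reducedPositions Sgn.minus t, p ≤ q) ↔
        ∀ k ≤ p.val, path t k ≤ path t p.val) := by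
    intro p hp
    rw [mem_reducedPositions_minus] at hp
    constructor
    · intro hq k hk
      by_contra hcon
      -- the last place before `p` where the path is higher than at `p` is a record
      classical
      have hex : ∃ j, j ≤ p.val ∧ path t p.val < path t (p.val - j) :=
        ⟨p.val - k, by omega, by rw [show p.val - (p.val - k) = k by omega]; exact not_le.1 hcon⟩
      obtain ⟨h1, h2⟩ := Nat.find_spec hex
      set j := Nat.find hex with hj
      have hmin : ∀ i < j, path t (p.val - i) ≤ path t p.val := by
        intro i hi
        by_contra hc
        exact Nat.find_min hex hi ⟨by omega, not_le.1 hc⟩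
      have hj0 : j ≠ 0 := by
        intro hc; rw [hc] at h2; simp at h2
      have hp2 := p.2
      have := hq ⟨p.val - j, by omega⟩ (by
        rw [mem_reducedPositions_minus]
        intro k hk
        simp only at hk ⊢
        rcases Nat.lt_or_ge p.val k with h | h
        · exact (hp k h).trans h2
        · have := hmin (p.val - k) (by omega)
          rw [show p.val - (p.val - k) = k by omega] at this
          exact this.trans_lt h2)
      rw [Fin.le_def] at this
      simp only at this
      omega
    · intro h q hq
      by_contra hc
      rw [not_le, Fin.lt_def] at hc
      rw [mem_reducedPositions_minus] at hq
      have h1 := hq p.val hc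
      have h2 := h q.val hc.le
      omega
  constructor
  · intro h
    simp only [signCrystal] at h
    split_ifs at h with hne
    have hmem := Finset.min'_mem _ hne
    refine ⟨_, eq_minus_of_mem_reducedPositions hmem, (Option.some.inj h).symm,
      (hfirst _ hmem).1 fun q hq => Finset.min'_le _ q hq, (mem_reducedPositions_minus _ _).1 hmem⟩
  · rintro ⟨p, -, rfl, h1, h2⟩
    have hmem := (mem_reducedPositions_minus _ _).2 h2
    have hne : (reducedPositions Sgn.minus t).Nonempty := ⟨p, hmem⟩
    have hp : (reducedPositions Sgn.minus t).min' hne = p :=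
      le_antisymm (Finset.min'_le _ _ hmem) (Finset.le_min' _ _ _ ((hfirst p hmem).2 h1))
    simp only [signCrystal]
    rw [dif_pos hne, hp]

theorem signCrystal_wt_eq (t : Fin n → Sgn) :
    (signCrystal n).wt t = (signCrystal n).hMinus t - (signCrystal n).hPlus t := rfl

theorem wt_update_minus {t : Fin n → Sgn} {p : Fin n} (hp : t p = Sgn.plus) :
    (signCrystal n).wt (Function.update t p Sgn.minus) = (signCrystal n).wt t + 2 := by
  rw [signCrystal_wt, signCrystal_wt, path_update, hp, if_pos p.2]
  simp only [signStep]
  ring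

theorem hPlus_of_signCrystal_e {t t' : Fin n → Sgn} (h : (signCrystal n).e t = some t') :
    (signCrystal n).hPlus t' + 1 = (signCrystal n).hPlus t := by
  obtain ⟨p, hp, rfl, h1, h2⟩ := (signCrystal_e_eq_some_iff t t').1 h
  obtain ⟨a1, k1, a2⟩ := signCrystal_hPlus t
  obtain ⟨b1, k2, b2⟩ := signCrystal_hPlus (Function.update t p Sgn.minus)
  have hs := path_succ t p
  rw [hp] at hs
  have c1 := a1 (p.val + 1)
  have c2 := b1 p.val
  rw [path_update, hp] at b2 c2
  simp only [signStep, lt_irrefl, if_false] at hs b2 c2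
  have e1 : path t k1 ≤ path t (p.val + 1) := by
    rcases Nat.lt_or_ge p.val k1 with h | h
    · exact h2 _ h
    · exact (h1 _ h).le
  rcases Nat.lt_or_ge p.val k2 with h | h
  · have := h2 _ h
    rw [if_pos h] at b2
    omega
  · have := h1 _ h
    rw [if_neg (by omega)] at b2
    omega

theorem signCrystal_isCrystal (n : ℕ) : (signCrystal n).IsCrystal where
  wt_eq _ := rfl
  e_eq_none_iff t := by
    simp only [signCrystal, Finset.card_eq_zero]
    split_ifs with h
    · simp [h.ne_empty]
    · simp [Finset.not_nonempty_iff_eq_empty.1 h]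
  f_eq_none_iff t := by
    simp only [signCrystal, Finset.card_eq_zero]
    split_ifs with h
    · simp [h.ne_empty]
    · simp [Finset.not_nonempty_iff_eq_empty.1 h]
  e_eq_some_iff t t' := by
    rw [signCrystal_e_eq_some_iff, signCrystal_f_eq_some_iff]
    constructor
    · rintro ⟨p, hp, rfl, h1, h2⟩
      have hs := path_succ t p
      rw [hp] at hs
      simp only [signStep] at hs
      refine ⟨p, by simp, by simp [← hp], fun k hk => ?_, fun k hk => ?_⟩
      · have := h1 k hk
        rw [path_update, path_update, if_neg (by omega), if_neg (by omega)]
        omega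
      · have := h2 k hk
        rw [path_update, path_update, if_pos hk, if_neg (by omega), hp]
        simp only [signStep]
        omega
    · rintro ⟨p, hp, rfl, h1, h2⟩
      have hs := path_succ t' p
      rw [hp] at hs
      simp only [signStep] at hs
      refine ⟨p, by simp, by simp [← hp], fun k hk => ?_, fun k hk => ?_⟩
      · have := h1 k hk
        rw [path_update, path_update, if_neg (by omega), if_pos (by omega), hp]
        simp only [signStep]
        omega
      · have := h2 k hk
        rw [path_update, path_update, if_pos hk, if_pos (by omega), hp]
        simp only [signStep]
        omega
  h_of_e t t' h := by
    have h1 := hPlus_of_signCrystal_e h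
    obtain ⟨p, hp, rfl, -, -⟩ := (signCrystal_e_eq_some_iff t t').1 h
    have h2 := wt_update_minus hp
    rw [signCrystal_wt_eq, signCrystal_wt_eq] at h2
    omega

/-- A flip of a `+` that lowers `h₊` takes place no later than the one made by `ẽ`. -/
theorem le_of_hPlus_update_lt {t : Fin n → Sgn} {i p : Fin n}
    (h : (signCrystal n).hPlus (Function.update t i Sgn.minus) < (signCrystal n).hPlus t)
    (h1 : ∀ k ≤ p.val, path t k < path t (p.val + 1))
    (h2 : ∀ k, p.val < k → path t k ≤ path t (p.val + 1)) : i ≤ p := by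
  by_contra hc
  rw [not_le, Fin.lt_def] at hc
  obtain ⟨-, k1, a2⟩ := signCrystal_hPlus t
  obtain ⟨b1, -⟩ := signCrystal_hPlus (Function.update t i Sgn.minus)
  have b := b1 (p.val + 1)
  rw [path_update, if_neg (by omega)] at b
  have e1 : path t k1 ≤ path t (p.val + 1) := by
    rcases Nat.lt_or_ge p.val k1 with h | h
    · exact h2 _ h
    · exact (h1 _ h).le
  omega

end SignCrystal

/-! ### Rigidity of crystal structures on sign sequences -/

section Rigidity

variable {n : ℕ}

/-- A raising operator on sign sequences, with its depth function `h`: on `{h > 0}` it changes one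
`+` to `-` and lowers `h` by one, and it maps onto the set of `t` with `h t + wt t > 0`. Injectivity
is a consequence. -/
structure IsRaising (h : (Fin n → Sgn) → ℕ) (G : (Fin n → Sgn) → (Fin n → Sgn)) : Prop where
  nonneg : ∀ t, 0 ≤ (h t : ℤ) + (signCrystal n).wt t
  flip : ∀ t, 0 < h t → ∃ j, t j = Sgn.plus ∧ G t = Function.update t j Sgn.minus
  depth : ∀ t, 0 < h t → h (G t) + 1 = h t
  surj : ∀ s, 0 < (h s : ℤ) + (signCrystal n).wt s → ∃ t, 0 < h t ∧ G t = s

/-- The opposite sign. -/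
def Sgn.neg : Sgn → Sgn
  | Sgn.plus => Sgn.minus
  | Sgn.minus => Sgn.plus

theorem Sgn.neg_neg (s : Sgn) : s.neg.neg = s := by cases s <;> rfl

instance : Fintype Sgn := ⟨{Sgn.plus, Sgn.minus}, fun s => by cases s <;> simp⟩

theorem wt_neg (t : Fin n → Sgn) :
    (signCrystal n).wt (fun i => (t i).neg) = - (signCrystal n).wt t := by
  rw [signCrystal_wt, signCrystal_wt, path, path, height, height, neg_neg,
    ← Finset.sum_neg_distrib]
  refine Finset.sum_congr rfl fun i _ => ?_
  cases t i <;> simp [signStep, Sgn.neg]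

theorem card_wt_neg (w : ℤ) :
    (Finset.univ.filter fun t : Fin n → Sgn => (signCrystal n).wt t = -w).card =
      (Finset.univ.filter fun t : Fin n → Sgn => (signCrystal n).wt t = w).card := by
  refine Finset.card_nbij' (fun t i => (t i).neg) (fun t i => (t i).neg) ?_ ?_ ?_ ?_
  · intro t ht
    simp only [Finset.coe_filter, Finset.mem_univ, true_and, Set.mem_ofPred_eq] at ht ⊢
    rw [wt_neg]
    omega
  · intro t ht
    simp only [Finset.coe_filter, Finset.mem_univ, true_and, Set.mem_ofPred_eq] at ht ⊢
    rw [wt_neg]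
    omega
  · intro t _
    simp [Sgn.neg_neg]
  · intro t _
    simp [Sgn.neg_neg]

namespace IsRaising

variable {h : (Fin n → Sgn) → ℕ} {G : (Fin n → Sgn) → (Fin n → Sgn)}

theorem wt (hG : IsRaising h G) {t : Fin n → Sgn} (ht : 0 < h t) :
    (signCrystal n).wt (G t) = (signCrystal n).wt t + 2 := by
  obtain ⟨j, hj, hj'⟩ := hG.flip t ht
  rw [hj', wt_update_minus hj]

theorem exists_iterate_eq (hG : IsRaising h G) (i : ℕ) : ∀ s : Fin n → Sgn,
    (i : ℤ) ≤ (h s : ℤ) + (signCrystal n).wt s →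
    ∃ t, h t = h s + i ∧ (signCrystal n).wt t = (signCrystal n).wt s - 2 * i ∧ G^[i] t = s := by
  induction i with
  | zero => exact fun s _ => ⟨s, by simp, by simp, rfl⟩
  | succ i ih =>
    intro s hs
    push_cast at hs
    obtain ⟨t₁, h1, rfl⟩ := hG.surj s (by omega)
    have h2 := hG.depth t₁ h1
    have h3 := hG.wt h1
    obtain ⟨t, h4, h5, h6⟩ := ih t₁ (by omega)
    refine ⟨t, by omega, by push_cast; omega, ?_⟩
    rw [Function.iterate_succ_apply', h6]

theorem wt_iterate (hG : IsRaising h G) (i : ℕ) : ∀ t : Fin n → Sgn, i ≤ h t →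
    (signCrystal n).wt (G^[i] t) = (signCrystal n).wt t + 2 * i := by
  induction i with
  | zero => simp
  | succ i ih =>
    intro t ht
    have h1 := hG.depth t (by omega)
    rw [Function.iterate_succ_apply, ih _ (by omega), hG.wt (by omega)]
    push_cast
    ring

/-- The `d`-th power of a raising operator maps the weight space `-d` onto the weight space `d`;
since they have the same number of elements, it is injective there. -/
theorem injOn_iterate (hG : IsRaising h G) (d : ℕ) :
    Set.InjOn (G^[d]) {t | (signCrystal n).wt t = -d} := by
  have hsub := Finset.injOn_of_surjOn_of_card_le (f := G^[d])
    (s := Finset.univ.filter fun t : Fin n → Sgn => (signCrystal n).wt t = -d)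
    (t := Finset.univ.filter fun t : Fin n → Sgn => (signCrystal n).wt t = d) ?_ ?_
    (card_wt_neg _).le
  · simpa using hsub
  · intro t ht
    simp only [Finset.coe_filter, Finset.mem_univ, true_and, Set.mem_ofPred_eq] at ht ⊢
    have := hG.nonneg t
    rw [hG.wt_iterate d t (by omega), ht]
    ring
  · intro s hs
    simp only [Finset.coe_filter, Finset.mem_univ, true_and, Set.mem_ofPred_eq] at hs ⊢
    obtain ⟨t, -, h2, h3⟩ := hG.exists_iterate_eq d s (by omega)
    exact ⟨t, by simp only [Set.mem_ofPred_eq]; omega, h3⟩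

theorem injOn (hG : IsRaising h G) : Set.InjOn G {t | 0 < h t} := by
  intro t₁ h1 t₂ h2 heq
  simp only [Set.mem_ofPred_eq] at h1 h2
  have w1 := hG.wt h1
  have w2 := hG.wt h2
  rw [heq] at w1
  -- pull `t₁` and `t₂` back to a negative weight `-(j + 1 + m)`
  obtain ⟨j, m, hj, hm⟩ : ∃ j m : ℕ, (j : ℤ) ≤ max 0 ((signCrystal n).wt t₁ + 1) ∧
      (signCrystal n).wt t₁ - 2 * j = -((j + 1 + m : ℕ) : ℤ) := by
    rcases le_or_gt 0 ((signCrystal n).wt t₁) with hw | hw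
    · exact ⟨((signCrystal n).wt t₁ + 1).toNat, 0, by omega, by push_cast; omega⟩
    · exact ⟨0, (-(signCrystal n).wt t₁ - 1).toNat, by omega, by push_cast; omega⟩
  have n1 := hG.nonneg t₁
  have n2 := hG.nonneg t₂
  obtain ⟨s₁, -, b1, c1⟩ := hG.exists_iterate_eq j t₁ (by omega)
  obtain ⟨s₂, -, b2, c2⟩ := hG.exists_iterate_eq j t₂ (by omega)
  have : s₁ = s₂ := by
    refine hG.injOn_iterate (j + 1 + m) (by simp only [Set.mem_ofPred_eq]; omega)
      (by simp only [Set.mem_ofPred_eq]; omega) ?_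
    rw [show j + 1 + m = m + (j + 1) by ring, Function.iterate_add_apply G m (j + 1) s₁,
      Function.iterate_add_apply G m (j + 1) s₂, Function.iterate_succ_apply',
      Function.iterate_succ_apply', c1, c2, heq]
  rw [← c1, ← c2, this]

theorem iterate_injective (hG : IsRaising h G) (i : ℕ) : ∀ t₁ t₂ : Fin n → Sgn, i ≤ h t₁ →
    i ≤ h t₂ → G^[i] t₁ = G^[i] t₂ → t₁ = t₂ := by
  induction i with
  | zero => intro t₁ t₂ _ _ heq; exact heq
  | succ i ih =>
    intro t₁ t₂ h1 h2 heq
    rw [Function.iterate_succ_apply, Function.iterate_succ_apply] at heq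
    have d1 := hG.depth t₁ (by omega)
    have d2 := hG.depth t₂ (by omega)
    exact hG.injOn (by simp only [Set.mem_ofPred_eq]; omega) (by simp only [Set.mem_ofPred_eq]; omega)
      (ih _ _ (by omega) (by omega) heq)

/-- Two depth functions of raising operators agree as soon as they are comparable: both `G^[i]` and
`G'^[i]` identify the elements of weight `w` and depth at least `i` with those of weight
`w + 2 i`. -/
theorem depth_eq {h' : (Fin n → Sgn) → ℕ} {G' : (Fin n → Sgn) → (Fin n → Sgn)}
    (hG : IsRaising h G) (hG' : IsRaising h' G') (hle : ∀ t, h t ≤ h' t) (t : Fin n → Sgn) :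
    h t = h' t := by
  refine le_antisymm (hle t) ?_
  set i := h' t with hi
  set w := (signCrystal n).wt t with hw
  have hnn := hG'.nonneg t
  set A := Finset.univ.filter fun s : Fin n → Sgn => (signCrystal n).wt s = w ∧ i ≤ h s
  set A' := Finset.univ.filter fun s : Fin n → Sgn => (signCrystal n).wt s = w ∧ i ≤ h' s
  set B := Finset.univ.filter fun s : Fin n → Sgn => (signCrystal n).wt s = w + 2 * i
  have h1 : A ⊆ A' := by
    intro s hs
    simp only [A, A', Finset.mem_filter, Finset.mem_univ, true_and] at hs ⊢
    exact ⟨hs.1, hs.2.trans (hle s)⟩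
  have h2 : A'.card ≤ B.card := by
    refine Finset.card_le_card_of_injOn (G'^[i]) ?_ ?_
    · intro s hs
      simp only [A', B, Finset.coe_filter, Finset.mem_univ, true_and, Set.mem_ofPred_eq] at hs ⊢
      rw [hG'.wt_iterate i s hs.2, hs.1]
    · intro s₁ hs₁ s₂ hs₂ heq
      simp only [A', Finset.coe_filter, Finset.mem_univ, true_and, Set.mem_ofPred_eq] at hs₁ hs₂
      exact hG'.iterate_injective i s₁ s₂ hs₁.2 hs₂.2 heq
  have h3 : B.card ≤ A.card := by
    refine Finset.card_le_card_of_surjOn (G^[i]) ?_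
    intro s hs
    simp only [A, B, Finset.coe_filter, Finset.mem_univ, true_and, Set.mem_ofPred_eq] at hs ⊢
    obtain ⟨r, a1, a2, a3⟩ := hG.exists_iterate_eq i s (by omega)
    exact ⟨r, by simp only [Set.mem_ofPred_eq]; omega, a3⟩
  have h4 := Finset.eq_of_subset_of_card_le h1 (h2.trans h3)
  have h5 : t ∈ A := by
    rw [h4]
    simp only [A', Finset.mem_filter, Finset.mem_univ, true_and]
    exact ⟨hw.symm, hi.le⟩
  simp only [A, Finset.mem_filter] at h5
  exact h5.2.2

end IsRaising

/-- `ẽ` on sign sequences, extended by the identity where it vanishes. -/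
noncomputable def signRaise (t : Fin n → Sgn) : Fin n → Sgn := ((signCrystal n).e t).getD t

theorem signCrystal_e_eq_some {t : Fin n → Sgn} (ht : 0 < (signCrystal n).hPlus t) :
    (signCrystal n).e t = some (signRaise t) := by
  rcases he : (signCrystal n).e t with _ | s
  · rw [(signCrystal_isCrystal n).e_eq_none_iff] at he
    omega
  · simp [signRaise, he]

theorem signCrystal_isRaising : IsRaising (signCrystal n).hPlus signRaise where
  nonneg t := by
    rw [signCrystal_wt_eq]
    omega
  flip t ht := by
    obtain ⟨p, h1, h2, -⟩ := (signCrystal_e_eq_some_iff _ _).1 (signCrystal_e_eq_some ht)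
    exact ⟨p, h1, h2⟩
  depth t ht := hPlus_of_signCrystal_e (signCrystal_e_eq_some ht)
  surj s hs := by
    rw [signCrystal_wt_eq] at hs
    rcases hf : (signCrystal n).f s with _ | t
    · rw [(signCrystal_isCrystal n).f_eq_none_iff] at hf
      omega
    · rw [← (signCrystal_isCrystal n).e_eq_some_iff] at hf
      have h1 := hPlus_of_signCrystal_e hf
      refine ⟨t, by omega, ?_⟩
      simp [signRaise, hf]

/-- The sum of the places of the signs `-`. -/
def minusPlaces (t : Fin n → Sgn) : ℕ := ∑ i with t i = Sgn.minus, i.val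

theorem minusPlaces_update {t : Fin n → Sgn} {j : Fin n} (hj : t j = Sgn.plus) :
    minusPlaces (Function.update t j Sgn.minus) = minusPlaces t + j.val := by
  have : (Finset.univ.filter fun i => Function.update t j Sgn.minus i = Sgn.minus) =
      insert j (Finset.univ.filter fun i => t i = Sgn.minus) := by
    ext i
    by_cases h : i = j
    · subst h; simp
    · simp [h]
  rw [minusPlaces, this, Finset.sum_insert (by simp [hj]), add_comm, minusPlaces]

/-- A raising operator with the depth function `h₊` flips at each `t` a place not beyond the one
flipped by `ẽ`; as both operators are bijections between the same sets, the sums of the flipped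
places agree, so they coincide. -/
theorem IsRaising.eq_signRaise {G : (Fin n → Sgn) → (Fin n → Sgn)}
    (hG : IsRaising (signCrystal n).hPlus G) {t : Fin n → Sgn}
    (ht : 0 < (signCrystal n).hPlus t) : G t = signRaise t := by
  classical
  set A := Finset.univ.filter fun t : Fin n → Sgn => 0 < (signCrystal n).hPlus t
  set B := Finset.univ.filter fun s : Fin n → Sgn =>
    0 < ((signCrystal n).hPlus s : ℤ) + (signCrystal n).wt s
  have himg : ∀ {G' : (Fin n → Sgn) → (Fin n → Sgn)}, IsRaising (signCrystal n).hPlus G' →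
      ∑ t ∈ A, minusPlaces (G' t) = ∑ s ∈ B, minusPlaces s := by
    intro G' hG'
    refine Finset.sum_nbij G' ?_ ?_ ?_ fun _ _ => rfl
    · intro t ht
      simp only [A, B, Finset.mem_filter, Finset.mem_univ, true_and] at ht ⊢
      have h1 := hG'.depth t ht
      have h2 := hG'.wt ht
      have h3 := hG'.nonneg t
      omega
    · intro t₁ h1 t₂ h2 heq
      simp only [A, Finset.coe_filter, Finset.mem_univ, true_and] at h1 h2
      exact hG'.injOn h1 h2 heq
    · intro s hs
      simp only [A, B, Finset.coe_filter, Finset.mem_univ, true_and, Set.mem_ofPred_eq] at hs ⊢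
      obtain ⟨t, h1, h2⟩ := hG'.surj s hs
      exact ⟨t, h1, h2⟩
  have hplace : ∀ t, 0 < (signCrystal n).hPlus t → ∃ j p : Fin n, j ≤ p ∧ t j = Sgn.plus ∧
      t p = Sgn.plus ∧ G t = Function.update t j Sgn.minus ∧
      signRaise t = Function.update t p Sgn.minus := by
    intro t ht
    obtain ⟨p, h1, h2, h3, h4⟩ := (signCrystal_e_eq_some_iff _ _).1 (signCrystal_e_eq_some ht)
    obtain ⟨j, h5, h6⟩ := hG.flip t ht
    have h7 := hG.depth t ht
    rw [h6] at h7
    exact ⟨j, p, le_of_hPlus_update_lt (by omega) h3 h4, h5, h1, h6, h2⟩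
  have hle : ∀ t ∈ A, minusPlaces (G t) ≤ minusPlaces (signRaise t) := by
    intro t ht
    simp only [A, Finset.mem_filter, Finset.mem_univ, true_and] at ht
    obtain ⟨j, p, h1, h2, h3, h4, h5⟩ := hplace t ht
    rw [h4, h5, minusPlaces_update h2, minusPlaces_update h3]
    have : j.val ≤ p.val := h1
    omega
  have heq := (Finset.sum_eq_sum_iff_of_le hle).1 ((himg hG).trans (himg signCrystal_isRaising).symm)
    t (by simpa [A] using ht)
  obtain ⟨j, p, h1, h2, h3, h4, h5⟩ := hplace t ht
  rw [h4, h5, minusPlaces_update h2, minusPlaces_update h3] at heq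
  rw [h4, h5, show j = p from Fin.ext (by omega)]

end Rigidity

/-! ### Affine Hecke operators on powers of a functor -/

section Powers

variable {C : Type u} [Category.{v} C]

/-- The `n`-th power of an endofunctor; `G` is applied first and `Gⁿ` after it, as in
`Function.iterate`. -/
def iterF (G : C ⥤ C) : ℕ → (C ⥤ C)
  | 0 => 𝟭 C
  | n + 1 => G ⋙ iterF G n

theorem iterF_obj (G : C ⥤ C) (n : ℕ) : ∀ M : C, (iterF G n).obj M = G.obj^[n] M := by
  induction n with
  | zero => exact fun _ => rfl
  | succ n ih => exact fun M => ih (G.obj M)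

theorem iterF_succ_obj (G : C ⥤ C) (n : ℕ) (M : C) :
    (iterF G (n + 1)).obj M = G.obj ((iterF G n).obj M) := by
  rw [iterF_obj, iterF_obj, Function.iterate_succ_apply']

theorem iterF_add_obj (G : C ⥤ C) (m n : ℕ) (M : C) :
    (iterF G (m + n)).obj M = (iterF G m).obj ((iterF G n).obj M) := by
  rw [iterF_obj, iterF_obj, iterF_obj, Function.iterate_add_apply]

/-- The operators `T_i ⋯ T_{n-1} T_n`, for `i ≤ n`, on `Eⁿ⁺¹`, where `T_j` acts on the `j`-th and the
`(j+1)`-st factor counted from the outermost one; here `i` is counted from `0`, and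
`i = n` gives the identity. -/
def heckeChain {E : C ⥤ C} (T : ∀ M : C, E.obj (E.obj M) ⟶ E.obj (E.obj M)) :
    ∀ (n : ℕ) (_ : Fin (n + 1)) (M : C), (iterF E n).obj (E.obj M) ⟶ (iterF E n).obj (E.obj M)
  | 0, _, _ => 𝟙 _
  | n + 1, i, M => Fin.lastCases (motive := fun _ => (iterF E n).obj (E.obj (E.obj M)) ⟶
      (iterF E n).obj (E.obj (E.obj M))) (𝟙 _)
      (fun j => (iterF E n).map (T M) ≫ heckeChain T n j (E.obj M)) i

variable {E : C ⥤ C} {T : ∀ M : C, E.obj (E.obj M) ⟶ E.obj (E.obj M)}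

theorem heckeChain_naturality
    (hT : ∀ {M M' : C} (g : M ⟶ M'), E.map (E.map g) ≫ T M' = T M ≫ E.map (E.map g)) (n : ℕ) :
    ∀ (i : Fin (n + 1)) (M M' : C) (g : M ⟶ M'),
    (iterF E n).map (E.map g) ≫ heckeChain T n i M' =
      heckeChain T n i M ≫ (iterF E n).map (E.map g) := by
  induction n with
  | zero => intro i M M' g; simp [heckeChain]
  | succ n ih =>
    intro i M M' g
    change (iterF E n).map (E.map (E.map g)) ≫ (Fin.lastCases (motive := fun _ =>
      (iterF E n).obj (E.obj (E.obj M')) ⟶ (iterF E n).obj (E.obj (E.obj M'))) _ _ i) =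
      (Fin.lastCases (motive := fun _ =>
      (iterF E n).obj (E.obj (E.obj M)) ⟶ (iterF E n).obj (E.obj (E.obj M))) _ _ i) ≫
      (iterF E n).map (E.map (E.map g))
    refine Fin.lastCases ?_ (fun j => ?_) i
    · simp
    · simp only [Fin.lastCases_castSucc]
      rw [Category.assoc, ← ih j _ _ (E.map g), ← Functor.map_comp_assoc, ← Functor.map_comp_assoc,
        hT g]

variable [Abelian C]

instance (G : C ⥤ C) [G.Additive] (n : ℕ) : (iterF G n).Additive := by
  induction n with
  | zero => exact inferInstanceAs (𝟭 C).Additive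
  | succ n ih => exact inferInstanceAs (G ⋙ iterF G n).Additive

instance {k : Type*} [Semiring k] [Linear k C] (G : C ⥤ C) [G.Additive] [G.Linear k] (n : ℕ) :
    (iterF G n).Linear k := by
  induction n with
  | zero => exact inferInstanceAs ((𝟭 C).Linear k)
  | succ n ih => exact inferInstanceAs ((G ⋙ iterF G n).Linear k)

instance (G : C ⥤ C) [PreservesFiniteLimits G] (n : ℕ) : PreservesFiniteLimits (iterF G n) := by
  induction n with
  | zero => exact inferInstanceAs (PreservesFiniteLimits (𝟭 C))
  | succ n ih => exact comp_preservesFiniteLimits G (iterF G n)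

instance (G : C ⥤ C) [PreservesFiniteColimits G] (n : ℕ) :
    PreservesFiniteColimits (iterF G n) := by
  induction n with
  | zero => exact inferInstanceAs (PreservesFiniteColimits (𝟭 C))
  | succ n ih => exact comp_preservesFiniteColimits G (iterF G n)

end Powers

section Hecke

variable {k : Type*} [Field k] {C : Type u} [Category.{v} C] [Abelian C] [Linear k C]

/-- The inductive step for `heckeChain_independent`. Here `τ` is a family of operators on `F E` and
`T` acts on `E²`; if the `τ i` are independent on vectors killed by `X - a`, so are the
`τ i T` together with the identity. -/
theorem independent_step {E : C ⥤ C} [E.Additive] [E.Linear k] (X : E ⟶ E) {a α β : k}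
    (hβ : α + β * a ≠ 0) (T : ∀ M : C, E.obj (E.obj M) ⟶ E.obj (E.obj M))
    (hrel : ∀ M : C, T M ≫ E.map (X.app M) =
      X.app (E.obj M) ≫ T M - (α • 𝟙 _ + β • X.app (E.obj M)))
    (hnil : ∀ M : C, IsNilpotent (R := End (E.obj M)) (X.app M - a • 𝟙 (E.obj M)))
    {F : C ⥤ C} [F.Additive] [F.Linear k] {ι : Type*} [Fintype ι]
    (τ : ι → ∀ M : C, F.obj (E.obj M) ⟶ F.obj (E.obj M))
    (hτ : ∀ i (M M' : C) (g : M ⟶ M'), F.map (E.map g) ≫ τ i M' = τ i M ≫ F.map (E.map g))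
    {A : C} (ind : ∀ (M : C) (v : ι → (A ⟶ F.obj (E.obj M))),
      (∀ i, v i ≫ F.map (X.app M - a • 𝟙 _) = 0) → ∑ i, v i ≫ τ i M = 0 → ∀ i, v i = 0)
    (M : C) (v : ι → (A ⟶ F.obj (E.obj (E.obj M)))) (w : A ⟶ F.obj (E.obj (E.obj M)))
    (hv : ∀ i, v i ≫ F.map (E.map (X.app M - a • 𝟙 _)) = 0)
    (hw : w ≫ F.map (E.map (X.app M - a • 𝟙 _)) = 0)
    (hsum : ∑ i, v i ≫ F.map (T M) ≫ τ i (E.obj M) + w = 0) : (∀ i, v i = 0) ∧ w = 0 := by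
  set x : E.obj (E.obj M) ⟶ E.obj (E.obj M) := X.app (E.obj M) - a • 𝟙 _ with hx
  set y : E.obj (E.obj M) ⟶ E.obj (E.obj M) := E.map (X.app M - a • 𝟙 _) with hy
  set g : E.obj (E.obj M) ⟶ E.obj (E.obj M) := α • 𝟙 _ + β • X.app (E.obj M) with hg
  have hXy : X.app (E.obj M) ≫ y = y ≫ X.app (E.obj M) :=
    (X.naturality (X.app M - a • 𝟙 (E.obj M))).symm
  have hxy : x ≫ y = y ≫ x := by
    rw [hx, Preadditive.sub_comp, Preadditive.comp_sub, hXy]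
    simp
  have hgy : g ≫ y = y ≫ g := by
    rw [hg, Preadditive.add_comp, Preadditive.comp_add, Linear.smul_comp, Linear.smul_comp,
      Linear.comp_smul, Linear.comp_smul, hXy]
    simp
  have hTy : T M ≫ y = x ≫ T M - g := by
    rw [hy, E.map_sub, E.map_smul, E.map_id, Preadditive.comp_sub, hrel, hx,
      Preadditive.sub_comp]
    simp only [Linear.comp_smul, Linear.smul_comp, Category.comp_id, Category.id_comp]
    rw [hg]
    abel
  have hgx : g = (α + β * a) • 𝟙 _ + β • x := by
    rw [hg, hx, smul_sub, add_smul, smul_smul]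
    abel
  have hτy : ∀ i, F.map y ≫ τ i (E.obj M) = τ i (E.obj M) ≫ F.map y := fun i => hτ i _ _ _
  suffices H : ∀ (N : ℕ) (v : ι → (A ⟶ F.obj (E.obj (E.obj M))))
      (w : A ⟶ F.obj (E.obj (E.obj M))), (∀ i, v i ≫ F.map (y) = 0) → w ≫ F.map y = 0 →
      (∀ i, v i ≫ F.map ((show End (E.obj (E.obj M)) from x) ^ N) = 0) →
      ∑ i, v i ≫ F.map (T M) ≫ τ i (E.obj M) + w = 0 → (∀ i, v i = 0) ∧ w = 0 by
    obtain ⟨N, hN⟩ := hnil (E.obj M)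
    refine H N v w hv hw (fun i => ?_) hsum
    have : ((show End (E.obj (E.obj M)) from x) ^ N) = 0 := hN
    rw [this]
    exact (congrArg (v i ≫ ·) (F.map_zero _ _)).trans comp_zero
  intro N
  induction N with
  | zero =>
    intro v w _ _ hN hsum
    have hv0 : ∀ i, v i = 0 := fun i => by
      have h := hN i
      rw [pow_zero, End.one_def, F.map_id, Category.comp_id] at h
      exact h
    refine ⟨hv0, ?_⟩
    simpa [hv0] using hsum
  | succ N ih =>
    intro v w hv hw hN hsum
    -- applying `X - a` at the last place turns the relation into one of smaller nilpotency degree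
    have h1 := congrArg (· ≫ F.map y) hsum
    simp only [Preadditive.add_comp, Preadditive.sum_comp, Category.assoc, zero_comp, hw,
      add_zero] at h1
    have h2 : ∀ i, v i ≫ F.map (T M) ≫ τ i (E.obj M) ≫ F.map y =
        (v i ≫ F.map x) ≫ F.map (T M) ≫ τ i (E.obj M) - v i ≫ F.map g ≫ τ i (E.obj M) := by
      intro i
      rw [← hτy, ← F.map_comp_assoc, hTy, F.map_sub, F.map_comp]
      simp only [Preadditive.sub_comp, Preadditive.comp_sub, Category.assoc]
    rw [Finset.sum_congr rfl fun i _ => h2 i, Finset.sum_sub_distrib, sub_eq_add_neg] at h1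
    obtain ⟨h3, h4⟩ := ih (fun i => v i ≫ F.map x) _ (fun i => by
        rw [Category.assoc, ← F.map_comp, hxy, F.map_comp, ← Category.assoc, hv, zero_comp])
      (by
        rw [Preadditive.neg_comp, Preadditive.sum_comp, neg_eq_zero]
        refine Finset.sum_eq_zero fun i _ => ?_
        rw [Category.assoc, Category.assoc, ← hτy, ← F.map_comp_assoc, hgy, F.map_comp_assoc,
          ← Category.assoc, hv, zero_comp])
      (fun i => by
        have h := hN i
        rw [pow_succ, End.mul_def, F.map_comp, ← Category.assoc] at h
        exact h) h1
    have h5 : ∀ i, v i ≫ F.map g = (α + β * a) • v i := by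
      intro i
      rw [hgx, F.map_add, F.map_smul, F.map_smul, F.map_id, Preadditive.comp_add,
        Linear.comp_smul, Linear.comp_smul, h3 i]
      simp
    have h6 : ∑ i, v i ≫ τ i (E.obj M) = 0 := by
      rw [neg_eq_zero] at h4
      have h7 : (α + β * a) • ∑ i, v i ≫ τ i (E.obj M) = 0 := by
        rw [Finset.smul_sum, ← h4]
        refine Finset.sum_congr rfl fun i _ => ?_
        rw [← Category.assoc, h5, Linear.smul_comp]
      exact (smul_eq_zero.1 h7).resolve_left hβ
    have hv0 := ind (E.obj M) v h3 h6
    refine ⟨hv0, ?_⟩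
    simpa [hv0] using hsum

variable {E : C ⥤ C} {T : ∀ M : C, E.obj (E.obj M) ⟶ E.obj (E.obj M)}

/-- The induced module of a module on which the last polynomial generator acts by the scalar `a`
embeds: vectors `v i` killed by `X - a` are independent after the application of the operators
`T_i ⋯ T_n`. The only input is the commutation relation
`x_{n+1} T_n = T_n x_n - (α + β x_n)` with `α + β a ≠ 0`. -/
theorem heckeChain_independent [E.Additive] [E.Linear k] (X : E ⟶ E) {a α β : k}
    (hβ : α + β * a ≠ 0)
    (hT : ∀ {M M' : C} (g : M ⟶ M'), E.map (E.map g) ≫ T M' = T M ≫ E.map (E.map g))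
    (hrel : ∀ M : C, T M ≫ E.map (X.app M) =
      X.app (E.obj M) ≫ T M - (α • 𝟙 _ + β • X.app (E.obj M)))
    (hnil : ∀ M : C, IsNilpotent (R := End (E.obj M)) (X.app M - a • 𝟙 (E.obj M))) (A : C) (n : ℕ) :
    ∀ (M : C) (v : Fin (n + 1) → (A ⟶ (iterF E n).obj (E.obj M))),
      (∀ i, v i ≫ (iterF E n).map (X.app M - a • 𝟙 _) = 0) →
      ∑ i, v i ≫ heckeChain T n i M = 0 → ∀ i, v i = 0 := by
  induction n with
  | zero =>
    intro M v _ h i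
    obtain rfl : i = 0 := Fin.ext (by omega)
    simpa [heckeChain] using h
  | succ n ih =>
    intro M
    change ∀ (v : Fin (n + 2) → (A ⟶ (iterF E n).obj (E.obj (E.obj M)))),
      (∀ i, v i ≫ (iterF E n).map (E.map (X.app M - a • 𝟙 _)) = 0) →
      ∑ i, v i ≫ (Fin.lastCases (motive := fun _ =>
      (iterF E n).obj (E.obj (E.obj M)) ⟶ (iterF E n).obj (E.obj (E.obj M))) (𝟙 _)
      (fun j => (iterF E n).map (T M) ≫ heckeChain T n j (E.obj M)) i) = 0 → ∀ i, v i = 0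
    intro v hv hsum
    rw [Fin.sum_univ_castSucc] at hsum
    simp only [Fin.lastCases_castSucc, Fin.lastCases_last, Category.comp_id] at hsum
    obtain ⟨h1, h2⟩ := independent_step X hβ T hrel hnil (heckeChain T n)
      (heckeChain_naturality hT n) ih M (fun j => v j.castSucc) (v (Fin.last _))
      (fun j => hv _) (hv _) hsum
    exact fun i => Fin.lastCases h2 h1 i

/-- Composition with a kernel identifies `Hom(A, F (ker φ))` with the vectors killed by `F φ`. -/
theorem exists_comp_kernel_of_comp_eq_zero {F : C ⥤ C} [F.Additive] [PreservesFiniteLimits F]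
    {A B D : C} (φ : B ⟶ D) (v : A ⟶ F.obj B) (hv : v ≫ F.map φ = 0) :
    ∃ w : A ⟶ F.obj (kernel φ), w ≫ F.map (kernel.ι φ) = v := by
  exact ⟨kernel.lift (F.map φ) v hv ≫ (PreservesKernel.iso F φ).inv, by simp⟩

variable (T) in
/-- The multiplicity estimate `dim Hom(A, Eⁿ⁺¹M) ≥ (n + 1) dim Hom(A, Eⁿ K)` for the kernel `K` of
`X - a` on `E M`. -/
theorem succ_mul_finrank_hom_kernel_le [E.Additive] [E.Linear k] [PreservesFiniteLimits E]
    (X : E ⟶ E) {a α β : k} (hβ : α + β * a ≠ 0)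
    (hT : ∀ {M M' : C} (g : M ⟶ M'), E.map (E.map g) ≫ T M' = T M ≫ E.map (E.map g))
    (hrel : ∀ M : C, T M ≫ E.map (X.app M) =
      X.app (E.obj M) ≫ T M - (α • 𝟙 _ + β • X.app (E.obj M)))
    (hnil : ∀ M : C, IsNilpotent (R := End (E.obj M)) (X.app M - a • 𝟙 (E.obj M)))
    (A : C) (n : ℕ) (M : C) [Module.Finite k (A ⟶ (iterF E n).obj (E.obj M))]
    [Module.Finite k (A ⟶ (iterF E n).obj (kernel (X.app M - a • 𝟙 (E.obj M))))] :
    (n + 1) * Module.finrank k (A ⟶ (iterF E n).obj (kernel (X.app M - a • 𝟙 (E.obj M)))) ≤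
      Module.finrank k (A ⟶ (iterF E n).obj (E.obj M)) := by
  set ι := kernel.ι (X.app M - a • 𝟙 (E.obj M))
  let Φ : (Fin (n + 1) → (A ⟶ (iterF E n).obj (kernel (X.app M - a • 𝟙 (E.obj M))))) →ₗ[k]
      (A ⟶ (iterF E n).obj (E.obj M)) :=
    ∑ i, Linear.rightComp k A ((iterF E n).map ι ≫ heckeChain T n i M) ∘ₗ LinearMap.proj i
  have hΦ : Function.Injective Φ := by
    rw [← LinearMap.ker_eq_bot, LinearMap.ker_eq_bot']
    intro v hv
    have h1 : ∑ i, (v i ≫ (iterF E n).map ι) ≫ heckeChain T n i M = 0 := by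
      simpa [Φ, LinearMap.sum_apply] using hv
    have h2 := heckeChain_independent X hβ hT hrel hnil A n M
      (fun i => v i ≫ (iterF E n).map ι) (fun i => by
        rw [Category.assoc, ← Functor.map_comp, kernel.condition, Functor.map_zero, comp_zero]) h1
    funext i
    rw [Pi.zero_apply, ← cancel_mono ((iterF E n).map ι), zero_comp]
    exact h2 i
  have := LinearMap.finrank_le_finrank_of_injective hΦ
  rw [Module.finrank_pi_fintype] at this
  simpa using this

variable (T) in
/-- A nonzero module over the affine Hecke algebra of rank `n` on which all `X_i - a` are nilpotent
has dimension at least `n!`. -/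
theorem factorial_le_finrank_hom [E.Additive] [E.Linear k] [PreservesFiniteLimits E]
    (X : E ⟶ E) {a α β : k} (hβ : α + β * a ≠ 0)
    (hT : ∀ {M M' : C} (g : M ⟶ M'), E.map (E.map g) ≫ T M' = T M ≫ E.map (E.map g))
    (hrel : ∀ M : C, T M ≫ E.map (X.app M) =
      X.app (E.obj M) ≫ T M - (α • 𝟙 _ + β • X.app (E.obj M)))
    (hnil : ∀ M : C, IsNilpotent (R := End (E.obj M)) (X.app M - a • 𝟙 (E.obj M)))
    (A : C) (hfin : ∀ B : C, Module.Finite k (A ⟶ B)) (n : ℕ) :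
    ∀ (M : C) (v : A ⟶ (iterF E n).obj M), v ≠ 0 →
      n.factorial ≤ Module.finrank k (A ⟶ (iterF E n).obj M) := by
  induction n with
  | zero =>
    intro M v hv
    have := hfin ((iterF E 0).obj M)
    have : Nontrivial (A ⟶ (iterF E 0).obj M) := ⟨v, 0, hv⟩
    exact Module.finrank_pos
  | succ n ih =>
    intro M v hv
    change A ⟶ (iterF E n).obj (E.obj M) at v
    change (n + 1).factorial ≤ Module.finrank k (A ⟶ (iterF E n).obj (E.obj M))
    have := hfin ((iterF E n).obj (E.obj M))
    have := hfin ((iterF E n).obj (kernel (X.app M - a • 𝟙 (E.obj M))))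
    set x := X.app M - a • 𝟙 (E.obj M) with hx
    -- the last nonzero vector among `v`, `v x`, `v x²`, … lies in the kernel of `x`
    obtain ⟨u, hu, hu0⟩ : ∃ u : A ⟶ (iterF E n).obj (E.obj M), u ≠ 0 ∧
        u ≫ (iterF E n).map x = 0 := by
      by_contra hcon
      push Not at hcon
      obtain ⟨N, hN⟩ := hnil M
      have key : ∀ N : ℕ, v ≫ (iterF E n).map ((show End (E.obj M) from x) ^ N) ≠ 0 := by
        intro N
        induction N with
        | zero =>
          rw [pow_zero, End.one_def, CategoryTheory.Functor.map_id]
          exact (Category.comp_id v).symm ▸ hv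
        | succ N ihN =>
          have := hcon _ ihN
          rw [pow_succ', End.mul_def, Functor.map_comp, ← Category.assoc]
          exact this
      refine key N ?_
      have : (show End (E.obj M) from x) ^ N = 0 := hN
      rw [this]
      exact (congrArg (v ≫ ·) (Functor.map_zero _ _ _)).trans comp_zero
    obtain ⟨w, hw⟩ := exists_comp_kernel_of_comp_eq_zero x u hu0
    have h1 := ih _ w (by rintro rfl; exact hu (by rw [← hw, zero_comp]))
    have h2 := succ_mul_finrank_hom_kernel_le T X hβ hT hrel hnil A n M
    rw [Nat.factorial_succ]
    exact (Nat.mul_le_mul_left _ h1).trans h2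

end Hecke

section Categorification

variable {k : Type*} [Field k] {C : Type u} [Category.{v} C] [Abelian C] [Linear k C]
  (S : Sl2Categorification k C)

/-- The action of `T` on `E² M`, as a morphism whose source and target are written `E (E M)`. -/
def Sl2Categorification.opT (M : C) : S.E.obj (S.E.obj M) ⟶ S.E.obj (S.E.obj M) := S.T.app M

theorem Sl2Categorification.opT_naturality {M M' : C} (g : M ⟶ M') :
    S.E.map (S.E.map g) ≫ S.opT M' = S.opT M ≫ S.E.map (S.E.map g) :=
  S.T.naturality g

/-- In both the degenerate and the nondegenerate case the Hecke relations yield the commutation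
relation `x₂ T = T x₁ - (α + β x₁)` with `α + β a ≠ 0`: here `(α, β)` is `(1, 0)` if `q = 1`, and
`(0, q - 1)` otherwise. -/
theorem Sl2Categorification.exists_commutation :
    ∃ α β : k, α + β * S.a ≠ 0 ∧ ∀ M : C, S.opT M ≫ S.E.map (S.X.app M) =
      S.X.app (S.E.obj M) ≫ S.opT M - (α • 𝟙 _ + β • S.X.app (S.E.obj M)) := by
  have hsq : ∀ M, S.opT M ≫ S.opT M = (S.q - 1) • S.opT M + S.q • 𝟙 _ := by
    intro M
    have h : (S.opT M - S.q • 𝟙 _) ≫ (S.opT M + 𝟙 _) = 0 := S.hecke M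
    simp only [Preadditive.sub_comp, Preadditive.comp_add, Category.comp_id, Linear.smul_comp,
      Category.id_comp] at h
    rw [← sub_eq_zero, ← h]
    module
  by_cases hq : S.q = 1
  · refine ⟨1, 0, by simp, fun M => ?_⟩
    have h : S.opT M ≫ S.E.map (S.X.app M) ≫ S.opT M = S.X.app (S.E.obj M) - S.opT M :=
      S.affine_of_eq hq M
    have h1 := congrArg (· ≫ S.opT M) h
    simp only [Category.assoc, hsq, hq, Preadditive.sub_comp] at h1
    simpa using h1
  · refine ⟨0, S.q - 1, ?_, fun M => ?_⟩
    · simpa using ⟨sub_ne_zero.2 hq, S.a_ne_zero hq⟩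
    · have h : S.opT M ≫ S.E.map (S.X.app M) ≫ S.opT M = S.q • S.X.app (S.E.obj M) :=
        S.affine_of_ne hq M
      have h1 := congrArg (· ≫ S.opT M) h
      simp only [Category.assoc, hsq, Linear.smul_comp, Preadditive.comp_add,
        Linear.comp_smul, Category.comp_id] at h1
      rw [h] at h1
      refine smul_right_injective _ S.q_ne_zero ?_
      simp only
      rw [smul_sub, ← h1]
      module

end Categorification

/-! ### Classes in the Grothendieck group -/

section Classes

variable {C : Type u} [Category.{v} C] [Abelian C]

theorem RatK0.cls_shortExact {S : ShortComplex C} (hS : S.ShortExact) :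
    RatK0.cls S.X₂ = RatK0.cls S.X₁ + RatK0.cls S.X₃ := by
  have h : K0.cls S.X₂ = K0.cls S.X₁ + K0.cls S.X₃ := by
    rw [← sub_eq_zero, ← sub_sub]
    exact (QuotientAddGroup.eq_zero_iff _).2 (AddSubgroup.subset_closure ⟨S, hS, rfl⟩)
  rw [RatK0.cls, h, TensorProduct.tmul_add]
  rfl

open ZeroObject in
theorem RatK0.cls_iso {M N : C} (i : M ≅ N) : RatK0.cls M = RatK0.cls N := by
  have key : ∀ {M N Z : C} (_ : M ≅ N), IsZero Z →
      RatK0.cls N = RatK0.cls M + RatK0.cls Z := by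
    intro M N Z i hZ
    have hS : (ShortComplex.mk i.hom (0 : N ⟶ Z) comp_zero).ShortExact :=
      { exact := (ShortComplex.exact_iff_epi _ rfl).2 inferInstance
        mono_f := inferInstanceAs (Mono i.hom)
        epi_g := ⟨fun _ _ _ => hZ.eq_of_src _ _⟩ }
    exact RatK0.cls_shortExact hS
  have h0 := key (Iso.refl (0 : C)) (isZero_zero C)
  have h1 := key i (isZero_zero C)
  rw [left_eq_add] at h0
  rw [h1, h0, add_zero]

theorem RatK0.cls_isZero {M : C} (h : IsZero M) : RatK0.cls M = 0 := by
  have hS : (ShortComplex.mk (𝟙 M) (0 : M ⟶ M) comp_zero).ShortExact :=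
    { exact := (ShortComplex.exact_iff_epi _ rfl).2 (inferInstanceAs (Epi (𝟙 M)))
      mono_f := inferInstanceAs (Mono (𝟙 M))
      epi_g := ⟨fun _ _ _ => h.eq_of_src _ _⟩ }
  have := RatK0.cls_shortExact hS
  rwa [left_eq_add] at this

theorem shortExact_of_mono {M N : C} (f : M ⟶ N) [Mono f] :
    (ShortComplex.mk f (cokernel.π f) (cokernel.condition f)).ShortExact :=
  { exact := ShortComplex.exact_cokernel f
    mono_f := inferInstanceAs (Mono f)
    epi_g := inferInstanceAs (Epi (cokernel.π f)) }

theorem shortExact_of_epi {M N : C} (f : M ⟶ N) [Epi f] :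
    (ShortComplex.mk (kernel.ι f) f (kernel.condition f)).ShortExact :=
  { exact := ShortComplex.exact_kernel f
    mono_f := inferInstanceAs (Mono (kernel.ι f))
    epi_g := inferInstanceAs (Epi f) }

theorem RatK0.map_cls (G : C ⥤ C) [G.Additive] [PreservesFiniteLimits G]
    [PreservesFiniteColimits G] (M : C) : RatK0.map G (RatK0.cls M) = RatK0.cls (G.obj M) := by
  rw [RatK0.map, RatK0.cls, LinearMap.baseChange_tmul]
  exact congrArg _ (K0.map_cls G M)

/-- The classes of objects span `ℚ ⊗ K(C)`. -/
theorem RatK0.eq_top_of_cls_mem (W : Submodule ℚ (RatK0 C)) (h : ∀ M : C, RatK0.cls M ∈ W) :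
    W = ⊤ := by
  rw [eq_top_iff]
  rintro x -
  induction x using TensorProduct.induction_on with
  | zero => exact W.zero_mem
  | add x y hx hy => exact W.add_mem hx hy
  | tmul r x =>
    have hr : r ⊗ₜ[ℤ] x = r • ((1 : ℚ) ⊗ₜ[ℤ] x) := by
      rw [TensorProduct.smul_tmul', smul_eq_mul, mul_one]
    rw [hr]
    refine W.smul_mem _ ?_
    clear hr
    obtain ⟨y, rfl⟩ := QuotientAddGroup.mk_surjective x
    induction y using FreeAbelianGroup.induction_on with
    | zero => rw [QuotientAddGroup.mk_zero, TensorProduct.tmul_zero]; exact W.zero_mem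
    | of M => exact h M
    | neg M hM => rw [QuotientAddGroup.mk_neg, TensorProduct.tmul_neg]; exact W.neg_mem hM
    | add x y hx hy => rw [QuotientAddGroup.mk_add, TensorProduct.tmul_add]; exact W.add_mem hx hy

/-- The linear form on `ℚ ⊗ K(C)` given by an additive function on objects. -/
theorem RatK0.exists_form (d : C → ℤ)
    (hd : ∀ S : ShortComplex C, S.ShortExact → d S.X₂ = d S.X₁ + d S.X₃) :
    ∃ φ : RatK0 C →ₗ[ℚ] ℚ, ∀ M, φ (RatK0.cls M) = d M := by
  let ψ : K0 C →+ ℤ := QuotientAddGroup.lift _ (FreeAbelianGroup.lift d) (by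
    rw [K0Relations, AddSubgroup.closure_le]
    rintro _ ⟨S, hS, rfl⟩
    simp [hd S hS])
  have hψ : ∀ M, ψ (K0.cls M) = d M := fun M => by
    simp [ψ, K0.cls]
  refine ⟨(TensorProduct.AlgebraTensorModule.rid ℤ ℚ ℚ).toLinearMap ∘ₗ
    ψ.toIntLinearMap.baseChange ℚ, fun M => ?_⟩
  simp [RatK0.cls, hψ]

end Classes

/-- A family of vectors on which a family of linear forms is unitriangular, with respect to a partial
order on the index set, is linearly independent. -/
theorem linearIndependent_of_unitriangular {Λ V : Type*} [PartialOrder Λ] [AddCommGroup V]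
    [Module ℚ V] (b : Λ → V) (φ : Λ → V →ₗ[ℚ] ℚ) (h1 : ∀ x, φ x (b x) ≠ 0)
    (h2 : ∀ x y, φ x (b y) ≠ 0 → x ≤ y) : LinearIndependent ℚ b := by
  classical
  rw [linearIndependent_iff]
  intro c hc
  by_contra hne
  obtain ⟨x, hx⟩ := Finset.exists_maximal (s := c.support) (Finsupp.support_nonempty_iff.2 hne)
  have := congrArg (φ x) hc
  rw [Finsupp.linearCombination_apply, Finsupp.sum, map_sum, map_zero,
    Finset.sum_eq_single_of_mem x hx.1] at this
  · rw [map_smul, smul_eq_mul] at this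
    exact (Finsupp.mem_support_iff.1 hx.1) ((mul_eq_zero.1 this).resolve_right (h1 x))
  · intro y hy hyx
    rw [map_smul, smul_eq_mul]
    refine mul_eq_zero_of_right _ ?_
    by_contra hxy
    exact hyx (le_antisymm (hx.2 hy (h2 x y hxy)) (h2 x y hxy))

/-! ### Dimensions of spaces of morphisms -/

section HomDimension

theorem finrank_le_of_exact {k V₁ V₂ V₃ : Type*} [Field k] [AddCommGroup V₁] [AddCommGroup V₂]
    [AddCommGroup V₃] [Module k V₁] [Module k V₂] [Module k V₃] (f : V₁ →ₗ[k] V₂)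
    (g : V₂ →ₗ[k] V₃) (h : LinearMap.ker g ≤ LinearMap.range f) [Module.Finite k V₁]
    [Module.Finite k V₃] :
    Module.Finite k V₂ ∧
      Module.finrank k V₂ ≤ Module.finrank k V₁ + Module.finrank k V₃ := by
  have h1 : Module.Finite k (LinearMap.ker g) := Submodule.finiteDimensional_of_le h
  have h2 : Module.Finite k (V₂ ⧸ LinearMap.ker g) :=
    Module.Finite.equiv g.quotKerEquivRange.symm
  have h3 : Module.Finite k V₂ := Module.Finite.of_submodule_quotient (LinearMap.ker g)
  refine ⟨h3, ?_⟩
  have e1 := g.finrank_range_add_finrank_ker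
  have e2 := Submodule.finrank_mono h
  have e3 := LinearMap.finrank_range_le f
  have e4 := Submodule.finrank_le (LinearMap.range g)
  omega

variable {k : Type*} [Field k] {C : Type u} [Category.{v} C] [Abelian C] [Linear k C]

theorem finrank_hom_to_le {S : ShortComplex C} (hS : S.ShortExact) (A : C)
    [Module.Finite k (A ⟶ S.X₁)] [Module.Finite k (A ⟶ S.X₃)] :
    Module.Finite k (A ⟶ S.X₂) ∧ Module.finrank k (A ⟶ S.X₂) ≤
      Module.finrank k (A ⟶ S.X₁) + Module.finrank k (A ⟶ S.X₃) := by
  have := hS.mono_f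
  refine finrank_le_of_exact (Linear.rightComp k A S.f) (Linear.rightComp k A S.g) ?_
  intro v hv
  exact ⟨hS.exact.lift v hv, hS.exact.lift_f v hv⟩

theorem finrank_hom_from_le {S : ShortComplex C} (hS : S.ShortExact) (B : C)
    [Module.Finite k (S.X₁ ⟶ B)] [Module.Finite k (S.X₃ ⟶ B)] :
    Module.Finite k (S.X₂ ⟶ B) ∧ Module.finrank k (S.X₂ ⟶ B) ≤
      Module.finrank k (S.X₁ ⟶ B) + Module.finrank k (S.X₃ ⟶ B) := by
  have := hS.epi_g
  rw [add_comm]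
  refine finrank_le_of_exact (Linear.leftComp k B S.g) (Linear.leftComp k B S.f) ?_
  intro v hv
  exact ⟨hS.exact.desc v hv, hS.exact.g_desc v hv⟩

theorem finrank_hom_projective {S : ShortComplex C} (hS : S.ShortExact) (P : C) [Projective P]
    [Module.Finite k (P ⟶ S.X₂)] : Module.finrank k (P ⟶ S.X₂) =
      Module.finrank k (P ⟶ S.X₁) + Module.finrank k (P ⟶ S.X₃) := by
  have := hS.mono_f
  have := hS.epi_g
  have hinj : Function.Injective (Linear.rightComp k P S.f) := fun a b hab =>
    (cancel_mono S.f).1 hab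
  have hsurj : LinearMap.range (Linear.rightComp k P S.g) = ⊤ :=
    LinearMap.range_eq_top.2 fun v => ⟨Projective.factorThru v S.g, Projective.factorThru_comp v S.g⟩
  have hker : LinearMap.ker (Linear.rightComp k P S.g) =
      LinearMap.range (Linear.rightComp k P S.f) := by
    ext v
    constructor
    · exact fun hv => ⟨hS.exact.lift v hv, hS.exact.lift_f v hv⟩
    · rintro ⟨w, rfl⟩
      simp [S.zero]
  have e1 := (Linear.rightComp k P S.g).finrank_range_add_finrank_ker
  rw [hsurj, finrank_top, hker, LinearMap.finrank_range_of_inj hinj] at e1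
  omega

theorem finrank_hom_le_of_epi {M N : C} (B : C) (f : M ⟶ N) [Epi f]
    [Module.Finite k (M ⟶ B)] : Module.finrank k (N ⟶ B) ≤ Module.finrank k (M ⟶ B) :=
  LinearMap.finrank_le_finrank_of_injective (f := Linear.leftComp k B f)
    fun _ _ hab => (cancel_epi f).1 hab

variable {ι : Type*} {Y : ι → C} {l : List ι} {M : C}

theorem HasFiltration.finrank_hom_from_le (h : HasFiltration Y l M) (B : C) (d : ι → ℕ)
    (hd : ∀ i ∈ l, Module.Finite k (Y i ⟶ B) ∧ Module.finrank k (Y i ⟶ B) ≤ d i) :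
    Module.Finite k (M ⟶ B) ∧ Module.finrank k (M ⟶ B) ≤ (l.map d).sum := by
  induction h with
  | zero M h =>
    have : Subsingleton (M ⟶ B) := ⟨fun _ _ => h.eq_of_src _ _⟩
    exact ⟨inferInstance, by simp [Module.finrank_zero_of_subsingleton]⟩
  | step i l S hS top rest ih =>
    obtain ⟨e⟩ := top
    obtain ⟨h1, h2⟩ := ih fun j hj => hd j (List.mem_cons_of_mem _ hj)
    obtain ⟨h3, h4⟩ := hd i List.mem_cons_self
    have eq : (Y i ⟶ B) ≃ₗ[k] (S.X₃ ⟶ B) := Linear.homCongr k e.symm (Iso.refl B)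
    have : Module.Finite k (S.X₃ ⟶ B) := Module.Finite.equiv eq
    obtain ⟨h5, h6⟩ := HWSl2.finrank_hom_from_le (k := k) hS B
    rw [← eq.finrank_eq] at h6
    exact ⟨h5, by simp only [List.map_cons, List.sum_cons]; omega⟩

theorem HasFiltration.finrank_hom_to_le (h : HasFiltration Y l M) (A : C) (d : ι → ℕ)
    (hd : ∀ i ∈ l, Module.Finite k (A ⟶ Y i) ∧ Module.finrank k (A ⟶ Y i) ≤ d i) :
    Module.Finite k (A ⟶ M) ∧ Module.finrank k (A ⟶ M) ≤ (l.map d).sum := by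
  induction h with
  | zero M h =>
    have : Subsingleton (A ⟶ M) := ⟨fun _ _ => h.eq_of_tgt _ _⟩
    exact ⟨inferInstance, by simp [Module.finrank_zero_of_subsingleton]⟩
  | step i l S hS top rest ih =>
    obtain ⟨e⟩ := top
    obtain ⟨h1, h2⟩ := ih fun j hj => hd j (List.mem_cons_of_mem _ hj)
    obtain ⟨h3, h4⟩ := hd i List.mem_cons_self
    have eq : (A ⟶ Y i) ≃ₗ[k] (A ⟶ S.X₃) := Linear.homCongr k (Iso.refl A) e.symm
    have : Module.Finite k (A ⟶ S.X₃) := Module.Finite.equiv eq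
    obtain ⟨h5, h6⟩ := HWSl2.finrank_hom_to_le (k := k) hS A
    rw [← eq.finrank_eq] at h6
    exact ⟨h5, by simp only [List.map_cons, List.sum_cons]; omega⟩

theorem HasFiltration.cls_eq (h : HasFiltration Y l M) :
    RatK0.cls M = (l.map fun i => RatK0.cls (Y i)).sum := by
  induction h with
  | zero M h => simpa using RatK0.cls_isZero h
  | step i l S hS top rest ih =>
    obtain ⟨e⟩ := top
    rw [RatK0.cls_shortExact hS, ih, RatK0.cls_iso e, List.map_cons, List.sum_cons, add_comm]

end HomDimension

/-! ### Simple objects of a highest weight category -/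

section SimpleQuotient

variable {C : Type u} [Category.{v} C] [Abelian C]

/-- A nonzero Noetherian object has a simple quotient. -/
theorem exists_simple_quotient {M : C} [IsNoetherianObject M] (hM : ¬ IsZero M) :
    ∃ (Q : C) (p : M ⟶ Q), Simple Q ∧ Epi p := by
  have hne : ∃ A : Subobject M, A ≠ ⊤ := by
    refine ⟨⊥, fun h => hM ?_⟩
    have h1 : (Subobject.mk (𝟙 M)) = ⊥ := by rw [← Subobject.top_eq_id, h]
    rw [Subobject.mk_eq_bot_iff_zero] at h1
    exact (IsZero.iff_id_eq_zero M).2 h1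
  obtain ⟨A, hA, hmax⟩ := WellFounded.has_min (r := (· > · : Subobject M → Subobject M → Prop))
    wellFounded_gt {A | A ≠ ⊤} hne
  refine ⟨cokernel A.arrow, cokernel.π A.arrow, ?_, inferInstance⟩
  have hQ : ¬ IsZero (cokernel A.arrow) := by
    intro h
    have : Epi A.arrow := Preadditive.epi_of_cokernel_zero (h.eq_of_tgt _ _)
    have : IsIso A.arrow := isIso_of_mono_of_epi _
    exact hA (Subobject.eq_top_of_isIso_arrow A)
  refine simple_of_cosimple _ fun {Z} f _ => ⟨?_, fun hf => ?_⟩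
  · rintro h rfl
    have : Mono (0 : cokernel A.arrow ⟶ Z) := inferInstance
    exact hQ (IsZero.of_mono_zero _ Z)
  · -- the kernel of `M ⟶ Z` contains `A`, hence equals `A`
    set g := cokernel.π A.arrow ≫ f with hg
    have hle : A ≤ kernelSubobject g :=
      le_kernelSubobject g A (by rw [hg, ← Category.assoc, cokernel.condition, zero_comp])
    have heq : kernelSubobject g = A := by
      by_contra hne'
      have hlt : A < kernelSubobject g := lt_of_le_of_ne hle (Ne.symm hne')
      have htop : kernelSubobject g = ⊤ := by
        by_contra h
        exact hmax _ h hlt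
      have : IsIso (kernelSubobject g).arrow := by rw [htop]; infer_instance
      have hg0 : g = 0 := by
        rw [← cancel_epi (kernelSubobject g).arrow, kernelSubobject_arrow_comp, comp_zero]
      rw [hg, ← comp_zero (f := cokernel.π A.arrow) (Z := Z), cancel_epi] at hg0
      exact hf hg0
    have hker : kernel.ι g ≫ cokernel.π A.arrow = 0 := by
      have h1 : (kernelSubobject g).arrow ≫ cokernel.π A.arrow = 0 := by
        have : ∀ B : Subobject M, B = A → B.arrow ≫ cokernel.π A.arrow = 0 := by
          rintro B rfl
          exact cokernel.condition _
        exact this _ heq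
      rw [← kernelSubobject_arrow', Category.assoc, h1, comp_zero]
    have : Epi g := epi_comp _ _
    have hinv : f ≫ Abelian.epiDesc g (cokernel.π A.arrow) hker = 𝟙 _ := by
      rw [← cancel_epi (cokernel.π A.arrow), ← Category.assoc, ← hg, Abelian.comp_epiDesc,
        Category.comp_id]
    have : IsSplitMono f := ⟨⟨_, hinv⟩⟩
    exact isIso_of_mono_of_epi f

end SimpleQuotient

namespace HighestWeightStructure

variable {k : Type*} [Field k] {C : Type u} [Category.{v} C] [Abelian C] [Linear k C]
  {Λ : Type*} [PartialOrder Λ] (H : HighestWeightStructure k C Λ)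

theorem eq_of_iso {x y : Λ} (i : H.L x ≅ H.L y) : x = y :=
  (H.classification (H.L x) (H.simple_L x)).unique ⟨Iso.refl _⟩ ⟨i⟩

theorem exists_mono_L {M : C} (hM : ¬ IsZero M) : ∃ (x : Λ) (i : H.L x ⟶ M), Mono i := by
  have := H.artinian M
  obtain ⟨Y, hY⟩ := exists_simple_subobject hM
  obtain ⟨x, ⟨e⟩, -⟩ := H.classification _ hY
  exact ⟨x, e.inv ≫ Y.arrow, mono_comp _ _⟩

theorem exists_epi_L {M : C} (hM : ¬ IsZero M) : ∃ (x : Λ) (p : M ⟶ H.L x), Epi p := by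
  have := H.noetherian M
  obtain ⟨Q, p, hQ, hp⟩ := exists_simple_quotient hM
  obtain ⟨x, ⟨e⟩, -⟩ := H.classification _ hQ
  exact ⟨x, p ≫ e.hom, epi_comp _ _⟩

theorem epi_of_ne_zero {M : C} {x : Λ} {p : M ⟶ H.L x} (hp : p ≠ 0) : Epi p :=
  have := H.simple_L x
  epi_of_nonzero_to_simple hp

theorem mono_of_ne_zero {M : C} {x : Λ} {i : H.L x ⟶ M} (hi : i ≠ 0) : Mono i :=
  have := H.simple_L x
  Preadditive.mono_of_kernel_zero (kernel_zero_of_nonzero_from_simple hi)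

theorem not_isZero_L (x : Λ) : ¬ IsZero (H.L x) :=
  have := H.simple_L x
  Simple.not_isZero _

theorem ne_zero_of_mono {M : C} {x : Λ} (i : H.L x ⟶ M) [Mono i] : i ≠ 0 := by
  rintro rfl
  exact H.not_isZero_L x (IsZero.of_mono_zero _ M)

theorem ne_zero_of_epi {M : C} {x : Λ} (p : M ⟶ H.L x) [Epi p] : p ≠ 0 := by
  rintro rfl
  exact H.not_isZero_L x (IsZero.of_epi_zero M _)

theorem hom_L_eq_zero {x y : Λ} (hxy : x ≠ y) (g : H.L x ⟶ H.L y) : g = 0 := by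
  by_contra hg
  have := H.mono_of_ne_zero hg
  have := H.epi_of_ne_zero hg
  have : IsIso g := isIso_of_mono_of_epi g
  exact hxy (H.eq_of_iso (asIso g))

theorem hom_Δ_L_eq_zero {x y : Λ} (hxy : x ≠ y) (g : H.Δ x ⟶ H.L y) : g = 0 := by
  by_contra hg
  obtain ⟨i, -⟩ := H.unique_quotient x (H.L y) (H.simple_L y) g (H.epi_of_ne_zero hg)
  exact hxy (H.eq_of_iso i)

/-- Every object has a finite composition series. -/
theorem exists_filtration (M : C) : ∃ l, HasFiltration H.L l M := by
  have := H.artinian M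
  suffices h : ∀ A : Subobject M, ∀ (N : C) (i : N ⟶ M) [Mono i], Subobject.mk i = A →
      ∃ l, HasFiltration H.L l N from h _ M (𝟙 M) rfl
  intro A
  induction A using WellFoundedLT.induction with
  | _ A ih =>
    intro N i _ hA
    by_cases hN : IsZero N
    · exact ⟨[], .zero N hN⟩
    · obtain ⟨x, p, hp⟩ := H.exists_epi_L hN
      obtain ⟨l, hl⟩ := ih (Subobject.mk (kernel.ι p ≫ i)) (by
        rw [← hA]
        refine lt_of_le_of_ne (Subobject.mk_le_mk_of_comm (kernel.ι p) rfl) fun heq => ?_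
        -- otherwise the kernel of `p` would be all of `N`
        have h1 := Subobject.ofMkLEMk_comp (f := i) (g := kernel.ι p ≫ i) heq.ge
        have h3 : Subobject.ofMkLEMk i (kernel.ι p ≫ i) heq.ge ≫ kernel.ι p = 𝟙 N := by
          rw [← cancel_mono i, Category.assoc, Category.id_comp]
          exact h1
        have h2 := congrArg (· ≫ p) h3
        simp only [Category.assoc, kernel.condition, comp_zero, Category.id_comp] at h2
        exact H.ne_zero_of_epi p h2.symm) _ (kernel.ι p ≫ i) rfl
      exact ⟨x :: l, .step x l (ShortComplex.mk (kernel.ι p) p (kernel.condition p))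
        (shortExact_of_epi p) ⟨Iso.refl _⟩ hl⟩

theorem hom_Δ_eq_zero_of_notMem {y : Λ} {l : List Λ} {M : C} (h : HasFiltration H.L l M)
    (hy : y ∉ l) (g : H.Δ y ⟶ M) : g = 0 := by
  induction h with
  | zero M h => exact h.eq_of_tgt _ _
  | step i l S hS top rest ih =>
    obtain ⟨e⟩ := top
    rw [List.mem_cons, not_or] at hy
    have h1 : g ≫ S.g = 0 := by
      rw [← cancel_mono e.hom, zero_comp]
      exact H.hom_Δ_L_eq_zero hy.1 _
    have := hS.mono_f
    rw [← hS.exact.lift_f g h1, ih hy.2 (hS.exact.lift g h1), zero_comp]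

open scoped Classical in
theorem hom_Δ_Δ_eq_zero {x y : Λ} (hxy : x < y) (g : H.Δ y ⟶ H.Δ x) : g = 0 := by
  obtain ⟨l, hl, hc⟩ := H.reciprocity x
  refine H.hom_Δ_eq_zero_of_notMem hl ?_ g
  rw [← List.count_eq_zero, hc, List.count_eq_zero, List.mem_cons, not_or]
  exact ⟨hxy.ne, fun h => lt_asymm hxy (H.lower_gt y x h)⟩

theorem hom_Δ_eq_zero_of_filtration {x : Λ} {l : List Λ} {M : C} (h : HasFiltration H.Δ l M)
    (hl : ∀ y ∈ l, x < y) (g : M ⟶ H.Δ x) : g = 0 := by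
  induction h with
  | zero M h => exact h.eq_of_src _ _
  | step i l S hS top rest ih =>
    obtain ⟨e⟩ := top
    have h1 : S.f ≫ g = 0 := ih (fun y hy => hl y (List.mem_cons_of_mem _ hy)) _
    have := hS.epi_g
    have h2 : hS.exact.desc g h1 = 0 := by
      rw [← cancel_epi e.inv, comp_zero]
      exact H.hom_Δ_Δ_eq_zero (hl i List.mem_cons_self) _
    rw [← hS.exact.g_desc g h1, h2, comp_zero]

/-- Endomorphisms of `L(x)` are scalars: they lift along `P(x) ⟶ L(x)` to maps `P(x) ⟶ Δ(x)`,
and these factor through `Δ(x)`, whose endomorphisms are scalars. -/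
theorem exists_smul_id (x : Λ) (φ : H.L x ⟶ H.L x) : ∃ r : k, r • 𝟙 _ = φ := by
  have hP := H.filtration_P x
  have hproj := H.projective_P x
  have hepi := H.epi_π x
  generalize hPx : H.P x = P at hP hproj
  cases hP with
  | step _ _ S hS top rest =>
    obtain ⟨e⟩ := top
    have := hS.epi_g
    set ψ := Projective.factorThru (S.g ≫ e.hom ≫ H.π x ≫ φ) (H.π x) with hψ
    have h1 : ψ ≫ H.π x = S.g ≫ e.hom ≫ H.π x ≫ φ := Projective.factorThru_comp _ _
    have h2 : S.f ≫ ψ = 0 := H.hom_Δ_eq_zero_of_filtration rest (H.lower_gt x) _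
    obtain ⟨r, hr⟩ := (H.end_Δ x).2 (e.inv ≫ hS.exact.desc ψ h2)
    refine ⟨r, ?_⟩
    simp only at hr
    rw [← cancel_epi (H.π x), ← cancel_epi e.hom, ← cancel_epi S.g, ← h1]
    conv_rhs => rw [← hS.exact.g_desc ψ h2]
    have h3 : hS.exact.desc ψ h2 = e.hom ≫ (r • 𝟙 (H.Δ x)) := by rw [hr]; simp
    rw [h3]
    simp

theorem finrank_hom_L_self (x : Λ) :
    Module.Finite k (H.L x ⟶ H.L x) ∧ Module.finrank k (H.L x ⟶ H.L x) = 1 := by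
  have hs := H.exists_smul_id x
  have := H.simple_L x
  have h1 := finrank_eq_one (R := k) (𝟙 (H.L x)) (id_nonzero _) hs
  exact ⟨Module.finite_of_finrank_eq_succ h1, h1⟩

open scoped Classical in
theorem finrank_hom_L (x y : Λ) : Module.Finite k (H.L x ⟶ H.L y) ∧
    Module.finrank k (H.L x ⟶ H.L y) = if x = y then 1 else 0 := by
  split_ifs with h
  · subst h
    exact H.finrank_hom_L_self x
  · have : Subsingleton (H.L x ⟶ H.L y) :=
      ⟨fun a b => by rw [H.hom_L_eq_zero h a, H.hom_L_eq_zero h b]⟩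
    exact ⟨inferInstance, Module.finrank_zero_of_subsingleton⟩

open scoped Classical in
theorem finrank_hom_Δ_L (x y : Λ) : Module.Finite k (H.Δ x ⟶ H.L y) ∧
    Module.finrank k (H.Δ x ⟶ H.L y) = if x = y then 1 else 0 := by
  have hsub : x ≠ y → Subsingleton (H.Δ x ⟶ H.L y) := fun h =>
    ⟨fun a b => by rw [H.hom_Δ_L_eq_zero h a, H.hom_Δ_L_eq_zero h b]⟩
  split_ifs with h
  · subst h
    have := H.epi_π x
    have h1 := finrank_eq_one (R := k) (H.π x) (H.ne_zero_of_epi _) (fun g => by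
      by_cases hg : g = 0
      · exact ⟨0, by rw [hg, zero_smul]⟩
      · obtain ⟨i, hi⟩ := H.unique_quotient x (H.L x) (H.simple_L x) g (H.epi_of_ne_zero hg)
        obtain ⟨r, hr⟩ := H.exists_smul_id x i.hom
        exact ⟨r, by rw [← hi, ← hr]; simp⟩)
    exact ⟨Module.finite_of_finrank_eq_succ h1, h1⟩
  · have := hsub h
    exact ⟨inferInstance, Module.finrank_zero_of_subsingleton⟩

open scoped Classical in
theorem _root_.HWSl2.sum_map_ite_eq_count {Λ : Type*} (l : List Λ) (y : Λ) :
    (l.map fun x => if x = y then 1 else 0).sum = l.count y := by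
  induction l with
  | nil => rfl
  | cons a l ih =>
    rw [List.map_cons, List.sum_cons, ih, List.count_cons, add_comm]
    simp

open scoped Classical in
theorem finrank_hom_L_of_Δ_filtration {l : List Λ} {M : C} (h : HasFiltration H.Δ l M) (y : Λ) :
    Module.Finite k (M ⟶ H.L y) ∧ Module.finrank k (M ⟶ H.L y) ≤ l.count y := by
  rw [← sum_map_ite_eq_count]
  exact h.finrank_hom_from_le _ _
    fun x _ => ⟨(H.finrank_hom_Δ_L x y).1, (H.finrank_hom_Δ_L x y).2.le⟩

open scoped Classical in
theorem finrank_hom_L_of_L_filtration {l : List Λ} {M : C} (h : HasFiltration H.L l M) (y : Λ) :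
    (Module.Finite k (M ⟶ H.L y) ∧ Module.finrank k (M ⟶ H.L y) ≤ l.count y) ∧
    (Module.Finite k (H.L y ⟶ M) ∧ Module.finrank k (H.L y ⟶ M) ≤ l.count y) := by
  rw [← sum_map_ite_eq_count]
  refine ⟨h.finrank_hom_from_le _ _
    fun x _ => ⟨(H.finrank_hom_L x y).1, (H.finrank_hom_L x y).2.le⟩, h.finrank_hom_to_le _ _
    fun x _ => ⟨(H.finrank_hom_L y x).1, ?_⟩⟩
  rw [(H.finrank_hom_L y x).2]
  simp only [eq_comm, le_refl]

/-- All spaces of morphisms are finite dimensional. -/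
theorem finite_hom (H : HighestWeightStructure k C Λ) (A B : C) : Module.Finite k (A ⟶ B) := by
  obtain ⟨l, hl⟩ := H.exists_filtration A
  obtain ⟨m, hm⟩ := H.exists_filtration B
  refine (hl.finrank_hom_from_le B (fun x => Module.finrank k (H.L x ⟶ B)) fun x _ => ⟨?_, le_rfl⟩).1
  exact (H.finrank_hom_L_of_L_filtration hm x).2.1

/-- The classes of the simple objects are linearly independent: `dim Hom(P(x), L(y))` is
unitriangular. -/
theorem linearIndependent_cls_L : LinearIndependent ℚ fun x => RatK0.cls (H.L x) := by
  classical
  have hform : ∀ x, ∃ φ : RatK0 C →ₗ[ℚ] ℚ,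
      ∀ M, φ (RatK0.cls M) = (Module.finrank k (H.P x ⟶ M) : ℤ) := fun x =>
    RatK0.exists_form (fun M => (Module.finrank k (H.P x ⟶ M) : ℤ)) fun S hS => by
      have := H.projective_P x
      have := H.finite_hom (H.P x) S.X₂
      exact_mod_cast finrank_hom_projective hS (H.P x)
  choose φ hφ using hform
  refine linearIndependent_of_unitriangular _ φ (fun x => ?_) fun x y hxy => ?_
  · rw [hφ]
    have hP := H.filtration_P x
    have := H.finite_hom (H.P x) (H.L x)
    suffices h : ∃ g : H.P x ⟶ H.L x, g ≠ 0 by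
      obtain ⟨g, hg⟩ := h
      have : Nontrivial (H.P x ⟶ H.L x) := ⟨g, 0, hg⟩
      have := Module.finrank_pos (R := k) (M := H.P x ⟶ H.L x)
      exact_mod_cast this.ne'
    generalize H.P x = P at hP
    cases hP with
    | step _ _ S hS top rest =>
      obtain ⟨e⟩ := top
      have := hS.epi_g
      have := H.epi_π x
      have : Epi (S.g ≫ e.hom ≫ H.π x) := inferInstance
      exact ⟨_, H.ne_zero_of_epi (S.g ≫ e.hom ≫ H.π x)⟩
  · rw [hφ] at hxy
    have h1 := (H.finrank_hom_L_of_Δ_filtration (H.filtration_P x) y).2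
    have h2 : 0 < (x :: H.lower x).count y := by
      refine lt_of_lt_of_le (Nat.pos_of_ne_zero fun h => hxy ?_) h1
      rw [h]; rfl
    rw [List.count_pos_iff, List.mem_cons] at h2
    rcases h2 with rfl | h2
    · exact le_rfl
    · exact (H.lower_gt x y h2).le

/-- The basis of `ℚ ⊗ K(C)` formed by the classes of the simple objects. -/
noncomputable def basis : Module.Basis Λ ℚ (RatK0 C) :=
  Module.Basis.mk H.linearIndependent_cls_L (by
    rw [RatK0.eq_top_of_cls_mem (Submodule.span ℚ (Set.range fun x => RatK0.cls (H.L x)))]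
    intro M
    obtain ⟨l, hl⟩ := H.exists_filtration M
    rw [hl.cls_eq]
    refine list_sum_mem fun v hv => ?_
    obtain ⟨x, -, rfl⟩ := List.mem_map.1 hv
    exact Submodule.subset_span ⟨x, rfl⟩)

theorem basis_apply (x : Λ) : H.basis x = RatK0.cls (H.L x) := by
  simp [basis]

open scoped Classical in
/-- The multiplicity `[M : L(x)]` of a simple object in a composition series. -/
noncomputable def mult (M : C) (x : Λ) : ℕ := (H.exists_filtration M).choose.count x

open scoped Classical in
theorem repr_cls_of_filtration {l : List Λ} {M : C} (h : HasFiltration H.L l M) (x : Λ) :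
    H.basis.repr (RatK0.cls M) x = l.count x := by
  rw [h.cls_eq]
  clear h
  induction l with
  | nil => simp
  | cons a l ih =>
    rw [List.map_cons, List.sum_cons, map_add, Finsupp.add_apply, ih, ← H.basis_apply,
      Module.Basis.repr_self, Finsupp.single_apply, List.count_cons, add_comm]
    simp

theorem repr_cls (M : C) (x : Λ) : H.basis.repr (RatK0.cls M) x = H.mult M x :=
  H.repr_cls_of_filtration (H.exists_filtration M).choose_spec x

theorem mult_of_cls_eq {M N : C} (h : RatK0.cls M = RatK0.cls N) (x : Λ) :
    H.mult M x = H.mult N x := by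
  have := H.repr_cls M x
  rw [h, H.repr_cls] at this
  exact_mod_cast this.symm

theorem mult_shortExact {S : ShortComplex C} (hS : S.ShortExact) (x : Λ) :
    H.mult S.X₂ x = H.mult S.X₁ x + H.mult S.X₃ x := by
  have := H.repr_cls S.X₂ x
  rw [RatK0.cls_shortExact hS, map_add, Finsupp.add_apply, H.repr_cls, H.repr_cls] at this
  exact_mod_cast this.symm

theorem mult_le_of_mono {M N : C} (f : M ⟶ N) [Mono f] (x : Λ) : H.mult M x ≤ H.mult N x := by
  have h := H.mult_shortExact (shortExact_of_mono f) x
  simp only at h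
  omega

theorem mult_le_of_epi {M N : C} (f : M ⟶ N) [Epi f] (x : Λ) : H.mult N x ≤ H.mult M x := by
  have h := H.mult_shortExact (shortExact_of_epi f) x
  simp only at h
  omega

open scoped Classical in
theorem mult_L (x y : Λ) : H.mult (H.L x) y = if x = y then 1 else 0 := by
  have := H.repr_cls (H.L x) y
  rw [← H.basis_apply, Module.Basis.repr_self, Finsupp.single_apply] at this
  split_ifs at this ⊢ <;> exact_mod_cast this.symm

theorem mult_self (x : Λ) : H.mult (H.L x) x = 1 := by
  rw [mult_L, if_pos rfl]

theorem finrank_hom_le_mult (M : C) (x : Λ) : Module.finrank k (M ⟶ H.L x) ≤ H.mult M x :=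
  (H.finrank_hom_L_of_L_filtration (H.exists_filtration M).choose_spec x).1.2

theorem finrank_hom_le_mult' (M : C) (x : Λ) : Module.finrank k (H.L x ⟶ M) ≤ H.mult M x :=
  (H.finrank_hom_L_of_L_filtration (H.exists_filtration M).choose_spec x).2.2

theorem cls_eq_zero_iff (H : HighestWeightStructure k C Λ) {M : C} : RatK0.cls M = 0 ↔ IsZero M := by
  refine ⟨fun h => ?_, RatK0.cls_isZero⟩
  by_contra hM
  obtain ⟨x, i, hi⟩ := H.exists_mono_L hM
  have h1 := H.mult_le_of_mono i x
  have h2 := H.repr_cls M x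
  rw [h, map_zero, Finsupp.zero_apply] at h2
  rw [H.mult_self] at h1
  have : H.mult M x = 0 := by exact_mod_cast h2.symm
  omega

open scoped Classical in
/-- The multiplicities in standard objects are unitriangular, by reciprocity. -/
theorem mult_Δ (x y : Λ) : H.mult (H.Δ x) y = (y :: H.lower y).count x := by
  obtain ⟨l, hl, hc⟩ := H.reciprocity x
  have := H.repr_cls_of_filtration hl y
  rw [H.repr_cls, hc] at this
  exact_mod_cast this

theorem mult_Δ_self (x : Λ) : H.mult (H.Δ x) x = 1 := by
  classical
  rw [mult_Δ, List.count_cons_self, List.count_eq_zero.2 fun h => lt_irrefl _ (H.lower_gt x x h)]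

theorem le_of_mult_Δ_ne_zero {x y : Λ} (h : H.mult (H.Δ x) y ≠ 0) : y ≤ x := by
  classical
  rw [mult_Δ] at h
  rcases List.mem_cons.1 (List.count_pos_iff.1 (Nat.pos_of_ne_zero h)) with rfl | h
  · exact le_rfl
  · exact (H.lower_gt y x h).le

theorem linearIndependent_cls_Δ : LinearIndependent ℚ fun x => RatK0.cls (H.Δ x) := by
  refine linearIndependent_of_unitriangular _ (fun x => H.basis.coord x) (fun x => ?_)
    fun x y hxy => ?_
  · rw [Module.Basis.coord_apply, H.repr_cls, H.mult_Δ_self]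
    simp
  · rw [Module.Basis.coord_apply, H.repr_cls] at hxy
    exact H.le_of_mult_Δ_ne_zero (by exact_mod_cast hxy)

/-- If the simple subobjects `L(x)` of `M` account for the whole multiplicity of `L(x)` in `M`, then
the same holds for every subobject of `M`. -/
theorem mult_eq_finrank_of_mono {M N : C} (f : M ⟶ N) [Mono f] (x : Λ)
    (h : H.mult N x = Module.finrank k (H.L x ⟶ N)) :
    H.mult M x = Module.finrank k (H.L x ⟶ M) := by
  refine le_antisymm ?_ (H.finrank_hom_le_mult' M x)
  have hS := shortExact_of_mono f
  have := H.finite_hom (H.L x) M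
  have := H.finite_hom (H.L x) (cokernel f)
  have h1 := (HWSl2.finrank_hom_to_le (k := k) hS (H.L x)).2
  have h2 := H.mult_shortExact hS x
  have h3 := H.finrank_hom_le_mult' (cokernel f) x
  simp only at h1 h2
  omega

end HighestWeightStructure

/-! ### Weight vectors in representations of `sl₂` -/

section Sl2Action

/-- The operators `e`, `f`, `h` satisfy the relations of `sl₂`. -/
structure Sl2Action {V : Type*} [AddCommGroup V] [Module ℚ V] (e f h : Module.End ℚ V) : Prop where
  ef : ∀ v, e (f v) = f (e v) + h v
  he : ∀ v, h (e v) = e (h v) + (2 : ℚ) • e v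
  hf : ∀ v, h (f v) = f (h v) - (2 : ℚ) • f v

namespace Sl2Action

variable {V : Type*} [AddCommGroup V] [Module ℚ V] {e f h : Module.End ℚ V}

theorem symm (A : Sl2Action e f h) : Sl2Action f e (-h) where
  ef v := by rw [A.ef, LinearMap.neg_apply]; abel
  he v := by rw [LinearMap.neg_apply, LinearMap.neg_apply, A.hf, map_neg]; abel
  hf v := by rw [LinearMap.neg_apply, LinearMap.neg_apply, A.he, map_neg]; abel

theorem h_pow (A : Sl2Action e f h) {v : V} {w : ℚ} (hv : h v = w • v) (n : ℕ) :
    h ((e ^ n) v) = (w + 2 * n) • (e ^ n) v := by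
  induction n with
  | zero => simp [hv]
  | succ n ih =>
    rw [pow_succ', Module.End.mul_apply, A.he, ih, map_smul, ← add_smul]
    push_cast
    congr 1
    ring

theorem pow_comm (A : Sl2Action e f h) {v : V} {w : ℚ} (hv : h v = w • v) (n : ℕ) :
    (e ^ (n + 1)) (f v) = f ((e ^ (n + 1)) v) + ((n + 1) * (w + n)) • (e ^ n) v := by
  induction n with
  | zero => simp [A.ef, hv]
  | succ n ih =>
    rw [pow_succ' e (n + 1), Module.End.mul_apply, ih, map_add, A.ef, A.h_pow hv, map_smul,
      Module.End.mul_apply, add_assoc, ← Module.End.mul_apply e (e ^ n), ← pow_succ', ← add_smul]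
    push_cast
    congr 2
    ring

/-- `fⁿ eⁿ` acts by a scalar on a weight vector killed by `f`. -/
theorem pow_pow (A : Sl2Action e f h) {u : V} {w : ℚ} (hu : h u = w • u) (hf : f u = 0) (n : ℕ) :
    (f ^ n) ((e ^ n) u) = (∏ i ∈ Finset.range n, ((i + 1) * (-w - i) : ℚ)) • u := by
  induction n with
  | zero => simp
  | succ n ih =>
    have h1 := A.pow_comm hu n
    rw [hf, map_zero] at h1
    have h2 : f ((e ^ (n + 1)) u) = ((n + 1) * (-w - n) : ℚ) • (e ^ n) u := by
      have := eq_neg_of_add_eq_zero_left h1.symm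
      rw [this, ← neg_smul]
      congr 1
      ring
    rw [pow_succ f, Module.End.mul_apply, h2, map_smul, ih, smul_smul, Finset.prod_range_succ]
    congr 1
    ring

theorem prod_eq_factorial_sq (d : ℕ) :
    ∏ i ∈ Finset.range d, ((i + 1) * (d - i) : ℚ) = (d.factorial : ℚ) * d.factorial := by
  rw [Finset.prod_mul_distrib]
  congr 1
  · exact_mod_cast Finset.prod_range_add_one_eq_factorial d
  · rw [← Finset.prod_range_reflect, ← Finset.prod_range_add_one_eq_factorial]
    push_cast
    refine Finset.prod_congr rfl fun i hi => ?_
    rw [Finset.mem_range] at hi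
    rw [Nat.sub_sub, Nat.cast_sub (by omega)]
    push_cast
    ring

/-- A vector of weight `w` killed by `eᴺ` is killed by `fᵐ` for `m ≥ w + N`. -/
theorem pow_eq_zero (A : Sl2Action e f h) (hnil : ∀ v, ∃ M, (f ^ M) v = 0) (N : ℕ) :
    ∀ {v : V} {w : ℚ}, h v = w • v → (e ^ N) v = 0 → ∀ m : ℕ, w + N ≤ m → (f ^ m) v = 0 := by
  induction N with
  | zero =>
    intro v w _ hN m _
    rw [pow_zero, Module.End.one_apply] at hN
    rw [hN, map_zero]
  | succ N ih =>
    intro v w hv hN m hm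
    push_cast at hm
    have hev : h (e v) = (w + 2) • e v := by rw [A.he, hv, map_smul, ← add_smul]
    have step : ∀ m : ℕ, w + (N + 1) ≤ m → (f ^ (m + 1)) v = 0 → (f ^ m) v = 0 := by
      intro m hm h1
      have h2 := A.symm.pow_comm (w := -w) (v := v) (by rw [LinearMap.neg_apply, hv, neg_smul]) m
      have h3 : (f ^ (m + 1)) (e v) = 0 :=
        ih hev (by rw [← Module.End.mul_apply, ← pow_succ]; exact hN) _ (by push_cast; linarith)
      rw [h3, h1, map_zero, zero_add] at h2
      refine (smul_eq_zero.1 h2.symm).resolve_left (mul_ne_zero (by positivity) ?_)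
      have : (0 : ℚ) ≤ N := by positivity
      intro h0
      linarith
    obtain ⟨M, hM⟩ := hnil v
    have hbig : (f ^ (m + M)) v = 0 := by
      rw [pow_add, Module.End.mul_apply, hM, map_zero]
    have down : ∀ j, (f ^ (m + j)) v = 0 → (f ^ m) v = 0 := by
      intro j
      induction j with
      | zero => exact fun h => h
      | succ j ihj =>
        intro h
        refine ihj (step _ ?_ h)
        push_cast
        have : (0 : ℚ) ≤ j := by positivity
        linarith
    exact down M hbig

end Sl2Action

end Sl2Action

/-! ### Powers of exact functors: classes and adjunctions -/

section PowerClasses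

variable {C : Type u} [Category.{v} C] [Abelian C]

theorem pow_map_cls (G : C ⥤ C) [G.Additive] [PreservesFiniteLimits G]
    [PreservesFiniteColimits G] (n : ℕ) : ∀ M : C,
    (RatK0.map G ^ n) (RatK0.cls M) = RatK0.cls ((iterF G n).obj M) := by
  induction n with
  | zero => exact fun _ => rfl
  | succ n ih =>
    intro M
    rw [pow_succ, Module.End.mul_apply, RatK0.map_cls, ih]
    rfl

variable {k : Type*} [Field k] [Linear k C]

theorem nonempty_homLinearEquiv {F G : C ⥤ C} (adj : F ⊣ G) [F.Additive] [G.Additive] [G.Linear k]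
    (X Y : C) : Nonempty ((F.obj X ⟶ Y) ≃ₗ[k] (X ⟶ G.obj Y)) :=
  ⟨{ adj.homAddEquiv X Y with
      map_smul' := fun r g => by
        simp [Adjunction.homEquiv_unit, Functor.map_smul] }⟩

theorem nonempty_iterF_homLinearEquiv {F G : C ⥤ C} (adj : F ⊣ G) [F.Additive] [G.Additive]
    [G.Linear k] (n : ℕ) : ∀ X Y : C,
    Nonempty (((iterF F n).obj X ⟶ Y) ≃ₗ[k] (X ⟶ (iterF G n).obj Y)) := by
  induction n with
  | zero => exact fun X Y => ⟨LinearEquiv.refl k _⟩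
  | succ n ih =>
    intro X Y
    obtain ⟨e1⟩ := ih (F.obj X) Y
    obtain ⟨e2⟩ := nonempty_homLinearEquiv (k := k) adj X ((iterF G n).obj Y)
    rw [iterF_succ_obj G n Y]
    exact ⟨e1.trans e2⟩

theorem finrank_iterF_adj {F G : C ⥤ C} (adj : F ⊣ G) [F.Additive] [G.Additive]
    [G.Linear k] (n : ℕ) (X Y : C) : Module.finrank k ((iterF F n).obj X ⟶ Y) =
      Module.finrank k (X ⟶ (iterF G n).obj Y) :=
  (nonempty_iterF_homLinearEquiv adj n X Y).some.finrank_eq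

end PowerClasses

/-! ### The action on classes of standard objects -/

section Flips

variable {n : ℕ}

/-- The number of ways to get from `t` to `u` by `m` successive changes of a sign `s` to `s'`. -/
def flipCount (s s' : Sgn) : ℕ → (Fin n → Sgn) → (Fin n → Sgn) → ℕ
  | 0, t, u => if t = u then 1 else 0
  | m + 1, t, u => ∑ j with t j = s, flipCount s s' m (Function.update t j s') u

theorem flipCount_ne_zero {s s' : Sgn} (hs : s ≠ s') (m : ℕ) : ∀ t u : Fin n → Sgn,
    flipCount s s' m t u ≠ 0 → (∀ i, t i = s' → u i = s') ∧
      (Finset.univ.filter fun i => t i ≠ u i).card = m := by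
  induction m with
  | zero =>
    intro t u h
    simp only [flipCount, ne_eq, ite_eq_right_iff, one_ne_zero, imp_false, not_not] at h
    subst h
    simp
  | succ m ih =>
    intro t u h
    obtain ⟨j, hj, hj'⟩ := Finset.exists_ne_zero_of_sum_ne_zero h
    rw [Finset.mem_filter] at hj
    obtain ⟨h1, h2⟩ := ih _ _ hj'
    have huj : u j = s' := h1 j (by simp)
    refine ⟨fun i hi => ?_, ?_⟩
    · by_cases hij : i = j
      · rw [hij, huj]
      · exact h1 i (by rw [Function.update_of_ne hij, hi])
    · have : (Finset.univ.filter fun i => t i ≠ u i) =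
          insert j (Finset.univ.filter fun i => Function.update t j s' i ≠ u i) := by
        ext i
        by_cases hij : i = j
        · subst hij; simp [hj.2, huj, hs]
        · simp [hij]
      rw [this, Finset.card_insert_of_notMem (by simp [huj]), h2]

theorem flipCount_le_factorial {s s' : Sgn} (hs : s ≠ s') (m : ℕ) : ∀ t u : Fin n → Sgn,
    flipCount s s' m t u ≤ m.factorial := by
  induction m with
  | zero =>
    intro t u
    simp only [flipCount, Nat.factorial]
    split_ifs <;> omega
  | succ m ih =>
    intro t u
    by_cases h0 : flipCount s s' (m + 1) t u = 0
    · omega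
    · obtain ⟨-, h2⟩ := flipCount_ne_zero hs _ _ _ h0
      have h1 : flipCount s s' (m + 1) t u ≤ ∑ j with t j ≠ u j, m.factorial := by
        refine (Finset.sum_le_sum_of_ne_zero fun j hj hne => ?_).trans
          (Finset.sum_le_sum fun j _ => ih (Function.update t j s') u)
        rw [Finset.mem_filter] at hj ⊢
        have h3 := (flipCount_ne_zero hs _ _ _ hne).1 j (by simp)
        exact ⟨Finset.mem_univ _, by rw [hj.2, h3]; exact hs⟩
      rwa [Finset.sum_const, h2, smul_eq_mul, ← Nat.factorial_succ] at h1

theorem flipCount_one_ne_zero {s s' : Sgn} {t u : Fin n → Sgn} (h : flipCount s s' 1 t u ≠ 0) :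
    ∃ j, t j = s ∧ u = Function.update t j s' := by
  obtain ⟨j, hj, hj'⟩ := Finset.exists_ne_zero_of_sum_ne_zero h
  rw [Finset.mem_filter] at hj
  simp only [flipCount, ne_eq, ite_eq_right_iff, one_ne_zero, imp_false, not_not] at hj'
  exact ⟨j, hj.2, hj'.symm⟩

variable {V : Type*} [AddCommGroup V] [Module ℚ V]

theorem pow_apply_eq_sum_flipCount (g : Module.End ℚ V) {s s' : Sgn} (D : (Fin n → Sgn) → V)
    (hg : ∀ t, g (D t) = ∑ j with t j = s, D (Function.update t j s')) (m : ℕ) :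
    ∀ t, (g ^ m) (D t) = ∑ u, flipCount s s' m t u • D u := by
  induction m with
  | zero => intro t; simp [flipCount]
  | succ m ih =>
    intro t
    rw [pow_succ, Module.End.mul_apply, hg, map_sum]
    simp only [flipCount, Finset.sum_smul]
    rw [Finset.sum_comm]
    exact Finset.sum_congr rfl fun j _ => ih _

theorem pow_apply_eq_zero_of_flip (g : Module.End ℚ V) {s s' : Sgn} (hs : s ≠ s')
    (D : (Fin n → Sgn) → V)
    (hg : ∀ t, g (D t) = ∑ j with t j = s, D (Function.update t j s')) (t : Fin n → Sgn) :
    (g ^ (n + 1)) (D t) = 0 := by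
  rw [pow_apply_eq_sum_flipCount g D hg]
  refine Finset.sum_eq_zero fun u _ => ?_
  by_contra h
  have h1 : flipCount s s' (n + 1) t u ≠ 0 := by
    intro h0
    rw [h0, zero_smul] at h
    exact h rfl
  have h2 := (flipCount_ne_zero hs _ _ _ h1).2
  have h3 := Finset.card_le_univ (Finset.univ.filter fun i => t i ≠ u i)
  rw [Fintype.card_fin] at h3
  omega

/-- The commutator of the two flip operators is diagonal. -/
theorem flip_commutator (e f : Module.End ℚ V) (D : (Fin n → Sgn) → V)
    (he : ∀ t, e (D t) = ∑ j with t j = Sgn.plus, D (Function.update t j Sgn.minus))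
    (hf : ∀ t, f (D t) = ∑ j with t j = Sgn.minus, D (Function.update t j Sgn.plus))
    (t : Fin n → Sgn) : e (f (D t)) - f (e (D t)) = ((signCrystal n).wt t : ℚ) • D t := by
  have key : ∀ (s s' : Sgn) (l : Fin n), s ≠ s' → t l = s' →
      ∑ j with Function.update t l s j = s, D (Function.update (Function.update t l s) j s') =
        D t + ∑ j with t j = s, D (Function.update (Function.update t l s) j s') := by
    intro s s' l hs hl
    have : (Finset.univ.filter fun j => Function.update t l s j = s) =
        insert l (Finset.univ.filter fun j => t j = s) := by
      ext j
      by_cases hj : j = l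
      · subst hj; simp
      · simp [hj]
    rw [this, Finset.sum_insert (by simp [hl, hs.symm])]
    congr 2
    simp [← hl]
  have h1 : e (f (D t)) = ∑ l with t l = Sgn.minus, (D t + ∑ j with t j = Sgn.plus,
      D (Function.update (Function.update t l Sgn.plus) j Sgn.minus)) := by
    rw [hf, map_sum]
    refine Finset.sum_congr rfl fun l hl => ?_
    rw [he, key _ _ l (by decide) (Finset.mem_filter.1 hl).2]
  have h2 : f (e (D t)) = ∑ l with t l = Sgn.plus, (D t + ∑ j with t j = Sgn.minus,
      D (Function.update (Function.update t l Sgn.minus) j Sgn.plus)) := by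
    rw [he, map_sum]
    refine Finset.sum_congr rfl fun l hl => ?_
    rw [hf, key _ _ l (by decide) (Finset.mem_filter.1 hl).2]
  have h3 : ∑ l with t l = Sgn.minus, ∑ j with t j = Sgn.plus,
      D (Function.update (Function.update t l Sgn.plus) j Sgn.minus) =
      ∑ l with t l = Sgn.plus, ∑ j with t j = Sgn.minus,
      D (Function.update (Function.update t l Sgn.minus) j Sgn.plus) := by
    rw [Finset.sum_comm]
    refine Finset.sum_congr rfl fun j hj => Finset.sum_congr rfl fun l hl => ?_
    rw [Finset.mem_filter] at hj hl
    rw [Function.update_comm]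
    rintro rfl
    exact absurd (hj.2.symm.trans hl.2) (by decide)
  rw [h1, h2, Finset.sum_add_distrib, Finset.sum_add_distrib, h3, add_sub_add_right_eq_sub,
    Finset.sum_const, Finset.sum_const, signCrystal_wt, ← Nat.cast_smul_eq_nsmul ℚ,
    ← Nat.cast_smul_eq_nsmul ℚ, ← sub_smul]
  congr 1
  simp only [path, height, Fin.is_lt, Finset.filter_true, Finset.card_filter]
  push_cast
  rw [← Finset.sum_sub_distrib, ← Finset.sum_neg_distrib]
  refine Finset.sum_congr rfl fun i _ => ?_
  cases t i <;> simp [signStep]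

end Flips

section MaxPower

variable {C : Type u} [Category.{v} C] [Abelian C]

theorem isZero_iterF_of_le {G : C ⥤ C} [G.Additive] {M : C} {m n : ℕ} (hmn : m ≤ n)
    (h : IsZero ((iterF G m).obj M)) : IsZero ((iterF G n).obj M) := by
  obtain ⟨j, rfl⟩ := Nat.exists_eq_add_of_le' hmn
  rw [iterF_add_obj]
  exact Functor.map_isZero _ h

/-- `maxPower G M` is the last `i` with `Gⁱ M ≠ 0`, provided that some power of `G` kills `M`. -/
theorem maxPower_eq_iff {G : C ⥤ C} [G.Additive] {M : C} (hM : ¬ IsZero M)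
    (hbd : ∃ N, IsZero ((iterF G N).obj M)) (n : ℕ) : maxPower G M = n ↔
      ¬ IsZero ((iterF G n).obj M) ∧ IsZero ((iterF G (n + 1)).obj M) := by
  obtain ⟨N, hN⟩ := hbd
  have hset : {i : ℕ | ¬ IsZero (G.obj^[i] M)} = {i | ¬ IsZero ((iterF G i).obj M)} := by
    ext i
    simp only [Set.mem_ofPred_eq, iterF_obj]
  have hb : BddAbove {i : ℕ | ¬ IsZero ((iterF G i).obj M)} := by
    refine ⟨N, fun i hi => ?_⟩
    by_contra hlt
    exact hi (isZero_iterF_of_le (not_le.1 hlt).le hN)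
  have hmem : maxPower G M ∈ {i : ℕ | ¬ IsZero ((iterF G i).obj M)} := by
    rw [maxPower, hset]
    exact Nat.sSup_mem ⟨0, hM⟩ hb
  have hlt : ∀ i, maxPower G M < i → IsZero ((iterF G i).obj M) := by
    intro i hi
    by_contra h
    rw [maxPower, hset] at hi
    exact absurd (le_csSup hb h) (not_le.2 hi)
  constructor
  · rintro rfl
    exact ⟨hmem, hlt _ (Nat.lt_succ_self _)⟩
  · rintro ⟨h1, h2⟩
    refine le_antisymm ?_ ?_
    · by_contra hc
      exact hmem (isZero_iterF_of_le (not_le.1 hc) h2)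
    · by_contra hc
      exact h1 (hlt _ (not_le.1 hc))

end MaxPower

/-! ### Highest weight categorifications: labels, weights, and spaces of morphisms -/

section Labels

variable {k : Type*} [Field k] {C : Type u} [Category.{v} C] [Abelian C] [Linear k C]
  {Λ : Type*} [PartialOrder Λ] {𝔄 : Type*}
  {H : HighestWeightStructure k C Λ} {S : Sl2Categorification k C}
  (W : HighestWeightCategorification H S 𝔄)

namespace HighestWeightCategorification

/-- The element `σ_a(t)` of `Λ`. -/
def label (a : 𝔄) (t : Fin (W.n a) → Sgn) : Λ := (W.σ a t : Λ)

theorem exists_eq_label (x : Λ) : ∃ a t, x = W.label a t := by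
  obtain ⟨a, ha, -⟩ := W.partition x
  exact ⟨a, (W.σ a).symm ⟨x, ha⟩, by simp [label]⟩

theorem label_mem (a : 𝔄) (t : Fin (W.n a) → Sgn) : W.label a t ∈ W.block a := (W.σ a t).2

theorem block_eq_of_label_eq {a b : 𝔄} {t : Fin (W.n a) → Sgn} {u : Fin (W.n b) → Sgn}
    (h : W.label a t = W.label b u) : a = b :=
  (W.partition (W.label a t)).unique (W.label_mem a t) (h ▸ W.label_mem b u)

theorem label_injective (a : 𝔄) : Function.Injective (W.label a) :=
  fun _ _ h => (W.σ a).injective (Subtype.ext h)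

/-- The functor `G` changes, on the level of classes of standard objects, one sign `s` to `s'` in all
possible ways, and it preserves objects with a standard filtration. -/
structure IsFlipFunctor (G : C ⥤ C) [G.Additive] [PreservesFiniteLimits G]
    [PreservesFiniteColimits G] (s s' : Sgn) : Prop where
  ne : s ≠ s'
  filtered : ∀ M, IsFilteredBy H.Δ M → IsFilteredBy H.Δ (G.obj M)
  map_cls : ∀ a t, RatK0.map G (RatK0.cls (H.Δ (W.label a t))) =
    ∑ j with t j = s, RatK0.cls (H.Δ (W.label a (Function.update t j s')))

theorem isFlipFunctor_E : W.IsFlipFunctor S.E Sgn.plus Sgn.minus where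
  ne := by decide
  filtered M hM := (W.hwc0 M hM).1
  map_cls a t := by
    have h := congrArg (fun x : K0 C => (1 : ℚ) ⊗ₜ[ℤ] x) (W.hwc2_e a t)
    simp only [TensorProduct.tmul_sum] at h
    exact h

theorem isFlipFunctor_F : W.IsFlipFunctor S.F Sgn.minus Sgn.plus where
  ne := by decide
  filtered M hM := (W.hwc0 M hM).2
  map_cls a t := by
    have h := congrArg (fun x : K0 C => (1 : ℚ) ⊗ₜ[ℤ] x) (W.hwc2_f a t)
    simp only [TensorProduct.tmul_sum] at h
    exact h

namespace IsFlipFunctor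

variable {W} {G : C ⥤ C} [G.Additive] [PreservesFiniteLimits G]
    [PreservesFiniteColimits G] {s s' : Sgn}

theorem filtered_iterF (hG : W.IsFlipFunctor G s s') (m : ℕ) : ∀ M, IsFilteredBy H.Δ M →
    IsFilteredBy H.Δ ((iterF G m).obj M) := by
  induction m with
  | zero => exact fun _ h => h
  | succ m ih => exact fun M h => ih _ (hG.filtered M h)

open scoped Classical ZeroObject in
/-- The filtration of `Gᵐ Δ(σ_a(t))` contains `Δ(σ_a(u))` once for each way to get from `t` to `u`
by `m` sign changes, and nothing else. -/
theorem exists_filtration (hG : W.IsFlipFunctor G s s') (m : ℕ) (a : 𝔄)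
    (t : Fin (W.n a) → Sgn) : ∃ l, HasFiltration H.Δ l ((iterF G m).obj (H.Δ (W.label a t))) ∧
      ∀ y, l.count y ≠ 0 → ∃ u, y = W.label a u ∧ l.count y = flipCount s s' m t u := by
  have hΔ : IsFilteredBy H.Δ (H.Δ (W.label a t)) := by
    have hS : (ShortComplex.mk (0 : (0 : C) ⟶ H.Δ (W.label a t)) (𝟙 (H.Δ (W.label a t)))
        zero_comp).ShortExact :=
      { exact := (ShortComplex.exact_iff_mono _ rfl).2
          (inferInstanceAs (Mono (𝟙 (H.Δ (W.label a t)))))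
        mono_f := ⟨fun _ _ _ => (isZero_zero C).eq_of_tgt _ _⟩
        epi_g := inferInstanceAs (Epi (𝟙 (H.Δ (W.label a t)))) }
    exact ⟨[W.label a t], HasFiltration.step _ _ _ hS ⟨Iso.refl _⟩ (.zero _ (isZero_zero C))⟩
  obtain ⟨l, hl⟩ := hG.filtered_iterF m _ hΔ
  refine ⟨l, hl, fun y hy => ?_⟩
  have h1 := hl.cls_eq
  rw [← pow_map_cls, pow_apply_eq_sum_flipCount _ (fun t => RatK0.cls (H.Δ (W.label a t)))
    (hG.map_cls a)] at h1
  have h2 : ∀ l : List Λ, ∃ P : Λ →₀ ℚ, (∀ y, P y = l.count y) ∧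
      Finsupp.linearCombination ℚ (fun x => RatK0.cls (H.Δ x)) P =
        (l.map fun x => RatK0.cls (H.Δ x)).sum := by
    intro l
    induction l with
    | nil => exact ⟨0, by simp, by simp⟩
    | cons z l ih =>
      obtain ⟨P, hP1, hP2⟩ := ih
      refine ⟨Finsupp.single z 1 + P, fun y => ?_, by simp [hP2]⟩
      rw [Finsupp.add_apply, hP1, Finsupp.single_apply, List.count_cons, add_comm]
      simp
  obtain ⟨P, hP1, hP2⟩ := h2 l
  have h3 : P = ∑ u, Finsupp.single (W.label a u) (flipCount s s' m t u : ℚ) := by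
    refine H.linearIndependent_cls_Δ ?_
    rw [hP2, ← h1, map_sum]
    refine Finset.sum_congr rfl fun u _ => ?_
    rw [Finsupp.linearCombination_single, Nat.cast_smul_eq_nsmul]
  have h4 := hP1 y
  rw [h3, Finsupp.finsetSum_apply] at h4
  have hex : ∃ u, y = W.label a u := by
    by_contra hcon
    push Not at hcon
    rw [Finset.sum_eq_zero fun u _ => Finsupp.single_eq_of_ne (hcon u)] at h4
    exact hy (by exact_mod_cast h4.symm)
  obtain ⟨u, rfl⟩ := hex
  refine ⟨u, rfl, ?_⟩
  rw [Finset.sum_eq_single u (fun v _ hv => Finsupp.single_eq_of_ne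
    fun h => hv (W.label_injective a h).symm) (by simp), Finsupp.single_eq_same] at h4
  exact_mod_cast h4.symm

theorem finrank_hom_le (hG : W.IsFlipFunctor G s s') (m : ℕ) (x y : Λ) :
    Module.finrank k ((iterF G m).obj (H.L x) ⟶ H.L y) ≤ m.factorial := by
  classical
  obtain ⟨a, t, rfl⟩ := W.exists_eq_label x
  obtain ⟨l, hl, hc⟩ := hG.exists_filtration m a t
  have := H.epi_π (W.label a t)
  have := H.finite_hom ((iterF G m).obj (H.Δ (W.label a t))) (H.L y)
  refine (finrank_hom_le_of_epi (H.L y) ((iterF G m).map (H.π (W.label a t)))).trans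
    ((H.finrank_hom_L_of_Δ_filtration hl y).2.trans ?_)
  by_cases hy : l.count y = 0
  · rw [hy]; exact Nat.zero_le _
  · obtain ⟨u, -, h⟩ := hc y hy
    rw [h]
    exact flipCount_le_factorial hG.ne m t u

/-- A simple quotient of `G L(σ_a(t))` is obtained by one sign change. -/
theorem exists_flip (hG : W.IsFlipFunctor G s s') {a : 𝔄} {t : Fin (W.n a) → Sgn} {y : Λ}
    {g : G.obj (H.L (W.label a t)) ⟶ H.L y} (hg : g ≠ 0) :
    ∃ j, t j = s ∧ y = W.label a (Function.update t j s') := by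
  classical
  obtain ⟨l, hl, hc⟩ := hG.exists_filtration 1 a t
  have := H.epi_π (W.label a t)
  obtain ⟨h1, h2⟩ := H.finrank_hom_L_of_Δ_filtration hl y
  have hg' : G.map (H.π (W.label a t)) ≫ g ≠ 0 := by
    rw [← comp_zero (f := G.map (H.π (W.label a t))), ne_eq, cancel_epi]
    exact hg
  have : Nontrivial ((iterF G 1).obj (H.Δ (W.label a t)) ⟶ H.L y) := ⟨_, 0, hg'⟩
  have h3 := Module.finrank_pos (R := k) (M := (iterF G 1).obj (H.Δ (W.label a t)) ⟶ H.L y)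
  obtain ⟨u, rfl, h4⟩ := hc y (by omega)
  obtain ⟨j, h5, rfl⟩ := flipCount_one_ne_zero (h4 ▸ (by omega : l.count (W.label a u) ≠ 0))
  exact ⟨j, h5, rfl⟩

theorem isZero_iterF (hG : W.IsFlipFunctor G s s') (a : 𝔄) (t : Fin (W.n a) → Sgn) :
    IsZero ((iterF G (W.n a + 1)).obj (H.L (W.label a t))) := by
  have h1 : IsZero ((iterF G (W.n a + 1)).obj (H.Δ (W.label a t))) := by
    rw [← H.cls_eq_zero_iff, ← pow_map_cls]
    exact pow_apply_eq_zero_of_flip _ hG.ne (fun t => RatK0.cls (H.Δ (W.label a t)))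
      (hG.map_cls a) t
  have := H.epi_π (W.label a t)
  exact IsZero.of_epi ((iterF G (W.n a + 1)).map (H.π (W.label a t))) h1

theorem maxPower_eq_iff (hG : W.IsFlipFunctor G s s') (x : Λ) (n : ℕ) :
    maxPower G (H.L x) = n ↔
      ¬ IsZero ((iterF G n).obj (H.L x)) ∧ IsZero ((iterF G (n + 1)).obj (H.L x)) := by
  obtain ⟨a, t, rfl⟩ := W.exists_eq_label x
  exact HWSl2.maxPower_eq_iff (H.not_isZero_L _) ⟨_, hG.isZero_iterF a t⟩ n

theorem locally_nilpotent (hG : W.IsFlipFunctor G s s') (v : RatK0 C) :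
    ∃ M, (RatK0.map G ^ M) v = 0 := by
  have hmono : ∀ {v : RatK0 C} {M N : ℕ}, M ≤ N → (RatK0.map G ^ M) v = 0 →
      (RatK0.map G ^ N) v = 0 := by
    intro v M N hMN h
    obtain ⟨j, rfl⟩ := Nat.exists_eq_add_of_le' hMN
    rw [pow_add, Module.End.mul_apply, h, map_zero]
  have hv := H.basis.mem_span v
  induction hv using Submodule.span_induction with
  | mem v hv =>
    obtain ⟨x, rfl⟩ := hv
    obtain ⟨a, t, rfl⟩ := W.exists_eq_label x
    exact ⟨W.n a + 1, by
      rw [H.basis_apply, pow_map_cls]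
      exact RatK0.cls_isZero (hG.isZero_iterF a t)⟩
  | zero => exact ⟨0, map_zero _⟩
  | add v w _ _ hv hw =>
    obtain ⟨M, hM⟩ := hv
    obtain ⟨N, hN⟩ := hw
    exact ⟨max M N, by
      rw [map_add, hmono (le_max_left _ _) hM, hmono (le_max_right _ _) hN, add_zero]⟩
  | smul r v _ hv =>
    obtain ⟨M, hM⟩ := hv
    exact ⟨M, by rw [map_smul, hM, smul_zero]⟩

end IsFlipFunctor

end HighestWeightCategorification

theorem Sl2Categorification.sl2Action (S : Sl2Categorification k C) :
    Sl2Action S.opE S.opF S.opH where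
  ef v := by
    simp [ExactAdjointPair.opH, Ring.lie_def]
  he v := by
    have := LinearMap.congr_fun S.lie_h_e v
    simp only [Ring.lie_def, LinearMap.sub_apply, Module.End.mul_apply, LinearMap.smul_apply] at this
    rw [← this]; abel
  hf v := by
    have := LinearMap.congr_fun S.lie_h_f v
    simp only [Ring.lie_def, LinearMap.sub_apply, Module.End.mul_apply, LinearMap.smul_apply,
      neg_smul] at this
    rw [sub_eq_add_neg, ← this]; abel

/-- `h` acts diagonally in the basis of simple objects; an eigenvector has its weight in common with
the simple objects that occur in it. -/
theorem HighestWeightStructure.opH_cls_of_repr_ne_zero (H : HighestWeightStructure k C Λ)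
    (S : Sl2Categorification k C) {v : RatK0 C} {w : ℚ} (hv : S.opH v = w • v) {x : Λ}
    (hx : H.basis.repr v x ≠ 0) : S.opH (RatK0.cls (H.L x)) = w • RatK0.cls (H.L x) := by
  classical
  choose r hr using fun y => S.simple_weight (H.L y) (H.simple_L y)
  have h1 : H.basis.coord x ∘ₗ S.opH = r x • H.basis.coord x := by
    refine H.basis.ext fun y => ?_
    simp only [LinearMap.comp_apply, LinearMap.smul_apply, Module.Basis.coord_apply]
    rw [H.basis_apply, hr, ← H.basis_apply, map_smul, Finsupp.smul_apply, Module.Basis.repr_self,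
      Finsupp.single_apply]
    split_ifs with h
    · rw [h]
    · simp
  have h2 := LinearMap.congr_fun h1 v
  simp only [LinearMap.comp_apply, LinearMap.smul_apply, Module.Basis.coord_apply, hv, map_smul,
    smul_eq_mul] at h2
  rw [hr, mul_right_cancel₀ hx h2]

namespace HighestWeightCategorification

theorem opH_cls_L (a : 𝔄) (t : Fin (W.n a) → Sgn) : S.opH (RatK0.cls (H.L (W.label a t))) =
    ((signCrystal (W.n a)).wt t : ℚ) • RatK0.cls (H.L (W.label a t)) := by
  refine H.opH_cls_of_repr_ne_zero S (v := RatK0.cls (H.Δ (W.label a t))) ?_ ?_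
  · rw [← flip_commutator S.opE S.opF (fun t => RatK0.cls (H.Δ (W.label a t)))
      (W.isFlipFunctor_E.map_cls a) (W.isFlipFunctor_F.map_cls a), S.sl2Action.ef]
    abel
  · rw [H.repr_cls, H.mult_Δ_self]
    simp

/-- The axiom `wt = h₋ - h₊` for simple objects. -/
theorem maxPower_F_eq (a : 𝔄) (t : Fin (W.n a) → Sgn) :
    (maxPower S.F (H.L (W.label a t)) : ℤ) =
      maxPower S.E (H.L (W.label a t)) + (signCrystal (W.n a)).wt t := by
  set x := W.label a t
  obtain ⟨e1, e2⟩ := (W.isFlipFunctor_E.maxPower_eq_iff x _).1 rfl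
  obtain ⟨f1, f2⟩ := (W.isFlipFunctor_F.maxPower_eq_iff x _).1 rfl
  rw [← H.cls_eq_zero_iff, ← pow_map_cls] at e1 e2 f1 f2
  have hw := W.opH_cls_L a t
  have A := S.sl2Action
  refine le_antisymm ?_ ?_
  · by_contra hc
    refine f1 (A.pow_eq_zero W.isFlipFunctor_F.locally_nilpotent _ hw e2 _ ?_)
    exact_mod_cast (by omega : (signCrystal (W.n a)).wt t + ((maxPower S.E (H.L x) + 1 : ℕ) : ℤ) ≤
      maxPower S.F (H.L x))
  · by_contra hc
    refine e1 (A.symm.pow_eq_zero W.isFlipFunctor_E.locally_nilpotent _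
      (w := ((-(signCrystal (W.n a)).wt t : ℤ) : ℚ)) ?_ f2 _ ?_)
    · rw [LinearMap.neg_apply, hw, Int.cast_neg, neg_smul]
    · exact_mod_cast (by omega : -(signCrystal (W.n a)).wt t +
        ((maxPower S.F (H.L x) + 1 : ℕ) : ℤ) ≤ maxPower S.E (H.L x))

end HighestWeightCategorification

end Labels

/-! ### Multiplicities under exact functors -/

section Multiplicities

variable {k : Type*} [Field k] {C : Type u} [Category.{v} C] [Abelian C] [Linear k C]
  {Λ : Type*} [PartialOrder Λ]

theorem exists_smul_eq_of_finrank_le_one {V : Type*} [AddCommGroup V] [Module k V]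
    [Module.Finite k V] (h : Module.finrank k V ≤ 1) {v : V} (hv : v ≠ 0) (w : V) :
    ∃ r : k, r • v = w := by
  have : Nontrivial V := ⟨v, 0, hv⟩
  have h1 := Module.finrank_pos (R := k) (M := V)
  exact exists_smul_eq_of_finrank_eq_one (by omega) hv w

theorem comp_eq_zero_of_comp_eq_smul {M N : C} {φ : End N} (hφ : IsNilpotent φ) {g : M ⟶ N}
    {r : k} (h : r • g = g ≫ φ) : g ≫ φ = 0 := by
  obtain ⟨m, hm⟩ := hφ
  have h1 : ∀ m : ℕ, r ^ m • g = g ≫ (φ ^ m : End N) := by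
    intro m
    induction m with
    | zero => simp [End.one_def]
    | succ m ih =>
      rw [pow_succ φ m, End.mul_def, ← Category.assoc, ← h, Linear.smul_comp, ← ih, smul_smul,
        pow_succ']
  have h2 := h1 m
  rw [hm] at h2
  have h3 : r ^ m • g = 0 := h2.trans comp_zero
  rcases smul_eq_zero.1 h3 with h4 | h4
  · rw [← h, eq_zero_of_pow_eq_zero h4, zero_smul]
  · rw [h4, zero_comp]

theorem comp_eq_zero_of_comp_eq_smul' {M N : C} {φ : End N} (hφ : IsNilpotent φ) {g : N ⟶ M}
    {r : k} (h : r • g = φ ≫ g) : φ ≫ g = 0 := by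
  obtain ⟨m, hm⟩ := hφ
  have h1 : ∀ m : ℕ, r ^ m • g = (φ ^ m : End N) ≫ g := by
    intro m
    induction m with
    | zero => simp [End.one_def]
    | succ m ih =>
      rw [pow_succ' φ m, End.mul_def, Category.assoc, ← h, Linear.comp_smul, ← ih, smul_smul,
        pow_succ']
  have h2 := h1 m
  rw [hm] at h2
  have h3 : r ^ m • g = 0 := h2.trans zero_comp
  rcases smul_eq_zero.1 h3 with h4 | h4
  · rw [← h, eq_zero_of_pow_eq_zero h4, zero_smul]
  · rw [h4, comp_zero]

theorem RatK0.cls_kernel_eq_cls_cokernel {M : C} (φ : M ⟶ M) :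
    RatK0.cls (kernel φ) = RatK0.cls (cokernel φ) := by
  have h1 := RatK0.cls_shortExact (shortExact_of_mono (kernel.ι φ))
  have h2 := RatK0.cls_shortExact (shortExact_of_epi (cokernel.π φ))
  have h3 := RatK0.cls_iso (Abelian.coimageIsoImage φ)
  simp only at h1 h2
  have h4 : RatK0.cls (kernel φ) + RatK0.cls (Abelian.coimage φ) =
      RatK0.cls (Abelian.image φ) + RatK0.cls (cokernel φ) := h1.symm.trans h2
  rw [h3, add_comm] at h4
  exact add_left_cancel h4

namespace HighestWeightStructure

variable (H : HighestWeightStructure k C Λ)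

theorem repr_map (G : C ⥤ C) [G.Additive] [PreservesFiniteLimits G]
    [PreservesFiniteColimits G] (v : RatK0 C) (y : Λ) : H.basis.repr (RatK0.map G v) y =
      ∑ x ∈ (H.basis.repr v).support, H.basis.repr v x * H.mult (G.obj (H.L x)) y := by
  conv_lhs => rw [← H.basis.linearCombination_repr v, Finsupp.linearCombination_apply, Finsupp.sum]
  rw [map_sum, map_sum, Finsupp.finsetSum_apply]
  refine Finset.sum_congr rfl fun x _ => ?_
  rw [map_smul, map_smul, H.basis_apply, RatK0.map_cls, Finsupp.smul_apply, H.repr_cls,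
    smul_eq_mul]

theorem pow_map_eq (H : HighestWeightStructure k C Λ) (G : C ⥤ C) [G.Additive]
    [PreservesFiniteLimits G]
    [PreservesFiniteColimits G] (n : ℕ) : RatK0.map G ^ n = RatK0.map (iterF G n) :=
  H.basis.ext fun x => by rw [H.basis_apply, pow_map_cls, RatK0.map_cls]

theorem sum_mult_mul_le (G : C ⥤ C) [G.Additive] [PreservesFiniteLimits G]
    [PreservesFiniteColimits G] (M : C) (y : Λ) (s : Finset Λ) :
    ∑ x ∈ s, H.mult M x * H.mult (G.obj (H.L x)) y ≤ H.mult (G.obj M) y := by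
  classical
  have h1 := H.repr_map G (RatK0.cls M) y
  simp only [RatK0.map_cls, H.repr_cls] at h1
  have h2 : ∑ x ∈ s, (H.mult M x * H.mult (G.obj (H.L x)) y : ℚ) ≤ H.mult (G.obj M) y := by
    rw [h1, ← Finset.sum_filter_ne_zero]
    refine Finset.sum_le_sum_of_subset_of_nonneg (fun x hx => ?_) fun _ _ _ => by positivity
    rw [Finsupp.mem_support_iff, H.repr_cls]
    exact left_ne_zero_of_mul (Finset.mem_filter.1 hx).2
  exact_mod_cast h2

theorem mult_mul_le (G : C ⥤ C) [G.Additive] [PreservesFiniteLimits G]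
    [PreservesFiniteColimits G] (M : C) (x y : Λ) :
    H.mult M x * H.mult (G.obj (H.L x)) y ≤ H.mult (G.obj M) y := by
  simpa using H.sum_mult_mul_le G M y {x}

theorem mult_ne_zero_of_ne_zero {M : C} {x : Λ} {g : M ⟶ H.L x} (hg : g ≠ 0) : H.mult M x ≠ 0 := by
  have := H.epi_of_ne_zero hg
  have := H.mult_le_of_epi g x
  rw [H.mult_self] at this
  omega

theorem mult_ne_zero_of_ne_zero' {M : C} {x : Λ} {g : H.L x ⟶ M} (hg : g ≠ 0) : H.mult M x ≠ 0 := by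
  have := H.mono_of_ne_zero hg
  have := H.mult_le_of_mono g x
  rw [H.mult_self] at this
  omega

theorem cls_L_ne_zero (x : Λ) : RatK0.cls (H.L x) ≠ 0 := fun h =>
  H.not_isZero_L x (H.cls_eq_zero_iff.1 h)

theorem hasSimpleSocle {M : C} {z : Λ} {i : H.L z ⟶ M} (hi : i ≠ 0)
    (h1 : Module.finrank k (H.L z ⟶ M) ≤ 1) (h2 : ∀ y (g : H.L y ⟶ M), g ≠ 0 → y = z) :
    HasSimpleSocle M (H.L z) := by
  have := H.finite_hom (H.L z) M
  refine ⟨H.simple_L z, i, H.mono_of_ne_zero hi, fun T hT g => ?_⟩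
  obtain ⟨y, ⟨e⟩, -⟩ := H.classification T hT
  by_cases hg : g = 0
  · exact ⟨0, by rw [hg, zero_comp]⟩
  · have hg' : e.inv ≫ g ≠ 0 := fun h => hg (by rw [← e.hom_inv_id_assoc g, h, comp_zero])
    obtain rfl := h2 y _ hg'
    obtain ⟨r, hr⟩ := exists_smul_eq_of_finrank_le_one h1 hi (e.inv ≫ g)
    exact ⟨r • e.hom, by rw [Linear.smul_comp, ← Linear.comp_smul, hr, e.hom_inv_id_assoc]⟩

theorem hasSimpleHead {M : C} {z : Λ} {p : M ⟶ H.L z} (hp : p ≠ 0)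
    (h1 : Module.finrank k (M ⟶ H.L z) ≤ 1) (h2 : ∀ y (g : M ⟶ H.L y), g ≠ 0 → y = z) :
    HasSimpleHead M (H.L z) := by
  have := H.finite_hom M (H.L z)
  refine ⟨H.simple_L z, p, H.epi_of_ne_zero hp, fun T hT g => ?_⟩
  obtain ⟨y, ⟨e⟩, -⟩ := H.classification T hT
  by_cases hg : g = 0
  · exact ⟨0, by rw [hg, comp_zero]⟩
  · have hg' : g ≫ e.hom ≠ 0 := fun h => hg (by
      rw [← Category.comp_id g, ← e.hom_inv_id, ← Category.assoc, h, zero_comp])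
    obtain rfl := h2 y _ hg'
    obtain ⟨r, hr⟩ := exists_smul_eq_of_finrank_le_one h1 hp (g ≫ e.hom)
    exact ⟨r • e.inv, by
      rw [Linear.comp_smul, ← Linear.smul_comp, hr, Category.assoc, e.hom_inv_id,
        Category.comp_id]⟩

end HighestWeightStructure

end Multiplicities

/-! ### The highest power of `E` on a simple object -/

section TopPower

variable {k : Type*} [Field k] {C : Type u} [Category.{v} C] [Abelian C] [Linear k C]
  {Λ : Type*} [PartialOrder Λ] {𝔄 : Type*}

theorem HighestWeightStructure.factorial_le_finrank (H : HighestWeightStructure k C Λ)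
    (S : Sl2Categorification k C) {A : C} {n : ℕ} {M : C} {v : A ⟶ (iterF S.E n).obj M}
    (hv : v ≠ 0) : n.factorial ≤ Module.finrank k (A ⟶ (iterF S.E n).obj M) := by
  obtain ⟨α, β, hβ, hrel⟩ := S.exists_commutation
  exact factorial_le_finrank_hom S.opT S.X hβ S.opT_naturality hrel S.nilpotent A
    (H.finite_hom A) n M v hv

theorem HighestWeightStructure.succ_mul_finrank_le (H : HighestWeightStructure k C Λ)
    (S : Sl2Categorification k C) (A : C) (n : ℕ) (M : C) :
    (n + 1) * Module.finrank k
      (A ⟶ (iterF S.E n).obj (kernel (S.X.app M - S.a • 𝟙 (S.E.obj M)))) ≤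
      Module.finrank k (A ⟶ (iterF S.E n).obj (S.E.obj M)) := by
  obtain ⟨α, β, hβ, hrel⟩ := S.exists_commutation
  have := H.finite_hom A ((iterF S.E n).obj (S.E.obj M))
  have := H.finite_hom A
    ((iterF S.E n).obj (kernel (S.X.app M - S.a • 𝟙 (S.E.obj M))))
  exact succ_mul_finrank_hom_kernel_le S.opT S.X hβ S.opT_naturality hrel S.nilpotent A n M

namespace HighestWeightStructure

variable (H : HighestWeightStructure k C Λ) (S : Sl2Categorification k C)

/-- For `n = h₊(L(x))`, the object `Eⁿ L(x)` has `L(ν)` as its only composition factor, with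
multiplicity `n!`, and `Hom(L(ν), Eⁿ L(x))` has dimension `n!`. -/
structure IsTop (x ν : Λ) : Prop where
  mult_eq : H.mult ((iterF S.E (maxPower S.E (H.L x))).obj (H.L x)) ν =
    (maxPower S.E (H.L x)).factorial
  mult_eq_zero : ∀ y, y ≠ ν →
    H.mult ((iterF S.E (maxPower S.E (H.L x))).obj (H.L x)) y = 0
  finrank_eq : Module.finrank k (H.L ν ⟶ (iterF S.E (maxPower S.E (H.L x))).obj (H.L x)) =
    (maxPower S.E (H.L x)).factorial

end HighestWeightStructure

namespace HighestWeightCategorification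

variable {H : HighestWeightStructure k C Λ} {S : Sl2Categorification k C}

theorem opH_cls_L_eq_sub (W : HighestWeightCategorification H S 𝔄) (x : Λ) :
    S.opH (RatK0.cls (H.L x)) =
    ((maxPower S.F (H.L x) : ℚ) - maxPower S.E (H.L x)) • RatK0.cls (H.L x) := by
  obtain ⟨a, t, rfl⟩ := W.exists_eq_label x
  have h : (maxPower S.F (H.L (W.label a t)) : ℚ) = maxPower S.E (H.L (W.label a t)) +
      (signCrystal (W.n a)).wt t := by exact_mod_cast W.maxPower_F_eq a t
  rw [W.opH_cls_L, h, add_sub_cancel_left]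

/-- `Eᵐ` raises weights by `2m`. -/
theorem weight_of_mult_ne_zero (W : HighestWeightCategorification H S 𝔄) {m : ℕ} {u x : Λ}
    (h : H.mult ((iterF S.E m).obj (H.L u)) x ≠ 0) :
    (maxPower S.F (H.L x) : ℤ) - maxPower S.E (H.L x) =
      maxPower S.F (H.L u) - maxPower S.E (H.L u) + 2 * m := by
  have h1 := S.sl2Action.h_pow (W.opH_cls_L_eq_sub u) m
  have h2 : (S.opE ^ m) (RatK0.cls (H.L u)) = RatK0.cls ((iterF S.E m).obj (H.L u)) :=
    pow_map_cls _ _ _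
  rw [h2] at h1
  have h3 := H.opH_cls_of_repr_ne_zero S h1 (x := x) (by rw [H.repr_cls]; exact_mod_cast h)
  rw [W.opH_cls_L_eq_sub] at h3
  have h4 := smul_left_injective ℚ (H.cls_L_ne_zero x) h3
  exact_mod_cast h4

/-- The case of a lowest weight vector. Let `d = h₊(L(u))` and `L(ν) ⊂ Eᵈ L(u)`. The multiplicities
of `L(ν)` in `Eᵈ L(u)` and of `L(u)` in `Fᵈ L(ν)` are both at least `d!`, while their product is at
most the multiplicity `(d!)²` of `L(ν)` in `Eᵈ Fᵈ L(ν)`. -/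
theorem isTop_of_maxPower_F_eq_zero (W : HighestWeightCategorification H S 𝔄) {u : Λ}
    (hu : maxPower S.F (H.L u) = 0) :
    ∃ ν, H.IsTop S u ν := by
  set d := maxPower S.E (H.L u) with hd
  obtain ⟨h1, h2⟩ := (W.isFlipFunctor_E.maxPower_eq_iff u d).1 rfl
  obtain ⟨ν, i, hi⟩ := H.exists_mono_L h1
  have hi0 := H.ne_zero_of_mono i
  have hνE : IsZero (S.E.obj (H.L ν)) := by
    rw [iterF_succ_obj] at h2
    exact IsZero.of_mono (S.E.map i) h2
  have hνp : maxPower S.E (H.L ν) = 0 :=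
    (W.isFlipFunctor_E.maxPower_eq_iff ν 0).2 ⟨H.not_isZero_L ν, hνE⟩
  have hνw := W.weight_of_mult_ne_zero (H.mult_ne_zero_of_ne_zero' hi0)
  have hνm : maxPower S.F (H.L ν) = d := by omega
  have hfr := H.factorial_le_finrank S hi0
  have hadj := finrank_iterF_adj (k := k) S.adj'.some d (H.L ν) (H.L u)
  have hb := H.finrank_hom_le_mult ((iterF S.F d).obj (H.L ν)) u
  have hm := H.finrank_hom_le_mult' ((iterF S.E d).obj (H.L u)) ν
  have hp : ∃ p : (iterF S.F d).obj (H.L ν) ⟶ H.L u, p ≠ 0 := by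
    obtain ⟨e⟩ := nonempty_iterF_homLinearEquiv (k := k) S.adj'.some d (H.L ν) (H.L u)
    exact ⟨e.symm i, fun h => hi0 (by simpa using h)⟩
  obtain ⟨p, hp⟩ := hp
  have hepi := H.epi_of_ne_zero hp
  have hcls : RatK0.cls ((iterF S.E d).obj ((iterF S.F d).obj (H.L ν))) =
      ((d.factorial : ℚ) * d.factorial) • RatK0.cls (H.L ν) := by
    have h3 := S.sl2Action.symm.pow_pow (u := RatK0.cls (H.L ν)) (w := -d)
      (by rw [LinearMap.neg_apply, W.opH_cls_L_eq_sub, hνp, hνm]; simp)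
      ((RatK0.map_cls _ _).trans (RatK0.cls_isZero hνE)) d
    rw [← pow_map_cls, ← pow_map_cls]
    simp only [neg_neg] at h3
    rw [Sl2Action.prod_eq_factorial_sq] at h3
    exact h3
  have hmult : ∀ y, (H.mult ((iterF S.E d).obj ((iterF S.F d).obj (H.L ν))) y : ℚ) =
      ((d.factorial : ℚ) * d.factorial) * H.mult (H.L ν) y := by
    intro y
    rw [← H.repr_cls, hcls, map_smul, Finsupp.smul_apply, H.repr_cls, smul_eq_mul]
  have h4 : H.mult ((iterF S.E d).obj ((iterF S.F d).obj (H.L ν))) ν =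
      d.factorial * d.factorial := by
    have := hmult ν
    rw [H.mult_self, Nat.cast_one, mul_one] at this
    exact_mod_cast this
  have h5 : ∀ y, y ≠ ν → H.mult ((iterF S.E d).obj (H.L u)) y = 0 := by
    intro y hy
    have h6 := hmult y
    rw [H.mult_L, if_neg hy.symm, Nat.cast_zero, mul_zero] at h6
    have h7 := H.mult_le_of_epi ((iterF S.E d).map p) y
    have h8 : H.mult ((iterF S.E d).obj ((iterF S.F d).obj (H.L ν))) y = 0 := by exact_mod_cast h6
    omega
  have h6 := H.mult_mul_le (iterF S.E d) ((iterF S.F d).obj (H.L ν)) u ν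
  rw [h4] at h6
  have h7 : H.mult ((iterF S.E d).obj (H.L u)) ν ≤ d.factorial := by
    refine Nat.le_of_mul_le_mul_left ((Nat.mul_le_mul_right _ ?_).trans h6) d.factorial_pos
    omega
  exact ⟨ν, le_antisymm h7 (hfr.trans hm), h5, le_antisymm (hm.trans h7) hfr⟩

/-- With `i = h₋(L(x))` and a simple quotient `L(u)` of `Fⁱ L(x)`, which `F` kills, `L(x)` embeds into
`Eⁱ L(u)`, hence `Eⁿ L(x)` into `Eⁿ⁺ⁱ L(u)`, where `n + i = h₊(L(u))`. -/
theorem exists_isTop (W : HighestWeightCategorification H S 𝔄) (x : Λ) : ∃ ν, H.IsTop S x ν := by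
  set n := maxPower S.E (H.L x) with hn
  set i := maxPower S.F (H.L x) with hi
  obtain ⟨e1, e2⟩ := (W.isFlipFunctor_E.maxPower_eq_iff x n).1 rfl
  obtain ⟨f1, f2⟩ := (W.isFlipFunctor_F.maxPower_eq_iff x i).1 rfl
  obtain ⟨u, p, hp⟩ := H.exists_epi_L f1
  have hp0 := H.ne_zero_of_epi p
  have huF : maxPower S.F (H.L u) = 0 := by
    refine (W.isFlipFunctor_F.maxPower_eq_iff u 0).2 ⟨H.not_isZero_L u, ?_⟩
    rw [iterF_succ_obj] at f2
    change IsZero (S.F.obj (H.L u))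
    exact IsZero.of_epi (S.F.map p) f2
  obtain ⟨ν, hν⟩ := W.isTop_of_maxPower_F_eq_zero huF
  obtain ⟨e⟩ := nonempty_iterF_homLinearEquiv (k := k) S.adj'.some i (H.L x) (H.L u)
  have hj : e p ≠ 0 := fun h => hp0 (by simpa using h)
  have hw := W.weight_of_mult_ne_zero (H.mult_ne_zero_of_ne_zero' hj)
  have hd : maxPower S.E (H.L u) = n + i := by omega
  obtain ⟨t1, t2, t3⟩ := hν
  rw [hd, iterF_add_obj] at t1 t2 t3
  have hmono := H.mono_of_ne_zero hj
  have h1 := H.mult_eq_finrank_of_mono ((iterF S.E n).map (e p)) ν (t1.trans t3.symm)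
  have h2 : ∀ y, y ≠ ν → H.mult ((iterF S.E n).obj (H.L x)) y = 0 := by
    intro y hy
    have := H.mult_le_of_mono ((iterF S.E n).map (e p)) y
    rw [t2 y hy] at this
    omega
  have h3 := W.isFlipFunctor_F.finrank_hom_le n ν x
  rw [finrank_iterF_adj (k := k) S.adj'.some n (H.L ν) (H.L x)] at h3
  obtain ⟨y, q, hq⟩ := H.exists_mono_L e1
  have hq0 := H.ne_zero_of_mono q
  have hy : y = ν := by
    by_contra hy
    exact H.mult_ne_zero_of_ne_zero' hq0 (h2 y hy)
  subst hy
  have h4 := H.factorial_le_finrank S hq0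
  have h5 := le_antisymm h3 h4
  exact ⟨y, h1.trans h5, h2, h5⟩

/-- A simple subobject or quotient `L(y)` of `E L(x)` satisfies `h₊(L(y)) = h₊(L(x)) - 1`. -/
theorem maxPower_of_hom_ne_zero (W : HighestWeightCategorification H S 𝔄) {x y : Λ} {n : ℕ}
    (hx : maxPower S.E (H.L x) = n + 1)
    (h : (∃ g : S.E.obj (H.L x) ⟶ H.L y, g ≠ 0) ∨ ∃ g : H.L y ⟶ S.E.obj (H.L x), g ≠ 0) :
    maxPower S.E (H.L y) = n := by
  obtain ⟨e1, e2⟩ := (W.isFlipFunctor_E.maxPower_eq_iff x (n + 1)).1 hx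
  have e3 : IsZero ((iterF S.E (n + 1)).obj (S.E.obj (H.L x))) := e2
  have hy : IsZero ((iterF S.E (n + 1)).obj (H.L y)) := by
    rcases h with ⟨g, hg⟩ | ⟨g, hg⟩
    · have := H.epi_of_ne_zero hg
      exact IsZero.of_epi ((iterF S.E (n + 1)).map g) e3
    · have := H.mono_of_ne_zero hg
      exact IsZero.of_mono ((iterF S.E (n + 1)).map g) e3
  refine (W.isFlipFunctor_E.maxPower_eq_iff y n).2 ⟨fun hz => e1 ?_, hy⟩
  -- If `Eⁿ L(y)` vanished, so would `Eⁿ⁺¹ F L(y)`, which has `Eⁿ⁺¹ L(x)` as a subobject or quotient.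
  have hFy : IsZero ((iterF S.E (n + 1)).obj (S.F.obj (H.L y))) := by
    rw [← H.cls_eq_zero_iff, ← pow_map_cls, ← RatK0.map_cls]
    have h1 := S.sl2Action.pow_comm (W.opH_cls_L_eq_sub y) n
    have h2 : (S.opE ^ n) (RatK0.cls (H.L y)) = 0 := by
      rw [ExactAdjointPair.opE, pow_map_cls, H.cls_eq_zero_iff]
      exact hz
    have h3 : (S.opE ^ (n + 1)) (RatK0.cls (H.L y)) = 0 := by
      rw [ExactAdjointPair.opE, pow_map_cls, H.cls_eq_zero_iff]
      exact hy
    rw [h2, h3, map_zero, smul_zero, add_zero] at h1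
    exact h1
  rcases h with ⟨g, hg⟩ | ⟨g, hg⟩
  · obtain ⟨e⟩ := nonempty_homLinearEquiv (k := k) S.adj (H.L x) (H.L y)
    have := H.mono_of_ne_zero (i := e g) fun h => hg (by simpa using h)
    exact IsZero.of_mono ((iterF S.E (n + 1)).map (e g)) hFy
  · obtain ⟨e⟩ := nonempty_homLinearEquiv (k := k) S.adj'.some (H.L y) (H.L x)
    have := H.epi_of_ne_zero (p := e.symm g) fun h => hg (by simpa using h)
    exact IsZero.of_epi ((iterF S.E (n + 1)).map (e.symm g)) hFy

theorem finrank_hom_E_le_one (W : HighestWeightCategorification H S 𝔄) (x y : Λ) :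
    Module.finrank k (S.E.obj (H.L x) ⟶ H.L y) ≤ 1 :=
  W.isFlipFunctor_E.finrank_hom_le 1 x y

theorem finrank_hom_F_le_one (W : HighestWeightCategorification H S 𝔄) (x y : Λ) :
    Module.finrank k (S.F.obj (H.L x) ⟶ H.L y) ≤ 1 :=
  W.isFlipFunctor_F.finrank_hom_le 1 x y

theorem finrank_hom_to_E_le_one (W : HighestWeightCategorification H S 𝔄) (x y : Λ) :
    Module.finrank k (H.L y ⟶ S.E.obj (H.L x)) ≤ 1 := by
  rw [← (nonempty_homLinearEquiv (k := k) S.adj'.some (H.L y) (H.L x)).some.finrank_eq]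
  exact W.finrank_hom_F_le_one y x

theorem finrank_hom_to_F_le_one (W : HighestWeightCategorification H S 𝔄) (x y : Λ) :
    Module.finrank k (H.L y ⟶ S.F.obj (H.L x)) ≤ 1 := by
  rw [← (nonempty_homLinearEquiv (k := k) S.adj (H.L y) (H.L x)).some.finrank_eq]
  exact W.finrank_hom_E_le_one y x

/-- The nilpotent endomorphism `X - a` of `E L(x)` annihilates the one-dimensional spaces of
morphisms between `E L(x)` and simple objects; hence the simple subobjects and quotients
of `E L(x)` are composition factors of its kernel. -/
theorem mult_kernel_ne_zero (W : HighestWeightCategorification H S 𝔄) {x y : Λ}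
    (h : (∃ g : S.E.obj (H.L x) ⟶ H.L y, g ≠ 0) ∨ ∃ g : H.L y ⟶ S.E.obj (H.L x), g ≠ 0) :
    H.mult (kernel (S.X.app (H.L x) - S.a • 𝟙 (S.E.obj (H.L x)))) y ≠ 0 := by
  have hnil := S.nilpotent (H.L x)
  rcases h with ⟨g, hg⟩ | ⟨g, hg⟩
  · have := H.finite_hom (S.E.obj (H.L x)) (H.L y)
    obtain ⟨r, hr⟩ := exists_smul_eq_of_finrank_le_one (W.finrank_hom_E_le_one x y) hg
      ((S.X.app (H.L x) - S.a • 𝟙 (S.E.obj (H.L x))) ≫ g)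
    have h0 := comp_eq_zero_of_comp_eq_smul' hnil hr
    rw [H.mult_of_cls_eq (RatK0.cls_kernel_eq_cls_cokernel _)]
    refine H.mult_ne_zero_of_ne_zero (g := cokernel.desc _ g h0) fun h => hg ?_
    rw [← cokernel.π_desc _ g h0, h, comp_zero]
  · have := H.finite_hom (H.L y) (S.E.obj (H.L x))
    obtain ⟨r, hr⟩ := exists_smul_eq_of_finrank_le_one (W.finrank_hom_to_E_le_one x y) hg
      (g ≫ (S.X.app (H.L x) - S.a • 𝟙 (S.E.obj (H.L x))))
    have h0 := comp_eq_zero_of_comp_eq_smul hnil hr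
    refine H.mult_ne_zero_of_ne_zero' (g := kernel.lift _ g h0) fun h => hg ?_
    rw [← kernel.lift_ι _ g h0, h, zero_comp]

/-- The crystal operator: `E L(x)` has a simple socle and a simple head, and they coincide. -/
theorem exists_raise (W : HighestWeightCategorification H S 𝔄) {x : Λ}
    (hx : 0 < maxPower S.E (H.L x)) : ∃ z,
    maxPower S.E (H.L z) + 1 = maxPower S.E (H.L x) ∧
    (∀ ν, H.IsTop S x ν → H.IsTop S z ν) ∧
    (∃ g : S.E.obj (H.L x) ⟶ H.L z, g ≠ 0) ∧ (∃ g : H.L z ⟶ S.E.obj (H.L x), g ≠ 0) ∧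
    (∀ y (g : S.E.obj (H.L x) ⟶ H.L y), g ≠ 0 → y = z) ∧
    (∀ y (g : H.L y ⟶ S.E.obj (H.L x)), g ≠ 0 → y = z) := by
  obtain ⟨n, hn⟩ := Nat.exists_eq_succ_of_ne_zero hx.ne'
  rw [Nat.succ_eq_add_one] at hn
  let A (y : Λ) : Prop := (∃ g : S.E.obj (H.L x) ⟶ H.L y, g ≠ 0) ∨
    ∃ g : H.L y ⟶ S.E.obj (H.L x), g ≠ 0
  have htop : ∀ y, A y → ∀ ν, H.IsTop S x ν → H.IsTop S y ν := by
    intro y hy ν hν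
    have hyn := W.maxPower_of_hom_ne_zero hn hy
    obtain ⟨ν', hν'⟩ := W.exists_isTop y
    have hmy : H.mult (S.E.obj (H.L x)) y ≠ 0 := by
      rcases hy with ⟨g, hg⟩ | ⟨g, hg⟩
      · exact H.mult_ne_zero_of_ne_zero hg
      · exact H.mult_ne_zero_of_ne_zero' hg
    have h1 := H.mult_mul_le (iterF S.E n) (S.E.obj (H.L x)) y ν'
    have h2 := hν'.mult_eq
    have h3 := hν.mult_eq_zero ν'
    rw [hyn] at h2
    rw [hn] at h3
    by_cases hνν : ν' = ν
    · rwa [← hνν]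
    · have h4 : H.mult ((iterF S.E n).obj (S.E.obj (H.L x))) ν' = 0 := h3 hνν
      rw [h4, h2, Nat.le_zero] at h1
      exact absurd h1 (mul_ne_zero hmy n.factorial_ne_zero)
  have huniq : ∀ y z, A y → A z → y = z := by
    classical
    intro y z hy hz
    by_contra hyz
    obtain ⟨ν, hν⟩ := W.exists_isTop x
    have h1 := H.succ_mul_finrank_le S (H.L ν) n (H.L x)
    have t1 := hν.mult_eq
    have t3 := hν.finrank_eq
    rw [hn] at t1 t3
    have h2 := H.mult_eq_finrank_of_mono ((iterF S.E n).map (kernel.ι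
      (S.X.app (H.L x) - S.a • 𝟙 (S.E.obj (H.L x))))) ν (t1.trans t3.symm)
    have t3' : Module.finrank k (H.L ν ⟶ (iterF S.E n).obj (S.E.obj (H.L x))) =
      (n + 1) * n.factorial := t3
    rw [t3', ← h2] at h1
    -- `L(ν)` occurs at most `n!` times in `Eⁿ K`, but `n!` times in each of `Eⁿ L(y)`, `Eⁿ L(z)`.
    have h3 := Nat.le_of_mul_le_mul_left h1 n.succ_pos
    have h4 := H.sum_mult_mul_le (iterF S.E n) (kernel
      (S.X.app (H.L x) - S.a • 𝟙 (S.E.obj (H.L x)))) ν {y, z}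
    have hy1 := (htop y hy ν hν).mult_eq
    have hz1 := (htop z hz ν hν).mult_eq
    rw [W.maxPower_of_hom_ne_zero hn hy] at hy1
    rw [W.maxPower_of_hom_ne_zero hn hz] at hz1
    rw [Finset.sum_pair hyz, hy1, hz1] at h4
    have h5 := W.mult_kernel_ne_zero hy
    have h6 := W.mult_kernel_ne_zero hz
    have h7 := n.factorial_pos
    have h8 := Nat.le_mul_of_pos_left n.factorial (Nat.pos_of_ne_zero h5)
    have h9 := Nat.le_mul_of_pos_left n.factorial (Nat.pos_of_ne_zero h6)
    omega
  have hE : ¬ IsZero (S.E.obj (H.L x)) := by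
    intro h
    refine ((W.isFlipFunctor_E.maxPower_eq_iff x (n + 1)).1 hn).1 ?_
    exact Functor.map_isZero (iterF S.E n) h
  obtain ⟨z, p, hp⟩ := H.exists_epi_L hE
  obtain ⟨z', i, hi⟩ := H.exists_mono_L hE
  have hAz : A z := .inl ⟨p, H.ne_zero_of_epi p⟩
  obtain rfl := huniq z z' hAz (.inr ⟨i, H.ne_zero_of_mono i⟩)
  exact ⟨z, by rw [W.maxPower_of_hom_ne_zero hn hAz, hn], htop z hAz, ⟨p, H.ne_zero_of_epi p⟩,
    ⟨i, H.ne_zero_of_mono i⟩, fun y g hg => huniq y z (.inl ⟨g, hg⟩) hAz,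
    fun y g hg => huniq y z (.inr ⟨g, hg⟩) hAz⟩

end HighestWeightCategorification

end TopPower

/-! ### Vectors killed by a power of `e` with a prescribed leading term -/

section CancelledFamilies

theorem IntLT.trans {α β γ : ℂ} (h : IntLT α β) (h' : IntLT β γ) : IntLT α γ := by
  obtain ⟨m, hm, h1⟩ := h
  obtain ⟨m', -, h2⟩ := h'
  exact ⟨m + m', by omega, by rw [Nat.cast_add, ← h1, ← h2]; ring⟩

theorem IntLT.irrefl (α : ℂ) : ¬ IntLT α α := by
  rintro ⟨m, hm, h⟩
  rw [sub_self] at h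
  exact hm.ne (by exact_mod_cast h)

variable {n : ℕ} {V : Type*} [AddCommGroup V] [Module ℚ V]

/-- The span of the vectors `D s'` for which `c s < c s'`. -/
def lowerSpan (D : (Fin n → Sgn) → V) (c : (Fin n → Sgn) → ℂ) (s : Fin n → Sgn) :
    Submodule ℚ V := Submodule.span ℚ {v | ∃ s', IntLT (c s) (c s') ∧ v = D s'}

theorem lowerSpan_le {D : (Fin n → Sgn) → V} {c : (Fin n → Sgn) → ℂ} {s s' : Fin n → Sgn}
    (h : IntLT (c s) (c s')) : lowerSpan D c s' ≤ lowerSpan D c s :=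
  Submodule.span_mono fun _ ⟨r, hr, hv⟩ => ⟨r, h.trans hr, hv⟩

/-- A family on which `e` acts like on the standard classes `D`, with the same leading terms on the
sequences that agree with `t` at the places cancelled in `u`, and vanishing on the
sequences in which a cancelled `+` of `t` has been changed, while no cancelled `-` has. -/
structure IsCancelledFamily (e : Module.End ℚ V) (D : (Fin n → Sgn) → V)
    (c : (Fin n → Sgn) → ℂ) (t : Fin n → Sgn) (u : Fin n → Option Sgn)
    (y : (Fin n → Sgn) → V) : Prop where
  map_eq : ∀ s, e (y s) = ∑ j with s j = Sgn.plus, y (Function.update s j Sgn.minus)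
  sub_mem : ∀ s, (∀ i, u i = none → s i = t i) → y s - D s ∈ lowerSpan D c s
  eq_zero : ∀ s i, u i = none → t i = Sgn.plus → s i = Sgn.minus →
    (∀ j, u j = none → t j = Sgn.minus → s j = Sgn.minus) → y s = 0

variable {e : Module.End ℚ V} {D : (Fin n → Sgn) → V} {c : (Fin n → Sgn) → ℂ}
  {d : Fin n → ℂ}

/-- Interchanging the signs at two places `a < b` with signs `-`, `+` increases `c`. -/
theorem intLT_comp_swap
    (hplus : ∀ s j, s j = Sgn.plus → c (Function.update s j Sgn.minus) = c s + d j)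
    (hminus : ∀ s j, s j = Sgn.minus → c (Function.update s j Sgn.plus) = c s - d j)
    (hd : ∀ i j, i < j → IntLT (d i) (d j)) {a b : Fin n} (hab : a < b) {s : Fin n → Sgn}
    (ha : s a = Sgn.minus) (hb : s b = Sgn.plus) : IntLT (c s) (c (s ∘ Equiv.swap a b)) := by
  have h1 : s ∘ Equiv.swap a b =
      Function.update (Function.update s b Sgn.minus) a Sgn.plus := by
    funext i
    by_cases hia : i = a
    · subst hia; simp [hb]
    · by_cases hib : i = b
      · subst hib; simp [ha, hia]
      · simp [Equiv.swap_apply_of_ne_of_ne hia hib, hia, hib]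
  rw [h1, hminus _ _ (by rw [Function.update_of_ne hab.ne, ha]), hplus _ _ hb]
  obtain ⟨m, hm, h2⟩ := hd a b hab
  exact ⟨m, hm, by rw [← h2]; ring⟩

theorem exists_isCancelledFamily
    (he : ∀ s, e (D s) = ∑ j with s j = Sgn.plus, D (Function.update s j Sgn.minus))
    (hplus : ∀ s j, s j = Sgn.plus → c (Function.update s j Sgn.minus) = c s + d j)
    (hminus : ∀ s j, s j = Sgn.minus → c (Function.update s j Sgn.plus) = c s - d j)
    (hd : ∀ i j, i < j → IntLT (d i) (d j)) (t : Fin n → Sgn) {u : Fin n → Option Sgn}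
    (hu : Relation.ReflTransGen CancelStep (fun i => some (t i)) u) :
    (∀ i s, u i = some s → t i = s) ∧ ∃ y, IsCancelledFamily e D c t u y := by
  induction hu with
  | refl =>
    exact ⟨fun i s h => Option.some.inj h, D, he, fun s _ => by simp, fun s i h => by simp at h⟩
  | @tail u w _ hstep ih =>
    obtain ⟨hut, y, hy⟩ := ih
    obtain ⟨a, b, hab, ha, hb, -, rfl⟩ := hstep
    have hta := hut a _ ha
    have htb := hut b _ hb
    have hw : ∀ i, u i = none → i ≠ a ∧ i ≠ b := by
      intro i hi
      constructor <;> rintro rfl <;> simp_all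
    have hwn : ∀ i, Function.update (Function.update u a none) b none i = none ↔
        i = b ∨ i = a ∨ u i = none := by
      intro i
      simp only [Function.update_apply]
      split_ifs <;> simp_all
    refine ⟨fun i s h => hut i s ?_, fun s => y s - y (s ∘ Equiv.swap a b), fun s => ?_,
      fun s hs => ?_, fun s i hi hti hsi hs => ?_⟩
    · simp only [Function.update_apply] at h
      split_ifs at h
      exact h
    · rw [map_sub, hy.map_eq, hy.map_eq, Finset.sum_sub_distrib]
      congr 1
      refine Finset.sum_equiv (Equiv.swap a b) (by simp) fun j _ => ?_
      congr 1
      funext i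
      simp [Function.update_apply]
    · have hsa : s a = Sgn.minus := by rw [hs a ((hwn a).2 (.inr (.inl rfl))), hta]
      have hsb : s b = Sgn.plus := by rw [hs b ((hwn b).2 (.inl rfl)), htb]
      have hlt := intLT_comp_swap hplus hminus hd hab hsa hsb
      have h1 := hy.sub_mem s fun i hi => hs i ((hwn i).2 (.inr (.inr hi)))
      have h2 := hy.sub_mem (s ∘ Equiv.swap a b) fun i hi => by
        rw [Function.comp_apply, Equiv.swap_apply_of_ne_of_ne (hw i hi).1 (hw i hi).2]
        exact hs i ((hwn i).2 (.inr (.inr hi)))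
      have h3 : D (s ∘ Equiv.swap a b) ∈ lowerSpan D c s :=
        Submodule.subset_span ⟨_, hlt, rfl⟩
      have h4 := Submodule.sub_mem _ h1 (Submodule.add_mem _ (lowerSpan_le hlt h2) h3)
      have h5 : y s - y (s ∘ Equiv.swap a b) - D s =
          y s - D s - (y (s ∘ Equiv.swap a b) - D (s ∘ Equiv.swap a b) +
            D (s ∘ Equiv.swap a b)) := by abel
      rw [h5]
      exact h4
    · rw [hwn] at hi
      have hsa : s a = Sgn.minus := hs a ((hwn a).2 (.inr (.inl rfl))) hta
      rcases hi with rfl | rfl | hi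
      · have h1 : s ∘ Equiv.swap a i = s := by
          funext j
          by_cases hja : j = a
          · subst hja; simp [hsa, hsi]
          · by_cases hji : j = i
            · subst hji; simp [hsa, hsi]
            · simp [Equiv.swap_apply_of_ne_of_ne hja hji]
        rw [h1, sub_self]
      · rw [hta] at hti
        exact absurd hti (by decide)
      · rw [hy.eq_zero s i hi hti hsi fun j hj => hs j ((hwn j).2 (.inr (.inr hj))),
          hy.eq_zero (s ∘ Equiv.swap a b) i hi hti ?_ ?_, sub_self]
        · rw [Function.comp_apply, Equiv.swap_apply_of_ne_of_ne (hw i hi).1 (hw i hi).2, hsi]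
        · intro j hj htj
          rw [Function.comp_apply, Equiv.swap_apply_of_ne_of_ne (hw j hj).1 (hw j hj).2]
          exact hs j ((hwn j).2 (.inr (.inr hj))) htj

/-- For every `t` there is a vector with leading term `D t` that is killed by `e ^ (h₊(t) + 1)`. -/
theorem exists_leading_vector
    (he : ∀ s, e (D s) = ∑ j with s j = Sgn.plus, D (Function.update s j Sgn.minus))
    (hplus : ∀ s j, s j = Sgn.plus → c (Function.update s j Sgn.minus) = c s + d j)
    (hminus : ∀ s j, s j = Sgn.minus → c (Function.update s j Sgn.plus) = c s - d j)
    (hd : ∀ i j, i < j → IntLT (d i) (d j)) (t : Fin n → Sgn) :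
    ∃ v, v - D t ∈ lowerSpan D c t ∧ (e ^ ((signCrystal n).hPlus t + 1)) v = 0 := by
  obtain ⟨-, y, hy⟩ := exists_isCancelledFamily he hplus hminus hd t
    (isReducedForm_reducedForm t).1
  refine ⟨y t, hy.sub_mem t fun _ _ => rfl, ?_⟩
  rw [pow_apply_eq_sum_flipCount e y hy.map_eq]
  refine Finset.sum_eq_zero fun u _ => ?_
  by_cases h0 : flipCount Sgn.plus Sgn.minus ((signCrystal n).hPlus t + 1) t u = 0
  · rw [h0, zero_smul]
  obtain ⟨h1, h2⟩ := flipCount_ne_zero (by decide) _ _ _ h0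
  have hflip : ∀ i, t i ≠ u i → t i = Sgn.plus ∧ u i = Sgn.minus := by
    intro i hi
    rcases ht : t i with _ | _
    · rcases hu : u i with _ | _
      · rw [ht, hu] at hi; exact absurd rfl hi
      · exact ⟨rfl, rfl⟩
    · rw [ht, h1 i ht] at hi; exact absurd rfl hi
  -- There are more changed places than `+` signs in the reduced form.
  obtain ⟨i, hi, hi'⟩ := Finset.exists_mem_notMem_of_card_lt_card
    (s := reducedPositions Sgn.plus t) (t := Finset.univ.filter fun i => t i ≠ u i)
    (by rw [h2]; exact Nat.lt_succ_self _)
  obtain ⟨ht, hu⟩ := hflip i (Finset.mem_filter.1 hi).2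
  rw [hy.eq_zero u i ?_ ht hu fun j _ hj => h1 j hj, smul_zero]
  rcases hr : reducedForm t i with _ | s
  · rfl
  · have h3 := (exists_isCancelledFamily he hplus hminus hd t
      (isReducedForm_reducedForm t).1).1 i s hr
    rw [ht] at h3
    exact absurd (Finset.mem_filter.2 ⟨Finset.mem_univ i, by rw [hr, h3]⟩) hi'

end CancelledFamilies

/-! ### The raising operator on the labels of a block -/

section Blocks

variable {k : Type*} [Field k] {C : Type u} [Category.{v} C] [Abelian C] [Linear k C]
  {Λ : Type*} [PartialOrder Λ] {𝔄 : Type*}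
  {H : HighestWeightStructure k C Λ} {S : Sl2Categorification k C}

namespace HighestWeightCategorification

variable (W : HighestWeightCategorification H S 𝔄)

open scoped Classical in
/-- The signs of the label of the head (and socle) of `E L(σ_a(t))`; the value is `t` if
`E L(σ_a(t)) = 0`. -/
noncomputable def raise (a : 𝔄) (t : Fin (W.n a) → Sgn) : Fin (W.n a) → Sgn :=
  if h : ∃ s, ∃ g : S.E.obj (H.L (W.label a t)) ⟶ H.L (W.label a s), g ≠ 0 then h.choose else t

/-- The properties of `exists_raise`, with the label of the head of `E L(σ_a(t))` expressed by
signs. -/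
theorem raise_spec (a : 𝔄) (t : Fin (W.n a) → Sgn)
    (ht : 0 < maxPower S.E (H.L (W.label a t))) :
    (∃ j, t j = Sgn.plus ∧ W.raise a t = Function.update t j Sgn.minus) ∧
    maxPower S.E (H.L (W.label a (W.raise a t))) + 1 = maxPower S.E (H.L (W.label a t)) ∧
    (∀ ν, H.IsTop S (W.label a t) ν → H.IsTop S (W.label a (W.raise a t)) ν) ∧
    (∃ g : S.E.obj (H.L (W.label a t)) ⟶ H.L (W.label a (W.raise a t)), g ≠ 0) ∧
    (∃ g : H.L (W.label a (W.raise a t)) ⟶ S.E.obj (H.L (W.label a t)), g ≠ 0) ∧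
    (∀ y (g : S.E.obj (H.L (W.label a t)) ⟶ H.L y), g ≠ 0 → y = W.label a (W.raise a t)) ∧
    (∀ y (g : H.L y ⟶ S.E.obj (H.L (W.label a t))), g ≠ 0 → y = W.label a (W.raise a t)) := by
  obtain ⟨z, h1, h2, h3, h4, h5, h6⟩ := W.exists_raise ht
  obtain ⟨g, hg⟩ := h3
  obtain ⟨j, hj, rfl⟩ := W.isFlipFunctor_E.exists_flip hg
  have hex : ∃ s, ∃ g : S.E.obj (H.L (W.label a t)) ⟶ H.L (W.label a s), g ≠ 0 := ⟨_, g, hg⟩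
  have hr : W.raise a t = Function.update t j Sgn.minus := by
    rw [raise, dif_pos hex]
    obtain ⟨g', hg'⟩ := hex.choose_spec
    exact W.label_injective a (h5 _ g' hg')
  rw [hr]
  exact ⟨⟨j, hj, rfl⟩, h1, h2, ⟨g, hg⟩, h4, h5, h6⟩

theorem maxPower_E_pos (W : HighestWeightCategorification H S 𝔄) {x : Λ}
    (h : ¬ IsZero (S.E.obj (H.L x))) : 0 < maxPower S.E (H.L x) :=
  Nat.pos_of_ne_zero fun h0 => h ((W.isFlipFunctor_E.maxPower_eq_iff x 0).1 h0).2

theorem maxPower_E_pos_of_hom (W : HighestWeightCategorification H S 𝔄) {x y : Λ}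
    {g : S.E.obj (H.L x) ⟶ H.L y}
    (hg : g ≠ 0) : 0 < maxPower S.E (H.L x) :=
  W.maxPower_E_pos (fun h => hg (h.eq_of_src _ _))

theorem maxPower_E_pos_of_hom' (W : HighestWeightCategorification H S 𝔄) {x y : Λ}
    {g : H.L y ⟶ S.E.obj (H.L x)}
    (hg : g ≠ 0) : 0 < maxPower S.E (H.L x) :=
  W.maxPower_E_pos (fun h => hg (h.eq_of_tgt _ _))

theorem exists_hom_to_E {x y : Λ} {g : S.F.obj (H.L y) ⟶ H.L x} (hg : g ≠ 0) :
    ∃ g' : H.L y ⟶ S.E.obj (H.L x), g' ≠ 0 := by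
  obtain ⟨e⟩ := nonempty_homLinearEquiv (k := k) S.adj'.some (H.L y) (H.L x)
  exact ⟨e g, fun h => hg (by simpa using h)⟩

theorem exists_hom_from_E {x y : Λ} {g : H.L x ⟶ S.F.obj (H.L y)} (hg : g ≠ 0) :
    ∃ g' : S.E.obj (H.L x) ⟶ H.L y, g' ≠ 0 := by
  obtain ⟨e⟩ := nonempty_homLinearEquiv (k := k) S.adj (H.L x) (H.L y)
  exact ⟨e.symm g, fun h => hg (by simpa using h)⟩

theorem isRaising (a : 𝔄) :
    IsRaising (fun t => maxPower S.E (H.L (W.label a t))) (W.raise a) where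
  nonneg t := by
    have := W.maxPower_F_eq a t
    omega
  flip t ht := (W.raise_spec a t ht).1
  depth t ht := (W.raise_spec a t ht).2.1
  surj s hs := by
    rw [← W.maxPower_F_eq] at hs
    have hF : ¬ IsZero (S.F.obj (H.L (W.label a s))) := by
      intro h
      have := (W.isFlipFunctor_F.maxPower_eq_iff (W.label a s) 0).2 ⟨H.not_isZero_L _, h⟩
      omega
    obtain ⟨μ, p, hp⟩ := H.exists_epi_L hF
    have hp0 := H.ne_zero_of_epi p
    obtain ⟨j, -, rfl⟩ := W.isFlipFunctor_F.exists_flip hp0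
    obtain ⟨g, hg⟩ := exists_hom_to_E hp0
    have hpos := W.maxPower_E_pos_of_hom' hg
    exact ⟨_, hpos, (W.label_injective a ((W.raise_spec a _ hpos).2.2.2.2.2.2 _ g hg)).symm⟩

theorem isTop_iterate_raise (a : 𝔄) (i : ℕ) : ∀ (t : Fin (W.n a) → Sgn) (ν : Λ),
    maxPower S.E (H.L (W.label a t)) = i → H.IsTop S (W.label a t) ν →
    ν = W.label a ((W.raise a)^[i] t) := by
  induction i with
  | zero =>
    intro t ν ht hν
    have h1 := hν.mult_eq
    rw [ht] at h1
    have h2 : H.mult (H.L (W.label a t)) ν = 1 := h1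
    classical
    by_contra hne
    rw [H.mult_L, if_neg fun h => hne h.symm] at h2
    exact absurd h2 (by decide)
  | succ i ih =>
    intro t ν ht hν
    obtain ⟨-, h1, h2, -⟩ := W.raise_spec a t (by omega)
    exact ih _ ν (by omega) (h2 ν hν)

/-- The simple objects with the same value of `h₊` are distinguished by the constituents of
their highest powers `E^{h₊}`. -/
theorem eq_of_isTop (W : HighestWeightCategorification H S 𝔄) {x y ν : Λ}
    (hx : H.IsTop S x ν) (hy : H.IsTop S y ν)
    (hxy : maxPower S.E (H.L x) = maxPower S.E (H.L y)) : x = y := by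
  obtain ⟨a, t, rfl⟩ := W.exists_eq_label x
  obtain ⟨b, s, rfl⟩ := W.exists_eq_label y
  have h1 := W.isTop_iterate_raise a _ t ν rfl hx
  have h2 := W.isTop_iterate_raise b _ s ν rfl hy
  have h3 := h1.symm.trans h2
  obtain rfl := W.block_eq_of_label_eq h3
  rw [hxy] at h3
  rw [(W.isRaising a).iterate_injective _ t s hxy.ge le_rfl (W.label_injective a h3)]

/-- The basis of simple objects is perfect: a vector killed by `eᴺ` is a combination of classes of
simple objects with this property. -/
theorem maxPower_lt_of_pow_eq_zero (W : HighestWeightCategorification H S 𝔄)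
    {v : RatK0 C} {N : ℕ} (hv : (S.opE ^ N) v = 0) {x : Λ}
    (hx : H.basis.repr v x ≠ 0) : maxPower S.E (H.L x) < N := by
  by_contra hlt
  obtain ⟨z, hz, hmax⟩ := Finset.exists_max_image (H.basis.repr v).support
    (fun y => maxPower S.E (H.L y)) ⟨x, Finsupp.mem_support_iff.2 hx⟩
  have hxz := hmax x (Finsupp.mem_support_iff.2 hx)
  obtain ⟨j, hj⟩ := Nat.exists_eq_add_of_le' ((not_lt.1 hlt).trans hxz)
  obtain ⟨ν, hν⟩ := W.exists_isTop z
  have h1 : (S.opE ^ maxPower S.E (H.L z)) v = 0 := by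
    rw [hj, pow_add, Module.End.mul_apply, hv, map_zero]
  rw [ExactAdjointPair.opE, H.pow_map_eq] at h1
  have h2 := H.repr_map (iterF S.E (maxPower S.E (H.L z))) v ν
  -- Only `L(z)` contributes to the coefficient of `e^{h₊(z)} v` at `L(ν)`.
  rw [h1, map_zero, Finsupp.zero_apply, Finset.sum_eq_single z, hν.mult_eq] at h2
  · exact mul_ne_zero (Finsupp.mem_support_iff.1 hz)
      (Nat.cast_ne_zero.2 (Nat.factorial_ne_zero _)) h2.symm
  · intro y hy hyz
    by_contra hne
    have h3 : H.mult ((iterF S.E (maxPower S.E (H.L z))).obj (H.L y)) ν ≠ 0 := fun h => hne (by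
      rw [h, Nat.cast_zero, mul_zero])
    have h4 : maxPower S.E (H.L y) = maxPower S.E (H.L z) := by
      refine le_antisymm (hmax y hy) ?_
      by_contra hc
      refine h3 ?_
      have h5 := isZero_iterF_of_le (not_le.1 hc)
        ((W.isFlipFunctor_E.maxPower_eq_iff y _).1 rfl).2
      have h6 := H.repr_cls ((iterF S.E (maxPower S.E (H.L z))).obj (H.L y)) ν
      rw [RatK0.cls_isZero h5, map_zero, Finsupp.zero_apply] at h6
      exact_mod_cast h6.symm
    obtain ⟨ν', hν'⟩ := W.exists_isTop y
    rw [← h4] at h3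
    obtain rfl : ν = ν' := by
      by_contra hνν
      exact h3 (hν'.mult_eq_zero ν hνν)
    exact hyz (W.eq_of_isTop hν' hν h4)
  · exact fun h => absurd hz h

/-- The vector with leading term `[Δ(σ_a(t))]` involves `L(σ_a(t))` with coefficient `1`. -/
theorem maxPower_E_le (a : 𝔄) (t : Fin (W.n a) → Sgn) :
    maxPower S.E (H.L (W.label a t)) ≤ (signCrystal (W.n a)).hPlus t := by
  obtain ⟨v, hv, hev⟩ := exists_leading_vector (e := S.opE)
    (D := fun s => RatK0.cls (H.Δ (W.label a s))) (c := fun s => W.c (W.label a s))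
    (W.isFlipFunctor_E.map_cls a) (W.hwc3_e a) (W.hwc3_f a) (W.hwc4 a) t
  refine Nat.lt_succ_iff.1 (W.maxPower_lt_of_pow_eq_zero hev ?_)
  have h1 : lowerSpan (fun s => RatK0.cls (H.Δ (W.label a s))) (fun s => W.c (W.label a s)) t ≤
      LinearMap.ker (H.basis.coord (W.label a t)) := by
    refine Submodule.span_le.2 ?_
    rintro _ ⟨s, hs, rfl⟩
    rw [SetLike.mem_coe, LinearMap.mem_ker, Module.Basis.coord_apply, H.repr_cls, Nat.cast_eq_zero]
    by_contra hne
    rcases (H.le_of_mult_Δ_ne_zero hne).eq_or_lt with h | h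
    · simp only [h] at hs
      exact IntLT.irrefl _ hs
    · exact IntLT.irrefl _ (hs.trans (W.hwc1 _ _ h))
  have h2 := LinearMap.mem_ker.1 (h1 hv)
  rw [map_sub, sub_eq_zero, Module.Basis.coord_apply, Module.Basis.coord_apply, H.repr_cls,
    H.mult_Δ_self] at h2
  rw [h2]
  simp

theorem maxPower_E_label (a : 𝔄) (t : Fin (W.n a) → Sgn) :
    maxPower S.E (H.L (W.label a t)) = (signCrystal (W.n a)).hPlus t :=
  (W.isRaising a).depth_eq signCrystal_isRaising (W.maxPower_E_le a) t

theorem maxPower_F_label (a : 𝔄) (t : Fin (W.n a) → Sgn) :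
    maxPower S.F (H.L (W.label a t)) = (signCrystal (W.n a)).hMinus t := by
  have h1 := W.maxPower_F_eq a t
  rw [W.maxPower_E_label, signCrystal_wt_eq] at h1
  omega

theorem raise_eq_signRaise (a : 𝔄) {t : Fin (W.n a) → Sgn}
    (ht : 0 < (signCrystal (W.n a)).hPlus t) : W.raise a t = signRaise t := by
  have h := W.isRaising a
  simp only [W.maxPower_E_label] at h
  exact h.eq_signRaise ht

end HighestWeightCategorification

end Blocks

/-! ### The operators of the crystal of simple objects -/

section CrystalOperators

variable {C : Type u} [Category.{v} C] [Abelian C]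

theorem HasSimpleSocle.of_iso {M M' T T' : C} (h : HasSimpleSocle M T) (eM : M ≅ M')
    (eT : T ≅ T') : HasSimpleSocle M' T' := by
  obtain ⟨hT, i, hi, hu⟩ := h
  refine ⟨Simple.of_iso eT.symm, eT.inv ≫ i ≫ eM.hom, inferInstance, fun Q hQ g => ?_⟩
  obtain ⟨h, hh⟩ := hu Q hQ (g ≫ eM.inv)
  exact ⟨h ≫ eT.hom, by
    rw [Category.assoc, eT.hom_inv_id_assoc, reassoc_of% hh, eM.inv_hom_id, Category.comp_id]⟩

theorem HasSimpleHead.of_iso {M M' T T' : C} (h : HasSimpleHead M T) (eM : M ≅ M')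
    (eT : T ≅ T') : HasSimpleHead M' T' := by
  obtain ⟨hT, p, hp, hu⟩ := h
  refine ⟨Simple.of_iso eT.symm, eM.inv ≫ p ≫ eT.hom, inferInstance, fun Q hQ g => ?_⟩
  obtain ⟨h, hh⟩ := hu Q hQ (eM.hom ≫ g)
  exact ⟨eT.inv ≫ h, by simp [hh]⟩

theorem HasSimpleHead.nonempty_iso {M T T' : C} (h : HasSimpleHead M T)
    (h' : HasSimpleHead M T') : Nonempty (T ≅ T') := by
  obtain ⟨hT, p, hp, hu⟩ := h
  obtain ⟨hT', p', hp', -⟩ := h'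
  obtain ⟨q, hq⟩ := hu T' hT' p'
  have hq0 : q ≠ 0 := by
    rintro rfl
    rw [comp_zero] at hq
    subst hq
    exact Simple.not_isZero T' (IsZero.of_epi_zero M T')
  have := isIso_of_hom_simple hq0
  exact ⟨asIso q⟩

theorem SimpleClass.eq_of_iso {x y : SimpleClass C} (e : x.obj ≅ y.obj) : x = y := by
  refine Subtype.ext ?_
  rw [← Quotient.out_eq x.1, ← Quotient.out_eq y.1]
  exact Quotient.sound (s := isIsomorphicSetoid C) ⟨e⟩

theorem SimpleClass.nonempty_obj_mk_iso (M : C) (hM : Simple M) :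
    Nonempty ((SimpleClass.mk M hM).obj ≅ M) :=
  Quotient.exact (s := isIsomorphicSetoid C)
    (Quotient.out_eq (Quotient.mk (isIsomorphicSetoid C) M))

theorem crystalOp_eq_some {G : C ⥤ C} {x y : SimpleClass C}
    (hs : HasSimpleSocle (G.obj x.obj) y.obj) (hh : HasSimpleHead (G.obj x.obj) y.obj) :
    crystalOp G x = some y := by
  have hex : ∃ y : SimpleClass C,
    HasSimpleSocle (G.obj x.obj) y.obj ∧ HasSimpleHead (G.obj x.obj) y.obj := ⟨y, hs, hh⟩
  rw [crystalOp, dif_pos hex, Option.some_inj]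
  obtain ⟨e⟩ := hex.choose_spec.2.nonempty_iso hh
  exact SimpleClass.eq_of_iso e

theorem crystalOp_eq_none {G : C ⥤ C} {x : SimpleClass C} (h : IsZero (G.obj x.obj)) :
    crystalOp G x = none := by
  rw [crystalOp, dif_neg]
  rintro ⟨y, ⟨hy, i, hi, -⟩, -⟩
  exact Simple.not_isZero y.obj (IsZero.of_mono i h)

theorem maxPower_congr {C : Type u} [Category.{v} C] (G : C ⥤ C) {M N : C} (e : M ≅ N) :
    maxPower G M = maxPower G N := by
  have : {i : ℕ | ¬ IsZero (G.obj^[i] M)} = {i : ℕ | ¬ IsZero (G.obj^[i] N)} := by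
    ext i
    simp only [Set.mem_ofPred_eq, ← iterF_obj]
    rw [((iterF G i).mapIso e).isZero_iff]
  rw [maxPower, this, maxPower]

theorem ExactAdjointPair.weight_eq {k : Type*} [Field k] [Linear k C] (A : ExactAdjointPair k C)
    {M : C} (hM : RatK0.cls M ≠ 0) {w : ℤ} (hw : A.opH (RatK0.cls M) = (w : ℚ) • RatK0.cls M) :
    A.weight M = w := by
  have hex : ∃ w : ℤ, A.opH (RatK0.cls M) = (w : ℚ) • RatK0.cls M := ⟨w, hw⟩
  rw [ExactAdjointPair.weight, dif_pos hex]
  have := smul_left_injective ℚ hM (hex.choose_spec.symm.trans hw)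
  exact_mod_cast this

end CrystalOperators

/-! ### Crystals covered by crystals -/

section Cover

/-- A structure covered by the images of morphisms from crystals is a crystal. -/
theorem CrystalData.isCrystal_of_cover {B : Type*} (K : CrystalData B) {ι : Type*} {B' : ι → Type*}
    (K' : ∀ i, CrystalData (B' i)) (hK' : ∀ i, (K' i).IsCrystal) (φ : ∀ i, B' i → B)
    (hφ : ∀ i, IsCrystalHom (K' i) K (φ i)) (hcov : ∀ b, ∃ i b', φ i b' = b) : K.IsCrystal where
  wt_eq b := by
    obtain ⟨i, b, rfl⟩ := hcov b
    rw [(hφ i).wt, (hφ i).hPlus, (hφ i).hMinus, (hK' i).wt_eq]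
  e_eq_none_iff b := by
    obtain ⟨i, b, rfl⟩ := hcov b
    rw [(hφ i).e, (hφ i).hPlus, Option.map_eq_none_iff, (hK' i).e_eq_none_iff]
  f_eq_none_iff b := by
    obtain ⟨i, b, rfl⟩ := hcov b
    rw [(hφ i).f, (hφ i).hMinus, Option.map_eq_none_iff, (hK' i).f_eq_none_iff]
  e_eq_some_iff b b' := by
    constructor
    · intro h
      obtain ⟨i, b, rfl⟩ := hcov b
      rw [(hφ i).e, Option.map_eq_some_iff] at h
      obtain ⟨s, hs, rfl⟩ := h
      rw [(hφ i).f, ((hK' i).e_eq_some_iff b s).1 hs, Option.map_some]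
    · intro h
      obtain ⟨i, b', rfl⟩ := hcov b'
      rw [(hφ i).f, Option.map_eq_some_iff] at h
      obtain ⟨s, hs, rfl⟩ := h
      rw [(hφ i).e, ((hK' i).e_eq_some_iff s b').2 hs, Option.map_some]
  h_of_e b b' h := by
    obtain ⟨i, b, rfl⟩ := hcov b
    rw [(hφ i).e, Option.map_eq_some_iff] at h
    obtain ⟨s, hs, rfl⟩ := h
    rw [(hφ i).hPlus, (hφ i).hPlus, (hφ i).hMinus, (hφ i).hMinus]
    exact (hK' i).h_of_e b s hs

/-- The structure on `B'` obtained from a structure on `B` along a bijection. -/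
def CrystalData.transport {B B' : Type*} (K : CrystalData B) (ψ : B ≃ B') : CrystalData B' where
  wt b := K.wt (ψ.symm b)
  e b := (K.e (ψ.symm b)).map ψ
  f b := (K.f (ψ.symm b)).map ψ
  hPlus b := K.hPlus (ψ.symm b)
  hMinus b := K.hMinus (ψ.symm b)

theorem CrystalData.isCrystalHom_transport {B B' : Type*} (K : CrystalData B) (ψ : B ≃ B') :
    IsCrystalHom K (K.transport ψ) ψ := by
  constructor <;> intro b <;> simp [CrystalData.transport]

/-- The image of an injective morphism from a crystal is a subcrystal isomorphic to it. -/
theorem exists_isSubcrystal {B B' : Type*} {K : CrystalData B} {K' : CrystalData B'}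
    (hK' : K'.IsCrystal) {s : Set B} (ψ : B' → s) (hψ : Function.Bijective ψ)
    (hφ : IsCrystalHom K' K fun b => (ψ b : B)) :
    ∃ Ks : CrystalData s, IsSubcrystal K s Ks ∧ IsCrystalIso K' Ks ψ := by
  have hhom := K'.isCrystalHom_transport (Equiv.ofBijective ψ hψ)
  refine ⟨K'.transport (Equiv.ofBijective ψ hψ), ⟨?_, ?_⟩, hψ, hhom⟩
  · exact CrystalData.isCrystal_of_cover _ (fun _ : Unit => K') (fun _ => hK') (fun _ => ψ)
      (fun _ => hhom) fun b => ⟨(), hψ.2 b⟩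
  · constructor <;> intro b <;> obtain ⟨b, rfl⟩ := hψ.2 b
    · exact (hφ.wt b).trans (hhom.wt b).symm
    · exact (hφ.hPlus b).trans (hhom.hPlus b).symm
    · exact (hφ.hMinus b).trans (hhom.hMinus b).symm
    · refine (hφ.e b).trans ?_
      have h := hhom.e b
      rw [Equiv.ofBijective_apply] at h
      rw [h, Option.map_map]
      rfl
    · refine (hφ.f b).trans ?_
      have h := hhom.f b
      rw [Equiv.ofBijective_apply] at h
      rw [h, Option.map_map]
      rfl

end Cover

/-! ### The crystal of a highest weight categorification -/

section Assembly

variable {k : Type*} [Field k] {C : Type u} [Category.{v} C] [Abelian C] [Linear k C]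
  {Λ : Type*} [PartialOrder Λ] {𝔄 : Type*}
  {H : HighestWeightStructure k C Λ} {S : Sl2Categorification k C}

namespace HighestWeightStructure

variable (H)

theorem nonempty_obj_iso (x : Λ) : Nonempty ((H.simpleClass x).obj ≅ H.L x) :=
  SimpleClass.nonempty_obj_mk_iso _ _

theorem simpleClass_injective : Function.Injective H.simpleClass := by
  intro x y h
  obtain ⟨e⟩ := H.nonempty_obj_iso x
  obtain ⟨e'⟩ := H.nonempty_obj_iso y
  rw [← h] at e'
  exact H.eq_of_iso (e.symm ≪≫ e')

theorem exists_eq_simpleClass (b : SimpleClass C) : ∃ x, H.simpleClass x = b := by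
  obtain ⟨x, ⟨e⟩, -⟩ := H.classification b.obj b.2
  obtain ⟨e'⟩ := H.nonempty_obj_iso x
  exact ⟨x, SimpleClass.eq_of_iso (e' ≪≫ e.symm)⟩

theorem crystalOp_simpleClass_eq_some {G : C ⥤ C} {x z : Λ}
    (hi : ∃ i : H.L z ⟶ G.obj (H.L x), i ≠ 0) (hp : ∃ p : G.obj (H.L x) ⟶ H.L z, p ≠ 0)
    (hi1 : Module.finrank k (H.L z ⟶ G.obj (H.L x)) ≤ 1)
    (hp1 : Module.finrank k (G.obj (H.L x) ⟶ H.L z) ≤ 1)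
    (hiu : ∀ y (g : H.L y ⟶ G.obj (H.L x)), g ≠ 0 → y = z)
    (hpu : ∀ y (g : G.obj (H.L x) ⟶ H.L y), g ≠ 0 → y = z) :
    crystalOp G (H.simpleClass x) = some (H.simpleClass z) := by
  obtain ⟨i, hi⟩ := hi
  obtain ⟨p, hp⟩ := hp
  obtain ⟨ex⟩ := H.nonempty_obj_iso x
  obtain ⟨ez⟩ := H.nonempty_obj_iso z
  exact crystalOp_eq_some ((H.hasSimpleSocle hi hi1 hiu).of_iso (G.mapIso ex.symm) ez.symm)
    ((H.hasSimpleHead hp hp1 hpu).of_iso (G.mapIso ex.symm) ez.symm)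

theorem crystalOp_simpleClass_eq_none {G : C ⥤ C} {x : Λ} (h : IsZero (G.obj (H.L x))) :
    crystalOp G (H.simpleClass x) = none := by
  obtain ⟨ex⟩ := H.nonempty_obj_iso x
  exact crystalOp_eq_none ((G.mapIso ex).isZero_iff.2 h)

end HighestWeightStructure

namespace HighestWeightCategorification

variable (W : HighestWeightCategorification H S 𝔄)

theorem crystalOp_E (a : 𝔄) (t : Fin (W.n a) → Sgn) :
    crystalOp S.E (H.simpleClass (W.label a t)) =
      ((signCrystal (W.n a)).e t).map fun s => H.simpleClass (W.label a s) := by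
  rcases Nat.eq_zero_or_pos ((signCrystal (W.n a)).hPlus t) with h0 | hpos
  · rw [((signCrystal_isCrystal _).e_eq_none_iff t).2 h0, Option.map_none]
    rw [← W.maxPower_E_label] at h0
    exact H.crystalOp_simpleClass_eq_none ((W.isFlipFunctor_E.maxPower_eq_iff _ 0).1 h0).2
  · rw [signCrystal_e_eq_some hpos, Option.map_some, ← W.raise_eq_signRaise a hpos]
    obtain ⟨-, -, -, h1, h2, h3, h4⟩ := W.raise_spec a t (by rwa [W.maxPower_E_label])
    exact H.crystalOp_simpleClass_eq_some h2 h1 (W.finrank_hom_to_E_le_one _ _)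
      (W.finrank_hom_E_le_one _ _) h4 h3

/-- If `L(t)` occurs in the head or socle of `E L(y)`, then `y` is the label of `f̃ t`. -/
theorem eq_label_of_raise (a : 𝔄) {t s : Fin (W.n a) → Sgn}
    (hs : (signCrystal (W.n a)).f t = some s) {y : Λ}
    (hy : (∃ g : S.E.obj (H.L y) ⟶ H.L (W.label a t), g ≠ 0) ∨
      ∃ g : H.L (W.label a t) ⟶ S.E.obj (H.L y), g ≠ 0) : y = W.label a s := by
  have hes := ((signCrystal_isCrystal _).e_eq_some_iff s t).2 hs
  have hpos : 0 < (signCrystal (W.n a)).hPlus s := by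
    refine Nat.pos_of_ne_zero fun h => ?_
    rw [((signCrystal_isCrystal _).e_eq_none_iff s).2 h] at hes
    exact absurd hes (by simp)
  rw [signCrystal_e_eq_some hpos, ← W.raise_eq_signRaise a hpos, Option.some_inj] at hes
  obtain ⟨b, r, rfl⟩ := W.exists_eq_label y
  have hrpos : 0 < maxPower S.E (H.L (W.label b r)) := by
    rcases hy with ⟨g, hg⟩ | ⟨g, hg⟩
    · exact W.maxPower_E_pos_of_hom hg
    · exact W.maxPower_E_pos_of_hom' hg
  obtain ⟨-, -, -, -, -, h1, h2⟩ := W.raise_spec b r hrpos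
  have h3 : W.label a t = W.label b (W.raise b r) := by
    rcases hy with ⟨g, hg⟩ | ⟨g, hg⟩
    · exact h1 _ g hg
    · exact h2 _ g hg
  obtain rfl := W.block_eq_of_label_eq h3
  rw [← hes] at h3
  rw [(W.isRaising a).injOn (by simpa [W.maxPower_E_label] using hpos) hrpos
    (W.label_injective a h3)]

theorem crystalOp_F (a : 𝔄) (t : Fin (W.n a) → Sgn) :
    crystalOp S.F (H.simpleClass (W.label a t)) =
      ((signCrystal (W.n a)).f t).map fun s => H.simpleClass (W.label a s) := by
  rcases hf : (signCrystal (W.n a)).f t with _ | s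
  · rw [(signCrystal_isCrystal _).f_eq_none_iff, ← W.maxPower_F_label] at hf
    exact H.crystalOp_simpleClass_eq_none ((W.isFlipFunctor_F.maxPower_eq_iff _ 0).1 hf).2
  · have hF : ¬ IsZero (S.F.obj (H.L (W.label a t))) := by
      intro h
      have h1 := (W.isFlipFunctor_F.maxPower_eq_iff (W.label a t) 0).2 ⟨H.not_isZero_L _, h⟩
      rw [W.maxPower_F_label, ← (signCrystal_isCrystal _).f_eq_none_iff, hf] at h1
      exact absurd h1 (by simp)
    have hiu : ∀ y (g : H.L y ⟶ S.F.obj (H.L (W.label a t))), g ≠ 0 → y = W.label a s :=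
      fun y g hg => W.eq_label_of_raise a hf (.inl (exists_hom_from_E hg))
    have hpu : ∀ y (g : S.F.obj (H.L (W.label a t)) ⟶ H.L y), g ≠ 0 → y = W.label a s :=
      fun y g hg => W.eq_label_of_raise a hf (.inr (exists_hom_to_E hg))
    obtain ⟨y, i, hi⟩ := H.exists_mono_L hF
    obtain ⟨z, p, hp⟩ := H.exists_epi_L hF
    have hi0 := H.ne_zero_of_mono i
    have hp0 := H.ne_zero_of_epi p
    obtain rfl := hiu y i hi0
    obtain rfl := hpu z p hp0
    exact H.crystalOp_simpleClass_eq_some ⟨i, hi0⟩ ⟨p, hp0⟩ (W.finrank_hom_to_F_le_one _ _)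
      (W.finrank_hom_F_le_one _ _) hiu hpu

theorem isCrystalHom (a : 𝔄) : IsCrystalHom (signCrystal (W.n a)) S.crystal
    fun t => H.simpleClass (W.label a t) where
  wt t := by
    obtain ⟨e⟩ := H.nonempty_obj_iso (W.label a t)
    have h := RatK0.cls_iso e
    refine S.weight_eq (h ▸ H.cls_L_ne_zero _) ?_
    rw [h, W.opH_cls_L]
  hPlus t := by
    obtain ⟨e⟩ := H.nonempty_obj_iso (W.label a t)
    exact (maxPower_congr _ e).trans (W.maxPower_E_label a t)
  hMinus t := by
    obtain ⟨e⟩ := H.nonempty_obj_iso (W.label a t)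
    exact (maxPower_congr _ e).trans (W.maxPower_F_label a t)
  e t := W.crystalOp_E a t
  f t := W.crystalOp_F a t

theorem bijective_labelMap (a : 𝔄) : Function.Bijective (W.labelMap a) := by
  refine ⟨fun t s h => ?_, ?_⟩
  · exact W.label_injective a (H.simpleClass_injective (congrArg Subtype.val h))
  · rintro ⟨_, x, hx, rfl⟩
    exact ⟨(W.σ a).symm ⟨x, hx⟩, Subtype.ext (by simp [labelMap])⟩

end HighestWeightCategorification

end Assembly

end HWSl2

open HWSl2

theorem theorem5p1 {k : Type*} [Field k] {C : Type*} [Category* C] [Abelian C] [Linear k C]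
    {Λ : Type*} [PartialOrder Λ] {𝔄 : Type*}
    (H : HighestWeightStructure k C Λ) (S : Sl2Categorification k C)
    (W : HighestWeightCategorification H S 𝔄) :
    S.crystal.IsCrystal ∧
    ∀ a : 𝔄, (signCrystal (W.n a)).IsCrystal ∧
      ∃ K : CrystalData (W.blockSimples a),
        IsSubcrystal S.crystal (W.blockSimples a) K ∧
        IsCrystalIso (signCrystal (W.n a)) K (W.labelMap a) := by
  refine ⟨?_, fun a => ⟨signCrystal_isCrystal _,
    exists_isSubcrystal (signCrystal_isCrystal _) _ (W.bijective_labelMap a) (W.isCrystalHom a)⟩⟩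
  refine CrystalData.isCrystal_of_cover _ (fun a => signCrystal (W.n a))
    (fun _ => signCrystal_isCrystal _) (fun a t => H.simpleClass (W.label a t)) W.isCrystalHom
    fun b => ?_
  obtain ⟨x, rfl⟩ := H.exists_eq_simpleClass b
  obtain ⟨a, t, rfl⟩ := W.exists_eq_label x
  exact ⟨a, t, rfl⟩
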